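/- **Setting.** For each $n\in\mathbb N$ let $p=p_n$, let $\beta^o=\beta^o_n\in\mathbb R^p$, let $\lambda_0=\lambda_{0,n}\ge 0$ be a baseline hazard, and let $(\tilde T,U,\mathcal Z)$, $\mathcal Z=\{Z(t):t\in\mathcal T\}$, be a generic triple of non-negative failure and censoring times and a jointly measurable (e.g. predictable) $\mathbb R^p$-valued covariate process, whose law may depend on $n$. Put $T=\min(\tilde T,U)$, $\delta=\mathbf 1_{\{\tilde T\le U\}}$, $Y(t)=\mathbf 1_{\{T\ge t\}}$, $N(t)=\mathbf 1_{\{T\le t,\delta=1\}}$, $t_+=\inf\{t\ge0:\mathbb P(T\le t)=1\}$, and $\mathcal T=[0,t_+]$ if $t_+<\infty$, $\mathcal T=[0,\infty)$ otherwise. Given $\mathcal Z$, $\tilde T$ and $U$ are conditionally independent, and $\tilde T$ has conditional hazard $\lambda_0(t)\exp\{\beta^{o\top}Z(t)\}$, i.e. $\mathbb P(\tilde T>t\mid\mathcal Z)=\exp\{-\int_0^t\lambda_0(s)e^{\beta^{o\top}Z(s)}ds\}$ for $0\le t<t_+$. We observe $n$ independent copies $(T_i,\delta_i,\mathcal Z_i)$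 of $(T,\delta,\mathcal Z)$, with associated $Y_i,N_i$. Write $\tilde w_i(s,\beta)=Y_i(s)e^{\beta^\top Z_i(s)}$, $w_i=\tilde w_i/\sum_j\tilde w_j$ (with $0/0=0$), $\bar Z(s,\beta)=\sum_i Z_i(s)w_i(s,\beta)$, and let $$\ell(\beta)=\frac1n\sum_{i=1}^n\int_{\mathcal T}\Bigl(\beta^\top Z_i(s)-\log\sum_{j=1}^n\tilde w_j(s,\beta)\Bigr)dN_i(s)$$ be the log-partial likelihood, with gradient $\dot\ell(\beta)=\frac1n\sum_i\int\{Z_i(s)-\bar Z(s,\beta)\}\,dN_i(s)$ and Hessian $\ddot\ell$. Let $$\mu(t)=\frac{\mathbb E\{Z(t)Y(t)e^{\beta^{o\top}Z(t)}\}}{\mathbb E\{Y(t)e^{\beta^{o\top}Z(t)}\}},\quad \Sigma=\mathbb E\int_{\mathcal T}\{Z(s)-\mu(s)\}^{\otimes2}dN(s),\quad \widehat{\mathcal V}(\beta)=\frac1n\sum_{i=1}^n\int_{\mathcal T}\{Z_i(s)-\bar Z(s,\beta)\}^{\otimes2}dN_i(s),$$ and assume that $\Sigma$ is invertible. For a matrix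 $A$, let $\|A\|_{\mathrm{op},1}=\sup_{v\ne0}\|Av\|_1/\|v\|_1$. Let $\mathcal S=\{j:\beta^o_j\ne0\}$, $\mathcal N=\mathcal S^c$, $d_o=|\mathcal S|$, $r_j=|\{i:(\Sigma^{-1})_{ij}\ne0\}|$. For $\lambda>0$, $\hat\beta$ is any minimiser over $\beta\in\mathbb R^p$ of $-\ell(\beta)+\lambda\|\beta\|_1$. For $\lambda_n>0$, $\hat\Theta$ is any $p\times p$ matrix whose $j$th row, for each $j$, has minimal $\ell_1$ norm among all $b\in\mathbb R^p$ with $\|\widehat{\mathcal V}(\hat\beta)b-e_j\|_\infty\le\lambda_n$, whenever such $b$ exist (it is arbitrary otherwise). **Assumptions.** There are constants $K_Z,L,C,B,\delta_0>0$, not depending on $n$, such that: * (A1) $\mathbb P(\|Z(t)\|_\infty\le K_Z)=1$ for all $t\in\mathcal T$, and almost surely $\|Z(s)-Z(t)\|_\infty\le L|s-t|$ for all $s,t\in\mathcal T$; * (A2)(a) $T$ has a Lebesgue density bounded by $C$; * $\|\beta^o\|_1\le B$; * (A3)(b) $d_o=o(n^{1/2}/\log^{1/2}(np))$; and, along those $n$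 (if there are infinitely many) for which $\beta^o=0$, $p=o(e^{n^a})$ for every $a>0$; * (A4)(a) $1/\kappa=O_p(1)$, where $$\kappa=\inf\Bigl\{\frac{d_o^{1/2}\{-v^\top\ddot\ell(\beta^o)v\}^{1/2}}{\|v_{\mathcal S}\|_1}: v\in\mathbb R^p\setminus\{0\},\ \|v_{\mathcal N}\|_1\le2\|v_{\mathcal S}\|_1\Bigr\}$$ ($\inf\emptyset=\infty$); * (A4)(c) $\|\Sigma^{-1}\|_{\mathrm{op},1}^2\max\bigl\{\frac{d_o\log(np)}{n^{1/2}},n^{-(1/3-\delta_0)}\bigr\}\max_jr_j=o\bigl(\log^{-1/2}(np)\bigr)$. **Proposition 2.** For every $K_Z>0$ there is a constant $A_0>0$, depending only on $K_Z$, such that the following holds. Under the above assumptions, let $\lambda\asymp n^{-1/2}\log^{1/2}(np)$ with $\lambda\ge A_0n^{-1/2}\log^{1/2}(np)$ for all large $n$, and let $$\lambda_n\asymp\max\Bigl(\|\Sigma^{-1}\|_{\mathrm{op},1}\frac{d_o\log(np)}{n^{1/2}},\ \|\Sigma^{-1}\|_{\mathrm{op},1}n^{-(1/3-\delta_0)}\Bigr).$$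 Then for every sequence $c=c_n\in\mathbb R^p$ with $\|c\|_1=1$, $$c^\top(\hat\Theta-\Sigma^{-1})\dot\ell(\beta^o)=o_p(n^{-1/2}).$$ -/

import Mathlib

open MeasureTheory Filter Topology Asymptotics Matrix

noncomputable section

namespace Cox

/-- The `ℓ₁` norm of a vector. -/
def l1 {p : ℕ} (v : Fin p → ℝ) : ℝ := ∑ j, |v j|

/-- The operator `ℓ₁` norm `sup_{v ≠ 0} ‖A v‖₁ / ‖v‖₁`. -/
def opOne {p : ℕ} (A : Matrix (Fin p) (Fin p) ℝ) : ℝ :=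
  ⨆ v : {v : Fin p → ℝ // v ≠ 0}, l1 (A *ᵥ v.1) / l1 v.1

/-- The largest number of non-zero entries in a column. -/
def maxColSupport {p : ℕ} (A : Matrix (Fin p) (Fin p) ℝ) : ℕ :=
  Finset.univ.sup fun j => {i : Fin p | A i j ≠ 0}.ncard

/-- The number of non-zero coordinates. -/
def sparsity {p : ℕ} (β : Fin p → ℝ) : ℕ := {j : Fin p | β j ≠ 0}.ncard

/-- A failure time, a censoring time and a `p`-variate covariate process on a sample space `Ω`.
The covariate process is used at times of the time index set only. -/
structure Triple (Ω : Type*) (p : ℕ) where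
  /-- The failure time. -/
  failure : Ω → ℝ
  /-- The censoring time. -/
  censor : Ω → ℝ
  /-- The covariate process. -/
  covariate : ℝ → Ω → Fin p → ℝ

namespace Triple

variable {Ω : Type*} {p : ℕ}

/-- The observed (possibly censored) time. -/
def time (X : Triple Ω p) (ω : Ω) : ℝ := min (X.failure ω) (X.censor ω)

/-- The indicator that failure is observed. -/
def event (X : Triple Ω p) (ω : Ω) : ℝ := if X.failure ω ≤ X.censor ω then 1 else 0

/-- The at-risk indicator. -/
def atRisk (X : Triple Ω p) (t : ℝ) (ω : Ω) : ℝ := if t ≤ X.time ω then 1 else 0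

/-- The unnormalised weight `Y(t) exp(βᵀ Z(t))`. -/
def weight (X : Triple Ω p) (t : ℝ) (β : Fin p → ℝ) (ω : Ω) : ℝ :=
  X.atRisk t ω * Real.exp (β ⬝ᵥ X.covariate t ω)

/-- The integral `∫ g dN` against the counting process `N(t) = 1{T ≤ t, δ = 1}`, which has a
single jump, of size one, at `T` if failure is observed and no jump otherwise. -/
def integralN (X : Triple Ω p) (g : ℝ → ℝ) (ω : Ω) : ℝ := X.event ω * g (X.time ω)

variable [MeasurableSpace Ω]

/-- The upper limit `inf {t ≥ 0 : F_T(t) = 1}` of the support of the observed time, `⊤` if there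
is no such `t`. -/
def tPlus (X : Triple Ω p) (P : Measure Ω) : EReal :=
  sInf ((fun t : ℝ => (t : EReal)) '' {t : ℝ | 0 ≤ t ∧ P {ω | X.time ω ≤ t} = 1})

/-- The time index set: `[0, t₊]` if `t₊ < ∞` and `[0, ∞)` otherwise. -/
def timeSet (X : Triple Ω p) (P : Measure Ω) : Set ℝ :=
  {t : ℝ | 0 ≤ t ∧ (t : EReal) ≤ X.tPlus P}

/-- The σ-algebra generated by the whole covariate process on the time index set. -/
abbrev covariateSigma (X : Triple Ω p) (P : Measure Ω) : MeasurableSpace Ω :=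
  ⨆ t ∈ X.timeSet P, MeasurableSpace.comap (X.covariate t) inferInstance

/-- The Cox proportional hazards model with regression vector `β` and baseline hazard `haz`:
failure and censoring times are conditionally independent given the covariate process, and the
conditional hazard of the failure time given the covariate process is
`haz t * exp (βᵀ Z(t))` for `0 ≤ t < t₊`, expressed through the conditional survival function. -/
structure IsCoxModel (X : Triple Ω p) (P : Measure Ω) (β : Fin p → ℝ) (haz : ℝ → ℝ) :
    Prop where
  measurable_failure : Measurable X.failure
  measurable_censor : Measurable X.censor
  /-- Joint measurability; every predictable process has it. -/
  measurable_covariate : Measurable fun q : ℝ × Ω => X.covariate q.1 q.2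
  failure_nonneg : ∀ ω, 0 ≤ X.failure ω
  censor_nonneg : ∀ ω, 0 ≤ X.censor ω
  condIndep : ∀ s u : Set ℝ, MeasurableSet s → MeasurableSet u →
    P[(X.failure ⁻¹' s ∩ X.censor ⁻¹' u).indicator (fun _ => (1 : ℝ)) | X.covariateSigma P]
      =ᵐ[P] fun ω =>
        (P[(X.failure ⁻¹' s).indicator (fun _ => (1 : ℝ)) | X.covariateSigma P]) ω *
        (P[(X.censor ⁻¹' u).indicator (fun _ => (1 : ℝ)) | X.covariateSigma P]) ω
  haz_nonneg : ∀ t, 0 ≤ haz t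
  haz_integrable : ∀ t : ℝ, 0 ≤ t → (t : EReal) < X.tPlus P →
    IntegrableOn haz (Set.Icc 0 t) volume
  hazard : ∀ t : ℝ, 0 ≤ t → (t : EReal) < X.tPlus P →
    P[{ω | t < X.failure ω}.indicator (fun _ => (1 : ℝ)) | X.covariateSigma P]
      =ᵐ[P] fun ω =>
        Real.exp (-∫ s in (0 : ℝ)..t, haz s * Real.exp (β ⬝ᵥ X.covariate s ω))

/-- The covariates are almost surely bounded by `K` in sup-norm at every time. -/
def BoundedCovariates (X : Triple Ω p) (P : Measure Ω) (K : ℝ) : Prop :=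
  ∀ t ∈ X.timeSet P, ∀ᵐ ω ∂P, ∀ j, |X.covariate t ω j| ≤ K

/-- Almost surely, the covariate paths are `L`-Lipschitz for the sup-norm. -/
def LipschitzCovariates (X : Triple Ω p) (P : Measure Ω) (L : ℝ) : Prop :=
  ∀ᵐ ω ∂P, ∀ s ∈ X.timeSet P, ∀ t ∈ X.timeSet P, ∀ j,
    |X.covariate s ω j - X.covariate t ω j| ≤ L * |s - t|

/-- The observed time has a Lebesgue density that is bounded by `C`. -/
def BoundedDensity (X : Triple Ω p) (P : Measure Ω) (C : ℝ) : Prop :=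
  ∃ f : ℝ → ℝ, Measurable f ∧ (∀ t, 0 ≤ f t ∧ f t ≤ C) ∧
    P.map X.time = volume.withDensity fun t => ENNReal.ofReal (f t)

/-- `μ(t, β) = E{Z(t) Y(t) exp(βᵀ Z(t))} / E{Y(t) exp(βᵀ Z(t))}`. -/
def mu (X : Triple Ω p) (P : Measure Ω) (t : ℝ) (β : Fin p → ℝ) : Fin p → ℝ := fun j =>
  (∫ ω, X.covariate t ω j * X.weight t β ω ∂P) / ∫ ω, X.weight t β ω ∂P

/-- `Σ = E ∫ {Z(s) - μ(s, β)}^{⊗2} dN(s)`. -/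
def sigma (X : Triple Ω p) (P : Measure Ω) (β : Fin p → ℝ) : Matrix (Fin p) (Fin p) ℝ :=
  Matrix.of fun j k => ∫ ω, X.integralN (fun s =>
    (X.covariate s ω j - X.mu P s β j) * (X.covariate s ω k - X.mu P s β k)) ω ∂P

end Triple

/-! ### Sample quantities

The sample of size `n` is realised on the product space `Fin n → Ω`: the `i`-th copy of the
triple `X` at the sample point `ω` is `X` at `ω i`. Under `Measure.pi fun _ => P` these are `n`
independent copies of `X`. -/

section Sample

variable {Ω : Type*} {p n : ℕ}

/-- The log-partial likelihood divided by `n`. -/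
def logLik (X : Triple Ω p) (ω : Fin n → Ω) (β : Fin p → ℝ) : ℝ :=
  (1 / (n : ℝ)) * ∑ i, X.integralN (fun s => β ⬝ᵥ X.covariate s (ω i)) (ω i) -
    (1 / (n : ℝ)) * ∑ i, X.integralN (fun s => Real.log (∑ j, X.weight s β (ω j))) (ω i)

/-- The Lasso penalised estimator: `b` minimises `-ℓ(β) + lam ‖β‖₁`. -/
def IsLasso (X : Triple Ω p) (ω : Fin n → Ω) (lam : ℝ) (b : Fin p → ℝ) : Prop :=
  ∀ β : Fin p → ℝ, -logLik X ω b + lam * l1 b ≤ -logLik X ω β + lam * l1 β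

/-- The normalised weight of individual `i` (with `0 / 0 = 0`). -/
def normWeight (X : Triple Ω p) (ω : Fin n → Ω) (s : ℝ) (β : Fin p → ℝ) (i : Fin n) : ℝ :=
  X.weight s β (ω i) / ∑ j, X.weight s β (ω j)

/-- The weighted average of the covariate processes. -/
def zbar (X : Triple Ω p) (ω : Fin n → Ω) (s : ℝ) (β : Fin p → ℝ) : Fin p → ℝ := fun k =>
  ∑ i, X.covariate s (ω i) k * normWeight X ω s β i

/-- The score vector, i.e. the gradient of `logLik`. -/
def score (X : Triple Ω p) (ω : Fin n → Ω) (β : Fin p → ℝ) : Fin p → ℝ := fun k =>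
  (1 / (n : ℝ)) * ∑ i, X.integralN (fun s => X.covariate s (ω i) k - zbar X ω s β k) (ω i)

/-- The Hessian matrix of `logLik`. -/
def hessian (X : Triple Ω p) (ω : Fin n → Ω) (β : Fin p → ℝ) : Matrix (Fin p) (Fin p) ℝ :=
  Matrix.of fun k l => -((1 / (n : ℝ)) * ∑ m, X.integralN (fun s =>
    ∑ i, (X.covariate s (ω i) k - zbar X ω s β k) * (X.covariate s (ω i) l - zbar X ω s β l) *
      normWeight X ω s β i) (ω m))

/-- The matrix `V̂(β) = n⁻¹ ∑ᵢ ∫ {Zᵢ(s) - Z̄(s, β)}^{⊗2} dNᵢ(s)`. -/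
def vhat (X : Triple Ω p) (ω : Fin n → Ω) (β : Fin p → ℝ) : Matrix (Fin p) (Fin p) ℝ :=
  Matrix.of fun k l => (1 / (n : ℝ)) * ∑ i, X.integralN (fun s =>
    (X.covariate s (ω i) k - zbar X ω s β k) * (X.covariate s (ω i) l - zbar X ω s β l)) (ω i)

/-- The constraint set of the `j`-th CLIME problem for the matrix `V`. -/
def climeFeasible (V : Matrix (Fin p) (Fin p) ℝ) (lam : ℝ) (j : Fin p) : Set (Fin p → ℝ) :=
  {b | ‖V *ᵥ b - Pi.single j 1‖ ≤ lam}

/-- The rows of `Θ` solve the CLIME problems: row `j` has minimal `ℓ₁` norm in the `j`-th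
constraint set. Nothing is required of row `j` when that constraint set is empty. -/
def IsClime (V : Matrix (Fin p) (Fin p) ℝ) (lam : ℝ) (Θ : Matrix (Fin p) (Fin p) ℝ) : Prop :=
  ∀ j, (climeFeasible V lam j).Nonempty →
    Θ j ∈ climeFeasible V lam j ∧ ∀ b ∈ climeFeasible V lam j, l1 (Θ j) ≤ l1 b

/-- The compatibility factor of `-ℓ̈(β)`, an infimum over the non-zero `v` with
`‖v_N‖₁ ≤ 2 ‖v_S‖₁`, where `S` and `N` are the support of `β` and its complement. -/
def kappa (X : Triple Ω p) (ω : Fin n → Ω) (β : Fin p → ℝ) : ENNReal :=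
  ⨅ v : {v : Fin p → ℝ // v ≠ 0 ∧ ∑ j with β j = 0, |v j| ≤ 2 * ∑ j with β j ≠ 0, |v j|},
    ENNReal.ofReal (√(sparsity β) * √(v.1 ⬝ᵥ (-hessian X ω β) *ᵥ v.1)) /
      ENNReal.ofReal (∑ j with β j ≠ 0, |v.1 j|)

theorem hasDerivAt_weight (X : Triple Ω p) (s : ℝ) (β v : Fin p → ℝ) (w : Ω) :
    HasDerivAt (fun t : ℝ => X.weight s (β + t • v) w)
      (X.weight s β w * (v ⬝ᵥ X.covariate s w)) 0 := by
  have h1 : HasDerivAt (fun t : ℝ => (β + t • v) ⬝ᵥ X.covariate s w)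
      (v ⬝ᵥ X.covariate s w) 0 := by
    simp only [add_dotProduct, smul_dotProduct, smul_eq_mul]
    simpa using ((hasDerivAt_id (0 : ℝ)).mul_const (v ⬝ᵥ X.covariate s w)).const_add
      (β ⬝ᵥ X.covariate s w)
  have h2 := (h1.exp).const_mul (X.atRisk s w)
  simpa [Triple.weight, mul_assoc] using h2

theorem sum_weight_pos (X : Triple Ω p) (ω : Fin n → Ω) (β : Fin p → ℝ) (i : Fin n) :
    0 < ∑ j, X.weight (X.time (ω i)) β (ω j) := by
  refine Finset.sum_pos' (fun j _ => ?_) ⟨i, Finset.mem_univ _, ?_⟩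
  · unfold Triple.weight Triple.atRisk
    split_ifs <;> simp [Real.exp_nonneg]
  · simp [Triple.weight, Triple.atRisk, Real.exp_pos]

/-- `score` is the gradient of `logLik`. -/
theorem hasDerivAt_logLik (X : Triple Ω p) (ω : Fin n → Ω) (β v : Fin p → ℝ) :
    HasDerivAt (fun t : ℝ => logLik X ω (β + t • v)) (score X ω β ⬝ᵥ v) 0 := by
  have hA : ∀ i, HasDerivAt (fun t : ℝ =>
      X.integralN (fun s => (β + t • v) ⬝ᵥ X.covariate s (ω i)) (ω i))
      (X.event (ω i) * (v ⬝ᵥ X.covariate (X.time (ω i)) (ω i))) 0 := fun i => by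
    simp only [Triple.integralN, add_dotProduct, smul_dotProduct, smul_eq_mul]
    refine HasDerivAt.const_mul _ ?_
    simpa using ((hasDerivAt_id (0 : ℝ)).mul_const
      (v ⬝ᵥ X.covariate (X.time (ω i)) (ω i))).const_add
      (β ⬝ᵥ X.covariate (X.time (ω i)) (ω i))
  have hB : ∀ i, HasDerivAt (fun t : ℝ =>
      X.integralN (fun s => Real.log (∑ j, X.weight s (β + t • v) (ω j))) (ω i))
      (X.event (ω i) * (zbar X ω (X.time (ω i)) β ⬝ᵥ v)) 0 := fun i => by
    simp only [Triple.integralN]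
    refine HasDerivAt.const_mul _ ?_
    have h := HasDerivAt.fun_sum (u := Finset.univ) fun (j : Fin n) _ =>
      hasDerivAt_weight X (X.time (ω i)) β v (ω j)
    have hl := h.log (by simpa using (sum_weight_pos X ω β i).ne')
    refine hl.congr_deriv (Eq.symm ?_)
    simp only [zero_smul, add_zero, zbar, normWeight, dotProduct, Finset.sum_mul, Finset.mul_sum,
      Finset.sum_div]
    rw [Finset.sum_comm]
    refine Finset.sum_congr rfl fun j _ => Finset.sum_congr rfl fun k _ => ?_
    ring
  have hA' := (HasDerivAt.fun_sum (u := Finset.univ) fun i _ => hA i).const_mul (1 / (n : ℝ))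
  have hB' := (HasDerivAt.fun_sum (u := Finset.univ) fun i _ => hB i).const_mul (1 / (n : ℝ))
  refine (hA'.fun_sub hB').congr_deriv (Eq.symm ?_)
  simp only [score, Triple.integralN, dotProduct, Finset.sum_mul, Finset.mul_sum]
  rw [Finset.sum_comm, ← Finset.sum_sub_distrib]
  refine Finset.sum_congr rfl fun j _ => ?_
  rw [← Finset.sum_sub_distrib]
  refine Finset.sum_congr rfl fun k _ => ?_
  ring

/-- `hessian` is the derivative of `score`. -/
theorem hasDerivAt_score (X : Triple Ω p) (ω : Fin n → Ω) (β v : Fin p → ℝ) (k : Fin p) :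
    HasDerivAt (fun t : ℝ => score X ω (β + t • v) k) ((hessian X ω β *ᵥ v) k) 0 := by
  have hZ : ∀ m, HasDerivAt (fun t : ℝ => zbar X ω (X.time (ω m)) (β + t • v) k)
      (∑ l, (∑ i, (X.covariate (X.time (ω m)) (ω i) k - zbar X ω (X.time (ω m)) β k) *
        (X.covariate (X.time (ω m)) (ω i) l - zbar X ω (X.time (ω m)) β l) *
          normWeight X ω (X.time (ω m)) β i) * v l) 0 := fun m => by
    set s := X.time (ω m) with hs
    have hS := sum_weight_pos X ω β m
    rw [← hs] at hS
    have hD := HasDerivAt.fun_sum (u := Finset.univ) fun (j : Fin n) _ =>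
      hasDerivAt_weight X s β v (ω j)
    have hN := HasDerivAt.fun_sum (u := Finset.univ) fun (j : Fin n) _ =>
      (hasDerivAt_weight X s β v (ω j)).const_mul (X.covariate s (ω j) k)
    have hq := hN.fun_div hD (by simpa using hS.ne')
    have hsum : ∑ i, normWeight X ω s β i = 1 := by
      simp only [normWeight, ← Finset.sum_div]
      exact div_self hS.ne'
    have hcen : ∑ i, (X.covariate s (ω i) k - zbar X ω s β k) * normWeight X ω s β i = 0 := by
      simp only [sub_mul, Finset.sum_sub_distrib, ← Finset.mul_sum, hsum]
      simp [zbar]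
    have hE : (fun t : ℝ => zbar X ω s (β + t • v) k) = fun t : ℝ =>
        (∑ j, X.covariate s (ω j) k * X.weight s (β + t • v) (ω j)) /
          ∑ j, X.weight s (β + t • v) (ω j) := by
      funext t
      simp only [zbar, normWeight, Finset.sum_div, mul_div_assoc]
    rw [hE]
    refine hq.congr_deriv (Eq.symm ?_)
    simp only [zero_smul, add_zero]
    have h1 : ∀ l, (∑ i, (X.covariate s (ω i) k - zbar X ω s β k) *
        (X.covariate s (ω i) l - zbar X ω s β l) * normWeight X ω s β i) =
        ∑ i, (X.covariate s (ω i) k - zbar X ω s β k) * normWeight X ω s β i *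
          X.covariate s (ω i) l := fun l => by
      have : ∀ i, (X.covariate s (ω i) k - zbar X ω s β k) *
          (X.covariate s (ω i) l - zbar X ω s β l) * normWeight X ω s β i =
          (X.covariate s (ω i) k - zbar X ω s β k) * normWeight X ω s β i *
            X.covariate s (ω i) l -
          (X.covariate s (ω i) k - zbar X ω s β k) * normWeight X ω s β i *
            zbar X ω s β l := fun i => by ring
      simp only [this, Finset.sum_sub_distrib, ← Finset.sum_mul, hcen]
      ring
    simp only [h1]
    have h2 : ∑ l, (∑ i, (X.covariate s (ω i) k - zbar X ω s β k) * normWeight X ω s β i *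
        X.covariate s (ω i) l) * v l =
        ∑ i, (X.covariate s (ω i) k - zbar X ω s β k) * normWeight X ω s β i *
          (v ⬝ᵥ X.covariate s (ω i)) := by
      simp only [Finset.sum_mul, dotProduct, Finset.mul_sum]
      rw [Finset.sum_comm]
      refine Finset.sum_congr rfl fun i _ => Finset.sum_congr rfl fun l _ => ?_
      ring
    rw [h2]
    have h3 : zbar X ω s β k = (∑ j, X.covariate s (ω j) k * X.weight s β (ω j)) /
        ∑ j, X.weight s β (ω j) := by
      simp only [zbar, normWeight, Finset.sum_div, mul_div_assoc]
    rw [h3]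
    have hne := hS.ne'
    set S := ∑ j, X.weight s β (ω j) with hSdef
    set N := ∑ j, X.covariate s (ω j) k * X.weight s β (ω j) with hNdef
    have h4 : ∀ i, (X.covariate s (ω i) k - N / S) * normWeight X ω s β i *
        (v ⬝ᵥ X.covariate s (ω i)) =
        (X.covariate s (ω i) k * (X.weight s β (ω i) * (v ⬝ᵥ X.covariate s (ω i)))) / S -
        N * (X.weight s β (ω i) * (v ⬝ᵥ X.covariate s (ω i))) / S ^ 2 := fun i => by
      simp only [normWeight, ← hSdef]
      field_simp
    simp only [h4, Finset.sum_sub_distrib, ← Finset.sum_div, ← Finset.mul_sum]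
    field_simp
  have hI : ∀ m, HasDerivAt (fun t : ℝ => X.integralN (fun s =>
      X.covariate s (ω m) k - zbar X ω s (β + t • v) k) (ω m)) _ 0 := fun m =>
    ((hZ m).const_sub (X.covariate (X.time (ω m)) (ω m) k)).const_mul (X.event (ω m))
  have h := (HasDerivAt.fun_sum (u := Finset.univ) fun m _ => hI m).const_mul (1 / (n : ℝ))
  refine h.congr_deriv (Eq.symm ?_)
  simp only [hessian, mulVec, dotProduct, Matrix.of_apply, Triple.integralN]
  simp only [mul_neg, Finset.sum_neg_distrib, neg_mul, neg_inj]
  simp only [Finset.mul_sum, Finset.sum_mul]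
  rw [Finset.sum_comm]
  refine Finset.sum_congr rfl fun m _ => Finset.sum_congr rfl fun l _ =>
    Finset.sum_congr rfl fun i _ => ?_
  ring

end Sample

/-- `ξ n = O_p(1)` for `[0, ∞]`-valued random variables on varying probability spaces. -/
def IsBigOpOne {S : ℕ → Type*} [∀ n, MeasurableSpace (S n)] (Q : ∀ n, Measure (S n))
    (ξ : ∀ n, S n → ENNReal) : Prop :=
  ∀ ε : ENNReal, 0 < ε → ∃ M : NNReal, ∀ᶠ n in atTop, Q n {ω | (M : ENNReal) < ξ n ω} ≤ ε

/-- `ξ n = o_p(a n)` for real random variables on varying probability spaces and a positive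
sequence `a`. -/
def IsLittleOp {S : ℕ → Type*} [∀ n, MeasurableSpace (S n)] (Q : ∀ n, Measure (S n))
    (ξ : ∀ n, S n → ℝ) (a : ℕ → ℝ) : Prop :=
  ∀ ε : ℝ, 0 < ε → Tendsto (fun n => Q n {ω | ε * a n < |ξ n ω|}) atTop (𝓝 0)

end Cox

end

noncomputable section

namespace Cox

/-! ### Elementary inequalities -/

/-! Write `s = √(log (np) / n)`. By Hölder, the linear form is at most the largest `ℓ₁` error of a
row of the CLIME matrix times the sup-norm of the score at the true parameter. The score is
`O_p(s)`. A CLIME row errs by at most `4 r ‖Σ⁻¹‖ λ_n` once the entrywise error of `vhat` at the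
Lasso estimator, times `‖Σ⁻¹‖`, is below `λ_n` (`IsClime.l1_row_sub_le`). The rate assumed for
`‖Σ⁻¹‖² r` makes the product `o(n^{-1/2})`.

Score: `n` times a coordinate of the score is the final value of a martingale with jumps bounded by
`2K`. Its exponential moments are bounded without martingale theory. The product of compensated
exponentials over failures is telescoped in the order of failure (`prod_eq_one_add_sum_prod_lt`).
Each summand, seen as a function of one individual, is integrated by the compensator formula
(`lintegral_event_eq_lintegral_hazard`). The resulting drift is nonpositive by Hoeffding's lemma,
because the failure rates of those at risk are proportional to the weights that centre the
covariates (`lintegral_prod_exp_exponent_le_one`).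

`vhat` at the truth: replacing the risk-set average by its population mean leaves an i.i.d. average,
controlled by Hoeffding. At the time of individual `i` the replacement costs about `√(log (np) /
R_i)`, where `R_i` is the size of the risk set, by a bound conditional on that individual
(`centred_tail`). Since `∑ R_i^{-1/2} ≤ 2√n`, the average cost is `O(s)` although late risk sets are
small (`vhat_tail`).

Lasso: local strong concavity of the log-partial likelihood, from a log-sum-exp inequality, and the
compatibility factor give an `ℓ₁` error of order `d_o λ` (`IsLasso.l1_sub_le`). As `vhat` is locally
Lipschitz in the parameter, `vhat` at the Lasso estimator errs by `O((1 + d_o) s)`, which times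
`‖Σ⁻¹‖` is of smaller order than `λ_n` (`eventually_rate_le`).

The probabilistic part is carried out for a version of the covariates that is bounded everywhere and
jointly measurable for the σ-algebra they generate (`isRegular_regTriple`). Almost surely all
estimators agree for the two versions. -/

theorem exp_mul_le_cosh_add {b x θ : ℝ} (hb : 0 < b) (hx : |x| ≤ b) :
    Real.exp (θ * x) ≤ Real.cosh (θ * b) + x / b * Real.sinh (θ * b) := by
  obtain ⟨h1, h2⟩ := abs_le.mp hx
  have hc := convexOn_exp.2 (Set.mem_univ (θ * b)) (Set.mem_univ (-(θ * b)))
    (show 0 ≤ (b + x) / (2 * b) from div_nonneg (by linarith) (by linarith))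
    (show 0 ≤ (b - x) / (2 * b) from div_nonneg (by linarith) (by linarith))
    (by field_simp; ring)
  simp only [smul_eq_mul] at hc
  have e : (b + x) / (2 * b) * (θ * b) + (b - x) / (2 * b) * -(θ * b) = θ * x := by
    field_simp; ring
  rw [e] at hc
  refine hc.trans (le_of_eq ?_)
  rw [Real.cosh_eq, Real.sinh_eq]
  field_simp
  ring

/-- A bounded variable is dominated, after exponential compensation, by an affine function. -/
theorem exp_compensated_le {b x y θ : ℝ} (hb : 0 < b) (hy : y = 0 ∨ y = 1)
    (hx : |x| ≤ b * y) :
    Real.exp (θ * x - (θ * b) ^ 2 / 2 * y) ≤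
      y * (1 + Real.exp (-((θ * b) ^ 2 / 2)) * (Real.sinh (θ * b) / b) * x) + (1 - y) := by
  rcases hy with rfl | rfl
  · have : x = 0 := by simpa using hx
    simp [this]
  · have h := exp_mul_le_cosh_add (θ := θ) hb (by simpa using hx)
    rw [mul_one, sub_eq_add_neg, Real.exp_add]
    have h3 := Real.cosh_le_exp_half_sq (θ * b)
    have h4 := Real.exp_pos (-((θ * b) ^ 2 / 2))
    have h5 : Real.exp ((θ * b) ^ 2 / 2) * Real.exp (-((θ * b) ^ 2 / 2)) = 1 := by
      rw [← Real.exp_add]; simp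
    calc Real.exp (θ * x) * Real.exp (-((θ * b) ^ 2 / 2))
        ≤ (Real.exp ((θ * b) ^ 2 / 2) + x / b * Real.sinh (θ * b)) *
          Real.exp (-((θ * b) ^ 2 / 2)) := by gcongr; linarith
      _ = _ := by rw [add_mul, h5]; ring

/-- Hoeffding's lemma for weights that need not sum to one: the linear term of the affine majorant
cancels because the weighted sum of `x` vanishes. -/
theorem sum_mul_exp_le {ι : Type*} (s : Finset ι) (w x : ι → ℝ) {b : ℝ} (θ : ℝ) (hb : 0 < b)
    (hw : ∀ i ∈ s, 0 ≤ w i) (hx : ∀ i ∈ s, |x i| ≤ b) (h0 : ∑ i ∈ s, w i * x i = 0) :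
    ∑ i ∈ s, w i * Real.exp (θ * x i - (θ * b) ^ 2 / 2) ≤ ∑ i ∈ s, w i := by
  calc ∑ i ∈ s, w i * Real.exp (θ * x i - (θ * b) ^ 2 / 2)
      ≤ ∑ i ∈ s, w i * (1 + Real.exp (-((θ * b) ^ 2 / 2)) * (Real.sinh (θ * b) / b) * x i) := by
        refine Finset.sum_le_sum fun i hi => mul_le_mul_of_nonneg_left ?_ (hw i hi)
        have := exp_compensated_le (y := 1) (θ := θ) hb (Or.inr rfl) (by simpa using hx i hi)
        simpa using this
    _ = ∑ i ∈ s, w i + Real.exp (-((θ * b) ^ 2 / 2)) * (Real.sinh (θ * b) / b) *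
          ∑ i ∈ s, w i * x i := by
        rw [Finset.mul_sum, ← Finset.sum_add_distrib]
        exact Finset.sum_congr rfl fun i _ => by ring
    _ = _ := by rw [h0]; ring

/-- Where `Y = 0` also `ξ = 0`, so the majorant is `1 + a ξ` in both cases and integrates to one.
The variance term is charged on `Y = 1` only: summed over individuals it counts those at risk rather
than all `n`, which makes the later bounds self-normalised. -/
theorem lintegral_exp_compensated_le_one {Ω : Type*} [MeasurableSpace Ω] (P : Measure Ω)
    [IsProbabilityMeasure P] {ξ Y : Ω → ℝ} {b : ℝ} (θ : ℝ) (hb : 0 < b) (hξ : Measurable ξ)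
    (hY : ∀ ω, Y ω = 0 ∨ Y ω = 1) (hb' : ∀ ω, |ξ ω| ≤ b * Y ω) (h0 : ∫ ω, ξ ω ∂P = 0) :
    ∫⁻ ω, ENNReal.ofReal (Real.exp (θ * ξ ω - (θ * b) ^ 2 / 2 * Y ω)) ∂P ≤ 1 := by
  set a := Real.exp (-((θ * b) ^ 2 / 2)) * (Real.sinh (θ * b) / b) with ha
  have hle : ∀ ω, Real.exp (θ * ξ ω - (θ * b) ^ 2 / 2 * Y ω) ≤ 1 + a * ξ ω := fun ω => by
    refine (exp_compensated_le hb (hY ω) (hb' ω)).trans (le_of_eq ?_)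
    rw [← ha]
    rcases hY ω with h | h
    · have : ξ ω = 0 := by simpa [h] using hb' ω
      simp [h, this]
    · simp [h]
  have hinteg : Integrable ξ P := by
    refine Integrable.of_bound hξ.aestronglyMeasurable b (Eventually.of_forall fun ω => ?_)
    rw [Real.norm_eq_abs]
    rcases hY ω with h | h <;> have := hb' ω <;> rw [h] at this <;> linarith
  calc ∫⁻ ω, ENNReal.ofReal (Real.exp (θ * ξ ω - (θ * b) ^ 2 / 2 * Y ω)) ∂P
      ≤ ∫⁻ ω, ENNReal.ofReal (1 + a * ξ ω) ∂P :=
        lintegral_mono fun ω => ENNReal.ofReal_le_ofReal (hle ω)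
    _ = ENNReal.ofReal (∫ ω, (1 + a * ξ ω) ∂P) := by
        rw [ofReal_integral_eq_lintegral_ofReal]
        · exact (integrable_const _).add (hinteg.const_mul a)
        · exact Eventually.of_forall fun ω => (Real.exp_pos _).le.trans (hle ω)
    _ = 1 := by
        rw [integral_add (integrable_const _) (hinteg.const_mul a), integral_const_mul, h0]
        simp

/-! ### Ordered sums and products -/

/-- Telescoping in the order of `τ`: bringing in the factor `a i` adds `a i - 1` times the product
of the earlier factors. This plays the role of the stochastic integral representation of an
exponential martingale. -/
theorem prod_eq_one_add_sum_prod_lt {ι : Type*} [DecidableEq ι] (s : Finset ι) (τ : ι → ℝ)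
    (a : ι → ℝ) (hτ : Set.InjOn τ s) :
    ∏ j ∈ s, a j = 1 + ∑ i ∈ s, (∏ j ∈ s, if τ j < τ i then a j else 1) * (a i - 1) := by
  induction s using Finset.induction_on_max_value τ with
  | empty => simp
  | @insert m s hm hmax ih =>
    have hlt : ∀ i ∈ s, τ i < τ m := fun i hi => lt_of_le_of_ne (hmax i hi) fun h =>
      hm (hτ (by simp [hi]) (by simp) h ▸ hi)
    rw [Finset.prod_insert hm, Finset.sum_insert hm]
    have h1 : ∀ i ∈ s, (∏ j ∈ insert m s, if τ j < τ i then a j else 1) =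
        ∏ j ∈ s, if τ j < τ i then a j else 1 := fun i hi => by
      rw [Finset.prod_insert hm, if_neg (not_lt.mpr (hlt i hi).le), one_mul]
    have h2 : (∏ j ∈ insert m s, if τ j < τ m then a j else 1) = ∏ j ∈ s, a j := by
      rw [Finset.prod_insert hm, if_neg (lt_irrefl _), one_mul]
      exact Finset.prod_congr rfl fun j hj => if_pos (hlt j hj)
    rw [Finset.sum_congr rfl fun i hi => by rw [h1 i hi], h2]
    have := ih (hτ.mono (by simp))
    linear_combination this

/-- A sum of an antitone function over the sizes of the risk sets; ties only decrease it. -/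
theorem sum_antitone_card_le {ι : Type*} [DecidableEq ι] (s : Finset ι) (τ : ι → ℝ)
    (φ : ℕ → ℝ) (hφ : AntitoneOn φ (Set.Ici 1)) :
    ∑ i ∈ s, φ (s.filter fun j => τ i ≤ τ j).card ≤ ∑ m ∈ Finset.range s.card, φ (m + 1) := by
  -- An individual with the smallest `τ` has everybody in its risk set, and adding it can enlarge
  -- the other risk sets only through ties.
  induction s using Finset.induction_on_min_value τ with
  | empty => simp
  | @insert a s ha hmin ih =>
    rw [Finset.sum_insert ha, Finset.card_insert_of_notMem ha, Finset.sum_range_succ, add_comm]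
    refine add_le_add ((Finset.sum_le_sum fun i hi => ?_).trans ih) (le_of_eq ?_)
    · refine hφ ?_ ?_ (Finset.card_le_card (Finset.filter_subset_filter _ (by simp)))
      · exact Finset.card_pos.mpr ⟨i, by simp [hi]⟩
      · exact Finset.card_pos.mpr ⟨i, by simp [hi]⟩
    · rw [Finset.filter_true_of_mem, Finset.card_insert_of_notMem ha]
      intro j hj
      rcases Finset.mem_insert.mp hj with rfl | h
      · exact le_rfl
      · exact hmin j h

theorem sum_inv_sqrt_le (n : ℕ) : ∑ m ∈ Finset.range n, 1 / √((m + 1 : ℕ) : ℝ) ≤ 2 * √n := by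
  induction n with
  | zero => simp
  | succ n ih =>
    rw [Finset.sum_range_succ]
    have h1 : 0 < √((n + 1 : ℕ) : ℝ) := Real.sqrt_pos.mpr (by positivity)
    have h2 : 0 ≤ √(n : ℝ) := Real.sqrt_nonneg _
    have e1 : √((n + 1 : ℕ) : ℝ) ^ 2 = n + 1 := by rw [Real.sq_sqrt (by positivity)]; simp
    have e2 : √(n : ℝ) ^ 2 = n := Real.sq_sqrt (by positivity)
    have : 1 / √((n + 1 : ℕ) : ℝ) ≤ 2 * √((n + 1 : ℕ) : ℝ) - 2 * √(n : ℝ) := by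
      rw [div_le_iff₀ h1]
      nlinarith [sq_nonneg (√((n + 1 : ℕ) : ℝ) - √(n : ℝ))]
    linarith

/-- Errors of order `1 / √R` at a risk set of size `R` average to order `1 / √n`, with no lower
bound on the risk sets. Antitonicity is asked from `1` on because `1 / √0 = 0`. -/
theorem sum_inv_sqrt_card_le {n : ℕ} (τ : Fin n → ℝ) :
    ∑ i, 1 / √(((Finset.univ.filter fun j => τ i ≤ τ j).card : ℕ) : ℝ) ≤ 2 * √n := by
  refine (sum_antitone_card_le Finset.univ τ (fun m : ℕ => 1 / √(m : ℝ)) ?_).trans ?_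
  · intro a ha b _ hab
    have : (0 : ℝ) < a := by exact_mod_cast ha
    exact one_div_le_one_div_of_le (Real.sqrt_pos.mpr this)
      (Real.sqrt_le_sqrt (by exact_mod_cast hab))
  · simpa using sum_inv_sqrt_le n

/-! ### Product measures -/

section Pi

variable {Ω : Type*} [MeasurableSpace Ω] {n : ℕ} (P : Measure Ω) [IsProbabilityMeasure P]

/-- Resampling one coordinate does not change an integral. -/
theorem lintegral_pi_resample (i : Fin n) {f : (Fin n → Ω) → ENNReal} (hf : Measurable f) :
    ∫⁻ ω, f ω ∂(Measure.pi fun _ => P) =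
      ∫⁻ ω, ∫⁻ x, f (Function.update ω i x) ∂P ∂(Measure.pi fun _ => P) := by
  have h := lmarginal_singleton (μ := fun _ : Fin n => P) f i
  have hm := Measurable.lmarginal (s := {i}) (fun _ : Fin n => P) hf
  rw [h] at hm
  refine lintegral_eq_of_lmarginal_eq {i} hf hm ?_
  rw [lmarginal_singleton, lmarginal_singleton]
  funext x
  simp

theorem lintegral_pi_prod (f : Fin n → Ω → ENNReal) (hf : ∀ i, Measurable (f i)) :
    ∫⁻ ω, ∏ i, f i (ω i) ∂(Measure.pi fun _ => P) = ∏ i, ∫⁻ x, f i x ∂P := by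
  have h := (ProbabilityTheory.iIndepFun_pi (μ := fun _ : Fin n => P)
    (X := f) fun i => (hf i).aemeasurable)
  rw [ProbabilityTheory.lintegral_prod_eq_prod_lintegral_of_indepFun Finset.univ _ h
    fun i => (hf i).comp (measurable_pi_apply i)]
  exact Finset.prod_congr rfl fun i _ =>
    (measurePreserving_eval (fun _ : Fin n => P) i).lintegral_comp (hf i)

end Pi

/-! ### Survival functions and hazards -/

/-- `x ↦ exp (-x)` is 1-Lipschitz on `[0, ∞)`, and absolute continuity survives composition with a
Lipschitz map. -/
theorem absolutelyContinuousOnInterval_exp_neg {f : ℝ → ℝ} {a b : ℝ}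
    (hf : AbsolutelyContinuousOnInterval f a b) (h0 : ∀ x ∈ Set.uIcc a b, 0 ≤ f x) :
    AbsolutelyContinuousOnInterval (fun x => Real.exp (-f x)) a b := by
  have hlip : ∀ x y : ℝ, 0 ≤ x → 0 ≤ y → dist (Real.exp (-x)) (Real.exp (-y)) ≤ dist x y := by
    have key : ∀ x y : ℝ, 0 ≤ x → x ≤ y → Real.exp (-x) - Real.exp (-y) ≤ y - x := by
      intro x y hx hxy
      have h1 : Real.exp (-y) = Real.exp (-x) * Real.exp (x - y) := by
        rw [← Real.exp_add]; ring_nf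
      have h2 := Real.add_one_le_exp (x - y)
      have h3 : Real.exp (-x) ≤ 1 := Real.exp_le_one_iff.mpr (by linarith)
      have h4 := Real.exp_pos (-x)
      rw [h1]
      nlinarith [Real.exp_le_one_iff.mpr (show x - y ≤ 0 by linarith)]
    intro x y hx hy
    rw [Real.dist_eq, Real.dist_eq]
    rcases le_total x y with h | h
    · rw [abs_of_nonneg (sub_nonneg.mpr (Real.exp_le_exp.mpr (neg_le_neg h))),
        abs_of_nonpos (by linarith)]
      linarith [key x y hx h]
    · rw [abs_of_nonpos (sub_nonpos.mpr (Real.exp_le_exp.mpr (neg_le_neg h))),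
        abs_of_nonneg (by linarith)]
      linarith [key y x hy h]
  rw [absolutelyContinuousOnInterval_iff] at hf ⊢
  intro ε hε
  obtain ⟨δ, hδ, h⟩ := hf ε hε
  refine ⟨δ, hδ, fun E hE hs => lt_of_le_of_lt (Finset.sum_le_sum fun i hi => ?_) (h E hE hs)⟩
  exact hlip _ _ (h0 _ (hE.left i (Finset.mem_coe.mpr hi)).left)
    (h0 _ (hE.left i (Finset.mem_coe.mpr hi)).right)

/-- The hazard is merely integrable, so the survival function need not be differentiable everywhere.
It is absolutely continuous with derivative `-h` times itself almost everywhere, which suffices for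
the fundamental theorem of calculus. -/
theorem integral_hazard_mul_survival {h : ℝ → ℝ} {b : ℝ} (hb : 0 ≤ b) (h0 : ∀ s, 0 ≤ h s)
    (hinteg : IntegrableOn h (Set.Icc 0 b)) :
    ∫ s in (0 : ℝ)..b, h s * Real.exp (-∫ u in (0 : ℝ)..s, h u) =
      1 - Real.exp (-∫ u in (0 : ℝ)..b, h u) := by
  have hii : IntervalIntegrable h volume 0 b := by
    rw [intervalIntegrable_iff_integrableOn_Icc_of_le hb]; exact hinteg
  have hac := hii.absolutelyContinuousOnInterval_intervalIntegral (c := 0) (by simp)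
  have hac' := absolutelyContinuousOnInterval_exp_neg hac fun x hx => by
    rw [Set.uIcc_of_le hb] at hx
    exact intervalIntegral.integral_nonneg hx.1 fun s _ => h0 s
  have hder : ∀ᵐ x, x ∈ Set.uIcc 0 b →
      deriv (fun x => Real.exp (-∫ u in (0 : ℝ)..x, h u)) x =
        -(h x * Real.exp (-∫ u in (0 : ℝ)..x, h u)) := by
    filter_upwards [hii.ae_hasDerivAt_integral] with x hx hx'
    have := (hx hx' 0 (by simp)).fun_neg.exp
    rw [this.deriv]; ring
  have h1 := hac'.integral_deriv_eq_sub
  have h2 : ∫ x in (0 : ℝ)..b, deriv (fun x => Real.exp (-∫ u in (0 : ℝ)..x, h u)) x =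
      ∫ x in (0 : ℝ)..b, -(h x * Real.exp (-∫ u in (0 : ℝ)..x, h u)) :=
    intervalIntegral.integral_congr_ae (by
      filter_upwards [hder] with x hx hx' using hx (Set.uIoc_subset_uIcc hx'))
  rw [h2, intervalIntegral.integral_neg] at h1
  simp only [intervalIntegral.integral_same, neg_zero, Real.exp_zero] at h1
  linarith

/-- A law whose survival function is `exp (-∫ h)` has hazard `h`. -/
theorem restrict_Icc_eq_withDensity {ν : Measure ℝ} [IsProbabilityMeasure ν] {h : ℝ → ℝ}
    {b : ℝ} (hb : 0 ≤ b) (h0 : ∀ s, 0 ≤ h s)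
    (hinteg : IntegrableOn h (Set.Icc 0 b)) (hneg : ν (Set.Iio 0) = 0)
    (hsurv : ∀ t ∈ Set.Icc 0 b,
      ν (Set.Ioi t) = ENNReal.ofReal (Real.exp (-∫ s in (0 : ℝ)..t, h s))) :
    ν.restrict (Set.Icc 0 b) =
      (volume.restrict (Set.Icc 0 b)).withDensity
        fun s => ENNReal.ofReal (h s) * ν (Set.Ici s) := by
  have hIic : ∀ t ∈ Set.Icc 0 b,
      ν (Set.Iic t) = ENNReal.ofReal (1 - Real.exp (-∫ s in (0 : ℝ)..t, h s)) := by
    intro t ht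
    rw [← Set.compl_Ioi, prob_compl_eq_one_sub measurableSet_Ioi, hsurv t ht,
      ENNReal.ofReal_sub _ (Real.exp_pos _).le, ENNReal.ofReal_one]
  have hIcc : ∀ t, ν (Set.Icc 0 t) = ν (Set.Iic t) := by
    intro t
    refine measure_congr ?_
    have : ∀ᵐ x ∂ν, ¬ x ∈ Set.Iio (0:ℝ) := measure_eq_zero_iff_ae_notMem.mp hneg
    filter_upwards [this] with x hx
    have hx : 0 ≤ x := by simpa using hx
    simp only [eq_iff_iff]
    constructor
    · exact fun h => h.2
    · exact fun h => ⟨hx, h⟩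
  have hcont : ContinuousOn (fun t => ∫ s in (0 : ℝ)..t, h s) (Set.Icc 0 b) :=
    intervalIntegral.continuousOn_primitive_interval (by rwa [Set.uIcc_of_le hb]) |>.mono
      (by rw [Set.uIcc_of_le hb])
  have hatom0 : ν {0} = 0 := by
    have h1 := hIic 0 ⟨le_rfl, hb⟩
    simp only [intervalIntegral.integral_same, neg_zero, Real.exp_zero, sub_self,
      ENNReal.ofReal_zero] at h1
    exact measure_mono_null (by simp) h1
  -- Continuity of the cumulative hazard excludes atoms, so closed and open tails have the same
  -- mass. The point `0` is treated apart, since it has no approach from the left inside the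
  -- interval.
  have hIci : ∀ t ∈ Set.Icc 0 b,
      ν (Set.Ici t) = ENNReal.ofReal (Real.exp (-∫ s in (0 : ℝ)..t, h s)) := by
    intro t ht
    rcases ht.1.eq_or_lt with rfl | htpos
    · rw [← hsurv 0 ht, ← Set.Ioi_union_left, measure_union _ (measurableSet_singleton _)]
      · rw [hatom0, add_zero]
      · simp
    · have hlim : Tendsto (fun k : ℕ => t - t / (k + 2)) atTop (𝓝 t) := by
        have : Tendsto (fun k : ℕ => t / ((k : ℝ) + 2)) atTop (𝓝 0) :=
          Tendsto.div_atTop tendsto_const_nhds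
            (tendsto_atTop_add_const_right _ _ tendsto_natCast_atTop_atTop)
        simpa using tendsto_const_nhds.sub this
      have hpos : ∀ k : ℕ, 0 < t / ((k : ℝ) + 2) := fun k => by positivity
      have hmem : ∀ k : ℕ, t - t / ((k : ℝ) + 2) ∈ Set.Icc 0 b := fun k => by
        refine ⟨?_, by linarith [hpos k, ht.2]⟩
        have : t / ((k : ℝ) + 2) ≤ t :=
          div_le_self htpos.le (by linarith [(Nat.cast_nonneg k : (0:ℝ) ≤ k)])
        linarith
      have e : Set.Ici t = ⋂ k : ℕ, Set.Ioi (t - t / ((k : ℝ) + 2)) := by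
        ext x
        simp only [Set.mem_Ici, Set.mem_iInter, Set.mem_Ioi]
        constructor
        · intro hx k; linarith [hpos k]
        · intro hx; exact le_of_tendsto' hlim fun k => (hx k).le
      have hanti : Antitone fun k : ℕ => Set.Ioi (t - t / ((k : ℝ) + 2)) := by
        intro i j hij
        refine Set.Ioi_subset_Ioi ?_
        have : t / ((j : ℝ) + 2) ≤ t / ((i : ℝ) + 2) :=
          div_le_div_of_nonneg_left htpos.le (by positivity) (by
            have : (i : ℝ) ≤ j := by exact_mod_cast hij
            linarith)
        linarith
      have h1 := tendsto_measure_iInter_atTop (μ := ν)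
        (fun k => measurableSet_Ioi.nullMeasurableSet) hanti ⟨0, measure_ne_top _ _⟩
      rw [← e] at h1
      have h2 : Tendsto (fun k : ℕ => ν (Set.Ioi (t - t / ((k : ℝ) + 2)))) atTop
          (𝓝 (ENNReal.ofReal (Real.exp (-∫ s in (0 : ℝ)..t, h s)))) := by
        simp_rw [fun k => hsurv _ (hmem k)]
        refine (ENNReal.continuous_ofReal.tendsto _).comp
          ((Real.continuous_exp.tendsto _).comp (Tendsto.neg ?_))
        exact (hcont t ht).tendsto.comp
          (tendsto_nhdsWithin_iff.mpr ⟨hlim, Eventually.of_forall hmem⟩)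
      exact tendsto_nhds_unique h1 h2
  have hdens : ∀ t ∈ Set.Icc 0 b, ∫⁻ s in Set.Icc 0 t, ENNReal.ofReal (h s) * ν (Set.Ici s) =
      ν (Set.Icc 0 t) := by
    intro t ht
    have hsub : Set.Icc 0 t ⊆ Set.Icc 0 b := Set.Icc_subset_Icc_right ht.2
    have h1 : ∫⁻ s in Set.Icc 0 t, ENNReal.ofReal (h s) * ν (Set.Ici s) =
        ∫⁻ s in Set.Icc 0 t, ENNReal.ofReal (h s * Real.exp (-∫ u in (0 : ℝ)..s, h u)) := by
      refine setLIntegral_congr_fun measurableSet_Icc fun s hs => ?_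
      rw [hIci s (hsub hs), ENNReal.ofReal_mul (h0 s)]
    have hinteg' : IntegrableOn (fun s => h s * Real.exp (-∫ u in (0 : ℝ)..s, h u))
        (Set.Icc 0 t) := by
      refine IntegrableOn.mul_continuousOn (hinteg.mono_set hsub) ?_ isCompact_Icc
      exact Real.continuous_exp.comp_continuousOn (hcont.mono hsub).neg
    rw [h1, ← ofReal_integral_eq_lintegral_ofReal hinteg'
      (Eventually.of_forall fun s => mul_nonneg (h0 s) (Real.exp_pos _).le),
      integral_Icc_eq_integral_Ioc, ← intervalIntegral.integral_of_le ht.1,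
      integral_hazard_mul_survival ht.1 h0 (hinteg.mono_set hsub), hIcc, hIic t ht]
  have hmeasI : Measurable fun s => ν (Set.Ici s) := by
    refine Antitone.measurable fun s t hst => measure_mono (Set.Ici_subset_Ici.mpr hst)
  have hfin : IsFiniteMeasure ((volume.restrict (Set.Icc 0 b)).withDensity
        fun s => ENNReal.ofReal (h s) * ν (Set.Ici s)) := by
    refine isFiniteMeasure_withDensity ?_
    rw [hdens b ⟨hb, le_rfl⟩]
    exact measure_ne_top _ _
  refine Measure.ext_of_Iic _ _ fun a => ?_
  rw [Measure.restrict_apply measurableSet_Iic, withDensity_apply _ measurableSet_Iic,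
    Measure.restrict_restrict measurableSet_Iic]
  rcases lt_or_ge a 0 with ha | ha
  · have : Set.Iic a ∩ Set.Icc 0 b = ∅ := by
      ext x; simp only [Set.mem_inter_iff, Set.mem_Iic, Set.mem_Icc, Set.mem_empty_iff_false,
        iff_false]; intro hx; linarith [hx.1, hx.2.1]
    rw [this]; simp
  · have : Set.Iic a ∩ Set.Icc 0 b = Set.Icc 0 (min a b) := by
      ext x; simp only [Set.mem_inter_iff, Set.mem_Iic, Set.mem_Icc, le_min_iff]; tauto
    rw [this, hdens _ ⟨le_min ha hb, min_le_right _ _⟩]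

/-- The interval `[0, τ)`. -/
def ico (τ : EReal) : Set ℝ := {s | 0 ≤ s ∧ (s : EReal) < τ}

theorem measurableSet_ico (τ : EReal) : MeasurableSet (ico τ) :=
  (measurableSet_le measurable_const measurable_id).inter
    (measurableSet_lt measurable_coe_real_ereal measurable_const)

theorem Icc_subset_ico {τ : EReal} {t : ℝ} (ht : t ∈ ico τ) : Set.Icc 0 t ⊆ ico τ :=
  fun _ hs => ⟨hs.1, lt_of_le_of_lt (EReal.coe_le_coe_iff.mpr hs.2) ht.2⟩

theorem exists_rat_mem_ico {τ : EReal} {t : ℝ} (ht : t ∈ ico τ) :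
    ∃ q : ℚ, t < q ∧ (q : ℝ) ∈ ico τ := by
  obtain ⟨q, h1, h2⟩ := EReal.exists_rat_btwn_of_lt ht.2
  have h1' : t < q := by exact_mod_cast h1
  exact ⟨q, h1', ht.1.trans h1'.le, by exact_mod_cast h2⟩

theorem ico_eq_iUnion (τ : EReal) :
    ico τ = ⋃ q : {q : ℚ // (q : ℝ) ∈ ico τ}, Set.Icc 0 ((q : ℚ) : ℝ) := by
  ext t
  simp only [Set.mem_iUnion, Subtype.exists, exists_prop]
  constructor
  · intro ht
    obtain ⟨q, h1, h2⟩ := exists_rat_mem_ico ht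
    exact ⟨q, h2, ht.1, h1.le⟩
  · rintro ⟨q, h1, h2⟩
    exact Icc_subset_ico h1 h2

/-- The survival formula is asked at rational times only: for a conditional law it holds almost
surely at each time, and only countably many exceptional sets can be discarded. Right continuity of
both sides recovers the other times. -/
theorem restrict_ico_eq_withDensity {ν : Measure ℝ} [IsProbabilityMeasure ν] {h : ℝ → ℝ}
    {τ : EReal} (h0 : ∀ s, 0 ≤ h s)
    (hinteg : ∀ t ∈ ico τ, IntegrableOn h (Set.Icc 0 t)) (hneg : ν (Set.Iio 0) = 0)
    (hsurv : ∀ q : ℚ, (q : ℝ) ∈ ico τ →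
      ν (Set.Ioi (q : ℝ)) = ENNReal.ofReal (Real.exp (-∫ s in (0 : ℝ)..q, h s))) :
    ν.restrict (ico τ) =
      (volume.restrict (ico τ)).withDensity fun s => ENNReal.ofReal (h s) * ν (Set.Ici s) := by
  have hsurv' : ∀ t ∈ ico τ,
      ν (Set.Ioi t) = ENNReal.ofReal (Real.exp (-∫ s in (0 : ℝ)..t, h s)) := by
    intro t ht
    obtain ⟨r, hr1, hr2⟩ := exists_rat_mem_ico ht
    obtain ⟨u, hu, hut, hul⟩ :=
      Rat.denseRange_cast.exists_seq_strictAnti_tendsto (Rat.cast_strictMono (K := ℝ)).monotone t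
    have e : Set.Ioi t = ⋃ k, Set.Ioi ((u k : ℚ) : ℝ) := by
      ext x
      simp only [Set.mem_Ioi, Set.mem_iUnion]
      constructor
      · intro hx
        exact (hul.eventually_lt_const hx).exists
      · rintro ⟨k, hk⟩
        exact lt_trans (hut k) hk
    have hmono : Monotone fun k => Set.Ioi ((u k : ℚ) : ℝ) := fun i j hij =>
      Set.Ioi_subset_Ioi (by exact_mod_cast hu.antitone hij)
    have h1 := tendsto_measure_iUnion_atTop (μ := ν) hmono
    rw [← e] at h1
    have hcont : ContinuousOn (fun t => ∫ s in (0 : ℝ)..t, h s) (Set.Icc 0 (r : ℝ)) :=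
      intervalIntegral.continuousOn_primitive_interval
        (by rw [Set.uIcc_of_le hr2.1]; exact hinteg _ hr2) |>.mono (by rw [Set.uIcc_of_le hr2.1])
    have hev : ∀ᶠ k in atTop, ((u k : ℚ) : ℝ) ∈ Set.Icc 0 (r : ℝ) := by
      filter_upwards [hul.eventually_lt_const hr1] with k hk
      exact ⟨ht.1.trans (le_of_lt (hut k)), hk.le⟩
    have h2 : Tendsto (fun k => ν (Set.Ioi ((u k : ℚ) : ℝ))) atTop
        (𝓝 (ENNReal.ofReal (Real.exp (-∫ s in (0 : ℝ)..t, h s)))) := by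
      refine Tendsto.congr' (f₁ := fun k =>
        ENNReal.ofReal (Real.exp (-∫ s in (0 : ℝ)..(u k : ℚ), h s))) ?_ ?_
      · filter_upwards [hev] with k hk
        exact (hsurv _ (Icc_subset_ico hr2 hk)).symm
      · refine (ENNReal.continuous_ofReal.tendsto _).comp
          ((Real.continuous_exp.tendsto _).comp (Tendsto.neg ?_))
        exact (hcont t ⟨ht.1, hr1.le⟩).tendsto.comp (tendsto_nhdsWithin_iff.mpr ⟨hul, hev⟩)
    exact tendsto_nhds_unique h1 h2
  rw [ico_eq_iUnion, ← restrict_withDensity (MeasurableSet.iUnion fun _ => measurableSet_Icc),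
    Measure.restrict_iUnion_congr]
  rintro ⟨q, hq⟩
  rw [restrict_withDensity measurableSet_Icc]
  exact restrict_Icc_eq_withDensity hq.1 h0 (hinteg _ hq) hneg fun t ht =>
    hsurv' t (Icc_subset_ico hq ht)


open ProbabilityTheory in
/-- The compensator formula for one individual. -/
theorem lintegral_event_eq_lintegral_hazard {Ω E : Type*} [MeasurableSpace Ω]
    [MeasurableSpace E] (P : Measure Ω) [IsProbabilityMeasure P] {π : Ω → E} (hπ : Measurable π)
    {S U : Ω → ℝ} (hS : Measurable S) (hU : Measurable U) (hS0 : ∀ ω, 0 ≤ S ω)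
    {τ : EReal} {h : ℝ → E → ℝ} (hm : Measurable (Function.uncurry h)) (h0 : ∀ s e, 0 ≤ h s e)
    (hinteg : ∀ e, ∀ t ∈ ico τ, IntegrableOn (fun s => h s e) (Set.Icc 0 t))
    (hind : ∀ s u : Set ℝ, MeasurableSet s → MeasurableSet u →
      P[(S ⁻¹' s ∩ U ⁻¹' u).indicator (fun _ => (1 : ℝ)) | MeasurableSpace.comap π inferInstance]
        =ᵐ[P] fun ω =>
        (P[(S ⁻¹' s).indicator (fun _ => (1 : ℝ)) | MeasurableSpace.comap π inferInstance]) ω *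
        (P[(U ⁻¹' u).indicator (fun _ => (1 : ℝ)) | MeasurableSpace.comap π inferInstance]) ω)
    (hsurv : ∀ t ∈ ico τ, P[{ω | t < S ω}.indicator (fun _ => (1 : ℝ)) |
        MeasurableSpace.comap π inferInstance]
      =ᵐ[P] fun ω => Real.exp (-∫ s in (0 : ℝ)..t, h s (π ω)))
    {g : ℝ → E → ENNReal} (hg : Measurable (Function.uncurry g)) :
    ∫⁻ ω, {ω | S ω ≤ U ω ∧ S ω ∈ ico τ}.indicator (fun ω => g (S ω) (π ω)) ω ∂P =
      ∫⁻ ω, (∫⁻ s in ico τ, {s | s ≤ S ω ∧ s ≤ U ω}.indicator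
        (fun s => g s (π ω) * ENNReal.ofReal (h s (π ω))) s) ∂P := by
  set κ := condDistrib S π P with hκ
  set κ' := condDistrib U π P with hκ'
  -- Conditional independence in terms of kernels: given `π`, the pair `(S, U)` has the product of
  -- the two conditional laws. Checking boxes is enough.
  have hjoint : P.map (fun ω => (π ω, S ω, U ω)) = (P.map π) ⊗ₘ (κ ×ₖ κ') := by
    have : IsProbabilityMeasure (P.map fun ω => (π ω, S ω, U ω)) :=
      Measure.isProbabilityMeasure_map (hπ.prodMk (hS.prodMk hU)).aemeasurable
    refine Measure.ext_prod₃ fun {A s u} hA hs hu => ?_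
    rw [Measure.map_apply (hπ.prodMk (hS.prodMk hU)) (hA.prod (hs.prod hu)),
      Measure.compProd_apply_prod hA (hs.prod hu)]
    simp_rw [Kernel.prod_apply_prod]
    rw [setLIntegral_map (f := fun e => κ e s * κ' e u) hA
      ((κ.measurable_coe hs).mul (κ'.measurable_coe hu)) hπ]
    have e1 := condDistrib_ae_eq_condExp (μ := P) hπ hS hs
    have e2 := condDistrib_ae_eq_condExp (μ := P) hπ hU hu
    have hA' : MeasurableSet[MeasurableSpace.comap π inferInstance] (π ⁻¹' A) := ⟨A, hA, rfl⟩
    have hSU : MeasurableSet (S ⁻¹' s ∩ U ⁻¹' u) := (hS hs).inter (hU hu)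
    have h1 := setIntegral_condExp (μ := P) hπ.comap_le
      ((integrable_const (1 : ℝ)).indicator hSU) hA'
    have h2 : ∫⁻ ω in π ⁻¹' A, κ (π ω) s * κ' (π ω) u ∂P =
        ENNReal.ofReal (∫ ω in π ⁻¹' A, (κ (π ω)).real s * (κ' (π ω)).real u ∂P) := by
      rw [ofReal_integral_eq_lintegral_ofReal]
      · refine lintegral_congr fun ω => ?_
        rw [ENNReal.ofReal_mul measureReal_nonneg, ofReal_measureReal, ofReal_measureReal]
      · refine Integrable.of_bound (C := 1) (Measurable.aestronglyMeasurable ?_)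
          (Eventually.of_forall fun ω => ?_)
        · exact (((κ.measurable_coe hs).comp hπ).ennreal_toReal).mul
            (((κ'.measurable_coe hu).comp hπ).ennreal_toReal)
        · rw [Real.norm_of_nonneg (mul_nonneg measureReal_nonneg measureReal_nonneg)]
          exact mul_le_one₀ measureReal_le_one measureReal_nonneg measureReal_le_one
      · exact Eventually.of_forall fun ω => mul_nonneg measureReal_nonneg measureReal_nonneg
    have h3 : ∫ ω in π ⁻¹' A, (κ (π ω)).real s * (κ' (π ω)).real u ∂P =
        ∫ ω in π ⁻¹' A, (P[(S ⁻¹' s ∩ U ⁻¹' u).indicator (fun _ => (1 : ℝ)) |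
          MeasurableSpace.comap π inferInstance]) ω ∂P := by
      refine setIntegral_congr_ae (hπ hA) ?_
      filter_upwards [e1, e2, hind s u hs hu] with ω w1 w2 w3 _
      rw [w3, w1, w2]
    rw [h2, h3, h1, integral_indicator_const _ hSU, smul_eq_mul, mul_one,
      measureReal_restrict_apply hSU, ofReal_measureReal]
    congr 1
    ext ω
    simp only [Set.mem_preimage, Set.mem_prod, Set.mem_inter_iff]
    tauto
  -- For almost every value of `π`, the conditional law of `S` has hazard `h · e` on `[0, τ)`.
  have hker : ∀ᵐ e ∂(P.map π), (κ e).restrict (ico τ) =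
      (volume.restrict (ico τ)).withDensity
        fun s => ENNReal.ofReal (h s e) * κ e (Set.Ici s) := by
    have hmeas : ∀ t : ℝ, Measurable fun e =>
        ENNReal.ofReal (Real.exp (-∫ s in (0 : ℝ)..t, h s e)) := by
      intro t
      refine (Real.continuous_exp.measurable.comp (Measurable.neg ?_)).ennreal_ofReal
      simp only [intervalIntegral]
      have hsm : StronglyMeasurable fun q : E × ℝ => h q.2 q.1 :=
        (hm.comp measurable_swap).stronglyMeasurable
      exact (hsm.integral_prod_right'.sub hsm.integral_prod_right').measurable
    have h1 : ∀ q : ℚ, (q : ℝ) ∈ ico τ → ∀ᵐ e ∂(P.map π), κ e (Set.Ioi (q : ℝ)) =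
        ENNReal.ofReal (Real.exp (-∫ s in (0 : ℝ)..q, h s e)) := by
      intro q hq
      rw [ae_map_iff hπ.aemeasurable
        (measurableSet_eq_fun (κ.measurable_coe measurableSet_Ioi) (hmeas q))]
      filter_upwards [condDistrib_ae_eq_condExp (μ := P) hπ hS (measurableSet_Ioi (a := (q : ℝ))),
        hsurv q hq] with ω w1 w2
      rw [← ofReal_measureReal, w1, ← w2]
      rfl
    have h2 : ∀ᵐ e ∂(P.map π), κ e (Set.Iio 0) = 0 := by
      have : ∫⁻ ω in π ⁻¹' Set.univ, κ (π ω) (Set.Iio 0) ∂P = 0 := by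
        rw [setLIntegral_preimage_condDistrib hπ hS.aemeasurable measurableSet_Iio
          MeasurableSet.univ]
        have : S ⁻¹' Set.Iio 0 = ∅ := by
          ext ω; simpa using hS0 ω
        simp [this]
      rw [Set.preimage_univ, setLIntegral_univ,
        lintegral_eq_zero_iff (f := fun ω => κ (π ω) (Set.Iio 0))
          ((κ.measurable_coe measurableSet_Iio).comp hπ)] at this
      rw [ae_map_iff hπ.aemeasurable
        (measurableSet_eq_fun (κ.measurable_coe measurableSet_Iio) measurable_const)]
      exact this
    have h3 := (ae_all_iff (μ := P.map π)).mpr fun q : {q : ℚ // (q : ℝ) ∈ ico τ} => h1 q.1 q.2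
    filter_upwards [h2, h3] with e w2 w3
    exact restrict_ico_eq_withDensity (fun s => h0 s e) (hinteg e) w2 fun q hq => w3 ⟨q, hq⟩
  have hgm : Measurable fun q : E × ℝ => g q.2 q.1 := hg.comp measurable_swap
  have hhm : Measurable fun q : E × ℝ => ENNReal.ofReal (h q.2 q.1) :=
    (hm.comp measurable_swap).ennreal_ofReal
  have hI := measurableSet_ico τ
  -- Both sides reduce to the time integral of the rate times the conditional probabilities of `S ≥
  -- s` and of `U ≥ s`. Here the first probability comes from the density of `S` and the second from
  -- integrating out `U`; in `hR` both come from the at-risk indicator.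
  have hL : ∫⁻ ω, {ω | S ω ≤ U ω ∧ S ω ∈ ico τ}.indicator (fun ω => g (S ω) (π ω)) ω ∂P =
      ∫⁻ e, (∫⁻ s in ico τ, g s e * ENNReal.ofReal (h s e) *
        (κ e (Set.Ici s) * κ' e (Set.Ici s))) ∂(P.map π) := by
    set F : E × ℝ × ℝ → ENNReal :=
      {q | q.2.1 ≤ q.2.2 ∧ q.2.1 ∈ ico τ}.indicator fun q => g q.2.1 q.1 with hF
    have hFm : Measurable F := by
      refine Measurable.indicator ?_ ?_
      · exact hgm.comp (measurable_fst.prodMk (measurable_fst.comp measurable_snd))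
      · exact (measurableSet_le (measurable_fst.comp measurable_snd)
          (measurable_snd.comp measurable_snd)).inter
          (hI.preimage (measurable_fst.comp measurable_snd))
    calc _ = ∫⁻ ω, F (π ω, S ω, U ω) ∂P := rfl
      _ = ∫⁻ q, F q ∂(P.map fun ω => (π ω, S ω, U ω)) :=
        (lintegral_map hFm (hπ.prodMk (hS.prodMk hU))).symm
      _ = ∫⁻ e, ∫⁻ q, F (e, q) ∂((κ ×ₖ κ') e) ∂(P.map π) := by
        rw [hjoint, Measure.lintegral_compProd hFm]
      _ = _ := by
        refine lintegral_congr_ae ?_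
        filter_upwards [hker] with e he
        rw [Kernel.prod_apply, lintegral_prod_symm' (fun q => F (e, q))
          (hFm.comp measurable_prodMk_left)]
        have h1 : ∀ u, ∫⁻ s, F (e, s, u) ∂(κ e) = ∫⁻ s in ico τ,
            ENNReal.ofReal (h s e) * κ e (Set.Ici s) *
              (Set.Iic u).indicator (fun s => g s e) s := by
          intro u
          have : ∀ s, F (e, s, u) =
              (ico τ).indicator (fun s => (Set.Iic u).indicator (fun s => g s e) s) s := by
            intro s
            simp only [hF, Set.indicator, Set.mem_ofPred_eq, Set.mem_Iic]
            by_cases h1 : s ≤ u <;> by_cases h2 : s ∈ ico τ <;> simp [h1, h2]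
          simp_rw [this]
          rw [lintegral_indicator hI, he, lintegral_withDensity_eq_lintegral_mul]
          · rfl
          · exact (hhm.comp measurable_prodMk_left).mul
              (Antitone.measurable fun s t hst => measure_mono (Set.Ici_subset_Ici.mpr hst))
          · exact (hgm.comp measurable_prodMk_left).indicator measurableSet_Iic
        simp_rw [h1]
        rw [lintegral_lintegral_swap]
        · refine lintegral_congr fun s => ?_
          have : ∀ u, ENNReal.ofReal (h s e) * κ e (Set.Ici s) *
              (Set.Iic u).indicator (fun s => g s e) s = (Set.Ici s).indicator (fun _ =>
                ENNReal.ofReal (h s e) * κ e (Set.Ici s) * g s e) u := by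
            intro u
            by_cases hsu : s ≤ u <;> simp [Set.indicator, hsu]
          simp_rw [this]
          rw [lintegral_indicator_const measurableSet_Ici]
          ring
        · refine Measurable.aemeasurable (Measurable.mul ?_ ?_)
          · exact ((hhm.comp measurable_prodMk_left).mul (Antitone.measurable fun s t hst =>
              measure_mono (Set.Ici_subset_Ici.mpr hst))).comp measurable_snd
          · exact ((hgm.comp measurable_prodMk_left).comp measurable_snd).indicator
              (measurableSet_le measurable_snd measurable_fst)
  have hR : ∫⁻ ω, (∫⁻ s in ico τ, {s | s ≤ S ω ∧ s ≤ U ω}.indicator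
        (fun s => g s (π ω) * ENNReal.ofReal (h s (π ω))) s) ∂P =
      ∫⁻ e, (∫⁻ s in ico τ, g s e * ENNReal.ofReal (h s e) *
        (κ e (Set.Ici s) * κ' e (Set.Ici s))) ∂(P.map π) := by
    set F : E × ℝ × ℝ → ENNReal := fun q => ∫⁻ s in ico τ,
      {s | s ≤ q.2.1 ∧ s ≤ q.2.2}.indicator (fun s => g s q.1 * ENNReal.ofReal (h s q.1)) s
      with hF
    have hFm' : Measurable fun r : (E × ℝ × ℝ) × ℝ =>
        {s | s ≤ r.1.2.1 ∧ s ≤ r.1.2.2}.indicator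
          (fun s => g s r.1.1 * ENNReal.ofReal (h s r.1.1)) r.2 := by
      have hms : MeasurableSet {r : (E × ℝ × ℝ) × ℝ | r.2 ≤ r.1.2.1 ∧ r.2 ≤ r.1.2.2} :=
        (measurableSet_le measurable_snd (by fun_prop)).inter
          (measurableSet_le measurable_snd (by fun_prop))
      have hmm : Measurable fun r : (E × ℝ × ℝ) × ℝ =>
          g r.2 r.1.1 * ENNReal.ofReal (h r.2 r.1.1) :=
        ((hgm.mul hhm).comp ((measurable_fst.comp measurable_fst).prodMk measurable_snd))
      exact hmm.indicator hms
    have hFm : Measurable F := hFm'.lintegral_prod_right'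
    calc _ = ∫⁻ ω, F (π ω, S ω, U ω) ∂P := rfl
      _ = ∫⁻ q, F q ∂(P.map fun ω => (π ω, S ω, U ω)) :=
        (lintegral_map hFm (hπ.prodMk (hS.prodMk hU))).symm
      _ = ∫⁻ e, ∫⁻ q, F (e, q) ∂((κ ×ₖ κ') e) ∂(P.map π) := by
        rw [hjoint, Measure.lintegral_compProd hFm]
      _ = _ := by
        refine lintegral_congr fun e => ?_
        simp only [hF]
        rw [lintegral_lintegral_swap]
        · refine lintegral_congr fun s => ?_
          have : ∀ q : ℝ × ℝ, {s | s ≤ q.1 ∧ s ≤ q.2}.indicator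
              (fun s => g s e * ENNReal.ofReal (h s e)) s =
              (Set.Ici s ×ˢ Set.Ici s).indicator
                (fun _ => g s e * ENNReal.ofReal (h s e)) q := fun q => by
            simp only [Set.indicator, Set.mem_ofPred_eq, Set.mem_prod, Set.mem_Ici]
          simp_rw [this]
          rw [lintegral_indicator_const (measurableSet_Ici.prod measurableSet_Ici),
            Kernel.prod_apply_prod]
        · exact (hFm'.comp ((measurable_const.prodMk measurable_fst).prodMk
            measurable_snd)).aemeasurable
  rw [hL, hR]

/-! ### Regular models -/

/-- A triple whose covariates are bounded everywhere and are a jointly measurable function of time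
and of a random element `π`, with respect to which the compensator formula holds. -/
structure IsRegular {Ω E : Type*} [MeasurableSpace Ω] [MeasurableSpace E] {p : ℕ}
    (X : Triple Ω p) (P : Measure Ω) (β : Fin p → ℝ) (K : ℝ) (π : Ω → E)
    (Z : ℝ → E → Fin p → ℝ) (I : Set ℝ) (haz : ℝ → ℝ) : Prop where
  measurable_failure : Measurable X.failure
  measurable_censor : Measurable X.censor
  measurable_proj : Measurable π
  measurable_cov : Measurable fun q : ℝ × E => Z q.1 q.2
  covariate_eq : ∀ t ω, X.covariate t ω = Z t (π ω)
  bound : ∀ t e j, |Z t e j| ≤ K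
  measure_time_eq : ∀ t, P {ω | X.time ω = t} = 0
  measurable_haz : Measurable haz
  haz_nonneg : ∀ t, 0 ≤ haz t
  compensator : ∀ g : ℝ → E → ENNReal, Measurable (Function.uncurry g) →
    ∫⁻ ω, ENNReal.ofReal (X.event ω) * g (X.time ω) (π ω) ∂P =
      ∫⁻ ω, (∫⁻ s in I, ENNReal.ofReal (X.atRisk s ω) * (g s (π ω) *
        ENNReal.ofReal (haz s * Real.exp (β ⬝ᵥ Z s (π ω))))) ∂P

theorem event_eq_zero_or_one {Ω : Type*} {p : ℕ} (X : Triple Ω p) (ω : Ω) :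
    X.event ω = 0 ∨ X.event ω = 1 := by
  unfold Triple.event; split_ifs <;> simp

theorem atRisk_eq_zero_or_one {Ω : Type*} {p : ℕ} (X : Triple Ω p) (t : ℝ) (ω : Ω) :
    X.atRisk t ω = 0 ∨ X.atRisk t ω = 1 := by
  unfold Triple.atRisk; split_ifs <;> simp

/-! ### Risk-set averages and their compensated exponents. -/

section Weighted

variable {E : Type*} {p n : ℕ} (Z : ℝ → E → Fin p → ℝ) (β : Fin p → ℝ) (k : Fin p)

/-- The weight of individual `j` at time `s` given the observed times `τ`. -/
def riskWeight (s : ℝ) (τ : Fin n → ℝ) (e : Fin n → E) (j : Fin n) : ℝ :=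
  (if s ≤ τ j then 1 else 0) * Real.exp (β ⬝ᵥ Z s (e j))

/-- The weighted average of the `k`-th covariate given the observed times `τ`. -/
def riskMean (s : ℝ) (τ : Fin n → ℝ) (e : Fin n → E) : ℝ :=
  (∑ j, Z s (e j) k * riskWeight Z β s τ e j) / ∑ j, riskWeight Z β s τ e j

/-- The compensated exponent that individual `i` contributes on failing at time `s`. -/
def exponent (θ b s : ℝ) (τ : Fin n → ℝ) (e : Fin n → E) (i : Fin n) : ℝ :=
  θ * (Z s (e i) k - riskMean Z β k s τ e) - (θ * b) ^ 2 / 2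

theorem riskWeight_nonneg (s : ℝ) (τ : Fin n → ℝ) (e : Fin n → E) (j : Fin n) :
    0 ≤ riskWeight Z β s τ e j := by
  unfold riskWeight; split_ifs <;> simp [Real.exp_nonneg]

theorem abs_riskMean_le {K : ℝ} (hK : 0 ≤ K) (hZ : ∀ t e j, |Z t e j| ≤ K) (s : ℝ)
    (τ : Fin n → ℝ) (e : Fin n → E) : |riskMean Z β k s τ e| ≤ K := by
  have hw := riskWeight_nonneg Z β s τ e
  unfold riskMean
  rw [abs_div, abs_of_nonneg (Finset.sum_nonneg fun j _ => hw j)]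
  refine div_le_of_le_mul₀ (Finset.sum_nonneg fun j _ => hw j) hK ?_
  refine (Finset.abs_sum_le_sum_abs _ _).trans ?_
  rw [Finset.mul_sum]
  refine Finset.sum_le_sum fun j _ => ?_
  rw [abs_mul, abs_of_nonneg (hw j)]
  exact mul_le_mul_of_nonneg_right (hZ _ _ _) (hw j)

/-- An empty risk set is no exception: then all weights vanish. -/
theorem sum_riskWeight_mul_sub (s : ℝ) (τ : Fin n → ℝ) (e : Fin n → E) :
    ∑ j, riskWeight Z β s τ e j * (Z s (e j) k - riskMean Z β k s τ e) = 0 := by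
  have hw := riskWeight_nonneg Z β s τ e
  simp only [mul_sub, Finset.sum_sub_distrib, ← Finset.sum_mul]
  by_cases h : ∑ j, riskWeight Z β s τ e j = 0
  · have h' := (Finset.sum_eq_zero_iff_of_nonneg fun j _ => hw j).mp h
    rw [h, zero_mul, sub_zero]
    exact Finset.sum_eq_zero fun j hj => by rw [h' j hj, zero_mul]
  · rw [riskMean, mul_div_cancel₀ _ h, sub_eq_zero]
    exact Finset.sum_congr rfl fun j _ => mul_comm _ _

/-- The drift inequality behind the exponential supermartingale: at time `s`, individual `i` fails
at a rate proportional to its risk weight, and these weights centre the covariate. The range `2 * K`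
bounds a covariate minus an average of covariates. -/
theorem sum_riskWeight_exp_exponent_le {K : ℝ} (hK : 0 < K) (hZ : ∀ t e j, |Z t e j| ≤ K)
    (θ s : ℝ) (τ : Fin n → ℝ) (e : Fin n → E) :
    ∑ i, riskWeight Z β s τ e i * Real.exp (exponent Z β k θ (2 * K) s τ e i) ≤
      ∑ i, riskWeight Z β s τ e i := by
  refine sum_mul_exp_le _ _ (fun i => Z s (e i) k - riskMean Z β k s τ e) θ (by linarith)
    (fun i _ => riskWeight_nonneg Z β s τ e i) (fun i _ => ?_) (sum_riskWeight_mul_sub Z β k s τ e)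
  refine (abs_sub _ _).trans ?_
  linarith [hZ s (e i) k, abs_riskMean_le Z β k hK.le hZ s τ e]

theorem exponent_le {K : ℝ} (hK : 0 < K) (hZ : ∀ t e j, |Z t e j| ≤ K)
    (θ b s : ℝ) (τ : Fin n → ℝ) (e : Fin n → E) (i : Fin n) :
    exponent Z β k θ b s τ e i ≤ |θ| * (2 * K) := by
  have h1 : θ * (Z s (e i) k - riskMean Z β k s τ e) ≤ |θ| * (2 * K) := by
    refine (le_abs_self _).trans ?_
    rw [abs_mul]
    refine mul_le_mul_of_nonneg_left ((abs_sub _ _).trans ?_) (abs_nonneg _)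
    linarith [hZ s (e i) k, abs_riskMean_le Z β k hK.le hZ s τ e]
  unfold exponent
  nlinarith [sq_nonneg (θ * b)]

theorem riskMean_congr {s : ℝ} {τ τ' : Fin n → ℝ} (e : Fin n → E)
    (h : ∀ j, s ≤ τ j ↔ s ≤ τ' j) : riskMean Z β k s τ e = riskMean Z β k s τ' e := by
  simp only [riskMean, riskWeight, h]

theorem measurable_exponent [MeasurableSpace E] (hZ : Measurable fun q : ℝ × E => Z q.1 q.2)
    (θ b : ℝ) (i : Fin n) :
    Measurable fun q : ℝ × (Fin n → ℝ) × (Fin n → E) =>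
      exponent Z β k θ b q.1 q.2.1 q.2.2 i := by
  have h1 : ∀ j l, Measurable fun q : ℝ × (Fin n → ℝ) × (Fin n → E) => Z q.1 (q.2.2 j) l :=
    fun j l => (measurable_pi_apply l).comp (hZ.comp (measurable_fst.prodMk
      ((measurable_pi_apply j).comp (measurable_snd.comp measurable_snd))))
  have h2 : ∀ j, Measurable fun q : ℝ × (Fin n → ℝ) × (Fin n → E) =>
      riskWeight Z β q.1 q.2.1 q.2.2 j := fun j => by
    refine Measurable.mul (Measurable.ite (measurableSet_le measurable_fst ?_)
      measurable_const measurable_const) (Real.continuous_exp.measurable.comp ?_)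
    · exact (measurable_pi_apply j).comp (measurable_fst.comp measurable_snd)
    · exact Finset.measurable_fun_sum _ fun l _ => (h1 j l).const_mul _
  refine (Measurable.const_mul ((h1 i k).sub (Measurable.div ?_ ?_)) θ).sub_const _
  · exact Finset.measurable_fun_sum _ fun j _ => (h1 j k).mul (h2 j)
  · exact Finset.measurable_fun_sum _ fun j _ => h2 j

end Weighted

/-! ### Products over past failures, made free of one individual. -/

section PastProd

variable {Ω E : Type*} {p n : ℕ}

/-- The product of the compensated exponentials of the failures before time `s`, when the
individual `i` has covariate `x` and is at risk up to time `s`. -/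
def pastProd (X : Triple Ω p) (β : Fin p → ℝ) (π : Ω → E) (Z : ℝ → E → Fin p → ℝ) (k : Fin p)
    (θ b : ℝ) (i : Fin n) (s : ℝ) (x : E) (ω : Fin n → Ω) : ℝ :=
  ∏ j ∈ Finset.univ.erase i, if X.time (ω j) < s then
    Real.exp (X.event (ω j) * exponent Z β k θ b (X.time (ω j))
      (Function.update (fun l => X.time (ω l)) i s) (Function.update (fun l => π (ω l)) i x) j)
    else 1

theorem update_comp_update {α : Type*} (f : Ω → α) (i : Fin n) (a : α) (ω : Fin n → Ω) (y : Ω) :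
    Function.update (fun l => f (Function.update ω i y l)) i a =
      Function.update (fun l => f (ω l)) i a := by
  funext j
  by_cases hj : j = i
  · subst hj; simp
  · simp [Function.update_of_ne hj]

/-- Predictability in elementary form. With its time overridden by `s` and its covariates by `x`,
the coordinate of individual `i` no longer enters, so the compensator formula applies to that
individual with the others frozen. -/
theorem pastProd_update (X : Triple Ω p) (β : Fin p → ℝ) (π : Ω → E) (Z : ℝ → E → Fin p → ℝ)
    (k : Fin p) (θ b : ℝ) (i : Fin n) (s : ℝ) (x : E) (ω : Fin n → Ω) (y : Ω) :
    pastProd X β π Z k θ b i s x (Function.update ω i y) = pastProd X β π Z k θ b i s x ω := by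
  unfold pastProd
  rw [update_comp_update, update_comp_update]
  refine Finset.prod_congr rfl fun j hj => ?_
  rw [Function.update_of_ne (Finset.ne_of_mem_erase hj)]

theorem pastProd_nonneg (X : Triple Ω p) (β : Fin p → ℝ) (π : Ω → E) (Z : ℝ → E → Fin p → ℝ)
    (k : Fin p) (θ b : ℝ) (i : Fin n) (s : ℝ) (x : E) (ω : Fin n → Ω) :
    0 ≤ pastProd X β π Z k θ b i s x ω :=
  Finset.prod_nonneg fun j _ => by split_ifs <;> positivity

/-- On the event that `i` is at risk at `s`, the product does not depend on `i`. -/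
theorem pastProd_eq_of_le (X : Triple Ω p) (β : Fin p → ℝ) (π : Ω → E) (Z : ℝ → E → Fin p → ℝ)
    (k : Fin p) (θ b : ℝ) (i : Fin n) (s : ℝ) (ω : Fin n → Ω) (hs : s ≤ X.time (ω i)) :
    pastProd X β π Z k θ b i s (π (ω i)) ω = ∏ j, if X.time (ω j) < s then
      Real.exp (X.event (ω j) * exponent Z β k θ b (X.time (ω j))
        (fun l => X.time (ω l)) (fun l => π (ω l)) j) else 1 := by
  rw [← Finset.mul_prod_erase _ _ (Finset.mem_univ i), if_neg (not_lt.mpr hs), one_mul]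
  refine Finset.prod_congr rfl fun j _ => ?_
  split_ifs with hlt
  · have : Function.update (fun l => π (ω l)) i (π (ω i)) = fun l => π (ω l) :=
      Function.update_eq_self i (fun l => π (ω l))
    rw [this]
    simp only [exponent]
    rw [riskMean_congr (τ' := fun l => X.time (ω l))]
    intro l
    by_cases hl : l = i
    · subst hl; simp only [Function.update_self]
      exact ⟨fun _ => hlt.le.trans hs, fun _ => hlt.le⟩
    · rw [Function.update_of_ne hl]
  · rfl

theorem exponent_update_of_le (X : Triple Ω p) (β : Fin p → ℝ) (π : Ω → E)
    (Z : ℝ → E → Fin p → ℝ) (k : Fin p) (θ b : ℝ) (i : Fin n) (s : ℝ) (ω : Fin n → Ω)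
    (hs : s ≤ X.time (ω i)) :
    exponent Z β k θ b s (Function.update (fun l => X.time (ω l)) i s)
        (Function.update (fun l => π (ω l)) i (π (ω i))) i =
      exponent Z β k θ b s (fun l => X.time (ω l)) (fun l => π (ω l)) i := by
  have : Function.update (fun l => π (ω l)) i (π (ω i)) = fun l => π (ω l) :=
    Function.update_eq_self i (fun l => π (ω l))
  rw [this]
  simp only [exponent]
  rw [riskMean_congr (τ' := fun l => X.time (ω l))]
  intro l
  by_cases hl : l = i
  · subst hl; simp only [Function.update_self, le_refl, true_iff]; exact hs
  · rw [Function.update_of_ne hl]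

/-- The product of the compensated exponentials of all failures, by order of failure. -/
theorem prod_exp_exponent_add_sum (X : Triple Ω p) (β : Fin p → ℝ) (π : Ω → E)
    (Z : ℝ → E → Fin p → ℝ) (k : Fin p) (θ b : ℝ) (ω : Fin n → Ω)
    (hω : Function.Injective fun i => X.time (ω i)) :
    ∏ j, Real.exp (X.event (ω j) * exponent Z β k θ b
        (X.time (ω j)) (fun l => X.time (ω l)) (fun l => π (ω l)) j) +
      ∑ i, X.event (ω i) * pastProd X β π Z k θ b i (X.time (ω i)) (π (ω i)) ω =
    1 + ∑ i, X.event (ω i) * (pastProd X β π Z k θ b i (X.time (ω i)) (π (ω i)) ω *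
      Real.exp (exponent Z β k θ b (X.time (ω i))
        (Function.update (fun l => X.time (ω l)) i (X.time (ω i)))
        (Function.update (fun l => π (ω l)) i (π (ω i))) i)) := by
  -- The two parts of each difference `a i - 1` stand on opposite sides of the identity, so that it
  -- can be read in `ENNReal`. A censored individual has `a i = 1` and drops out.
  rw [prod_eq_one_add_sum_prod_lt Finset.univ (fun i => X.time (ω i)) _ hω.injOn,
    add_assoc, ← Finset.sum_add_distrib]
  congr 1
  refine Finset.sum_congr rfl fun i _ => ?_
  rw [pastProd_eq_of_le X β π Z k θ b i _ ω le_rfl,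
    exponent_update_of_le X β π Z k θ b i _ ω le_rfl]
  rcases event_eq_zero_or_one X (ω i) with hd | hd
  · simp only [hd, zero_mul, Real.exp_zero, sub_self, mul_zero, add_zero]
  · simp only [hd, one_mul]; ring

/-- All individuals at risk at `s` share the same past product `W`. It factors out together with the
baseline hazard `c`, and what remains is `sum_riskWeight_exp_exponent_le`. -/
theorem sum_atRisk_pastProd_le (X : Triple Ω p) (β : Fin p → ℝ) (π : Ω → E)
    (Z : ℝ → E → Fin p → ℝ) (k : Fin p) (θ : ℝ) {K : ℝ} (hK : 0 < K)
    (hZ : ∀ t e j, |Z t e j| ≤ K) (s c : ℝ) (hc : 0 ≤ c) (ω : Fin n → Ω) :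
    ∑ i, X.atRisk s (ω i) * (pastProd X β π Z k θ (2 * K) i s (π (ω i)) ω *
      Real.exp (exponent Z β k θ (2 * K) s (Function.update (fun l => X.time (ω l)) i s)
        (Function.update (fun l => π (ω l)) i (π (ω i))) i) *
        (c * Real.exp (β ⬝ᵥ Z s (π (ω i))))) ≤
    ∑ i, X.atRisk s (ω i) * (pastProd X β π Z k θ (2 * K) i s (π (ω i)) ω *
        (c * Real.exp (β ⬝ᵥ Z s (π (ω i))))) := by
  set W := ∏ j, if X.time (ω j) < s then
      Real.exp (X.event (ω j) * exponent Z β k θ (2 * K) (X.time (ω j))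
        (fun l => X.time (ω l)) (fun l => π (ω l)) j) else 1 with hW
  have hW0 : 0 ≤ W := Finset.prod_nonneg fun j _ => by split_ifs <;> positivity
  have hmain := sum_riskWeight_exp_exponent_le Z β k hK hZ θ s (fun l => X.time (ω l))
    (fun l => π (ω l))
  have e1 : ∀ i, X.atRisk s (ω i) * (pastProd X β π Z k θ (2 * K) i s (π (ω i)) ω *
      Real.exp (exponent Z β k θ (2 * K) s (Function.update (fun l => X.time (ω l)) i s)
        (Function.update (fun l => π (ω l)) i (π (ω i))) i) *
        (c * Real.exp (β ⬝ᵥ Z s (π (ω i))))) = W * c *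
      (riskWeight Z β s (fun l => X.time (ω l)) (fun l => π (ω l)) i *
        Real.exp (exponent Z β k θ (2 * K) s (fun l => X.time (ω l)) (fun l => π (ω l)) i)) := by
    intro i
    unfold Triple.atRisk riskWeight
    split_ifs with hs
    · rw [pastProd_eq_of_le X β π Z k θ (2 * K) i s ω hs,
        exponent_update_of_le X β π Z k θ (2 * K) i s ω hs]
      ring
    · simp
  have e2 : ∀ i, X.atRisk s (ω i) * (pastProd X β π Z k θ (2 * K) i s (π (ω i)) ω *
        (c * Real.exp (β ⬝ᵥ Z s (π (ω i))))) = W * c *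
      riskWeight Z β s (fun l => X.time (ω l)) (fun l => π (ω l)) i := by
    intro i
    unfold Triple.atRisk riskWeight
    split_ifs with hs
    · rw [pastProd_eq_of_le X β π Z k θ (2 * K) i s ω hs]
      ring
    · simp
  simp_rw [e1, e2, ← Finset.mul_sum]
  exact mul_le_mul_of_nonneg_left hmain (mul_nonneg hW0 hc)

end PastProd

/-! ### The exponential supermartingale inequality for the score. -/

namespace IsRegular

variable {Ω E : Type*} [MeasurableSpace Ω] [MeasurableSpace E] {p : ℕ} {X : Triple Ω p}
  {P : Measure Ω} {β : Fin p → ℝ} {K : ℝ} {π : Ω → E}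
  {Z : ℝ → E → Fin p → ℝ} {I : Set ℝ} {haz : ℝ → ℝ}

theorem measurable_time (h : IsRegular X P β K π Z I haz) : Measurable X.time :=
  h.measurable_failure.min h.measurable_censor

theorem measurable_event (h : IsRegular X P β K π Z I haz) : Measurable X.event :=
  Measurable.ite (measurableSet_le h.measurable_failure h.measurable_censor)
    measurable_const measurable_const

theorem measurable_atRisk (h : IsRegular X P β K π Z I haz) :
    Measurable fun q : ℝ × Ω => X.atRisk q.1 q.2 :=
  Measurable.ite (measurableSet_le measurable_fst (h.measurable_time.comp measurable_snd))
    measurable_const measurable_const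

theorem measurable_rate (h : IsRegular X P β K π Z I haz) :
    Measurable fun q : ℝ × E => ENNReal.ofReal (haz q.1 * Real.exp (β ⬝ᵥ Z q.1 q.2)) := by
  refine ((h.measurable_haz.comp measurable_fst).mul
    (Real.continuous_exp.measurable.comp ?_)).ennreal_ofReal
  exact Finset.measurable_fun_sum _ fun l _ =>
    ((measurable_pi_apply l).comp h.measurable_cov).const_mul _

variable {n : ℕ}

theorem measurable_override (h : IsRegular X P β K π Z I haz) (i : Fin n) :
    Measurable fun q : ℝ × E × (Fin n → Ω) =>
      ((Function.update (fun l => X.time (q.2.2 l)) i q.1 : Fin n → ℝ),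
        (Function.update (fun l => π (q.2.2 l)) i q.2.1 : Fin n → E)) := by
  refine Measurable.prodMk (measurable_pi_iff.mpr fun j => ?_) (measurable_pi_iff.mpr fun j => ?_)
  · by_cases hj : j = i
    · subst hj; simpa using measurable_fst
    · simp only [Function.update_of_ne hj]
      exact h.measurable_time.comp
        ((measurable_pi_apply j).comp (measurable_snd.comp measurable_snd))
  · by_cases hj : j = i
    · subst hj
      simp only [Function.update_self]
      exact measurable_fst.comp measurable_snd
    · simp only [Function.update_of_ne hj]
      exact h.measurable_proj.comp
        ((measurable_pi_apply j).comp (measurable_snd.comp measurable_snd))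

theorem measurable_pastProd (h : IsRegular X P β K π Z I haz) (k : Fin p) (θ b : ℝ)
    (i : Fin n) : Measurable fun q : ℝ × E × (Fin n → Ω) =>
      pastProd X β π Z k θ b i q.1 q.2.1 q.2.2 := by
  have hωj : ∀ j, Measurable fun q : ℝ × E × (Fin n → Ω) => q.2.2 j := fun j =>
    (measurable_pi_apply j).comp (measurable_snd.comp measurable_snd)
  refine Finset.measurable_fun_prod _ fun j _ => Measurable.ite
    (measurableSet_lt (h.measurable_time.comp (hωj j)) measurable_fst) ?_ measurable_const
  refine Real.continuous_exp.measurable.comp ((h.measurable_event.comp (hωj j)).mul ?_)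
  exact (measurable_exponent Z β k h.measurable_cov θ b j).comp
    ((h.measurable_time.comp (hωj j)).prodMk (h.measurable_override i))

/-- A crude bound: only the finiteness of the integrals to be cancelled depends on it. -/
theorem pastProd_le (h : IsRegular X P β K π Z I haz) (hK : 0 < K) (k : Fin p) (θ b : ℝ)
    (i : Fin n) (s : ℝ) (x : E) (ω : Fin n → Ω) :
    pastProd X β π Z k θ b i s x ω ≤ Real.exp (|θ| * (2 * K)) ^ n := by
  have h1 : (1 : ℝ) ≤ Real.exp (|θ| * (2 * K)) := Real.one_le_exp (by positivity)
  refine (Finset.prod_le_prod (g := fun _ => Real.exp (|θ| * (2 * K)))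
    (fun j _ => by split_ifs <;> positivity) fun j _ => ?_).trans ?_
  · split_ifs
    · refine Real.exp_le_exp.mpr ?_
      rcases event_eq_zero_or_one X (ω j) with hd | hd
      · rw [hd, zero_mul]; positivity
      · rw [hd, one_mul]; exact exponent_le Z β k hK h.bound _ _ _ _ _ _
    · exact h1
  · rw [Finset.prod_const]
    exact pow_le_pow_right₀ h1 ((Finset.card_le_univ _).trans (by simp))

theorem zbar_eq_riskMean (h : IsRegular X P β K π Z I haz) (ω : Fin n → Ω) (s : ℝ) (k : Fin p) :
    zbar X ω s β k = riskMean Z β k s (fun l => X.time (ω l)) (fun l => π (ω l)) := by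
  simp only [zbar, normWeight, riskMean, riskWeight, Triple.weight, Triple.atRisk,
    h.covariate_eq, Finset.sum_div, mul_div_assoc]

variable [IsProbabilityMeasure P]

/-- The compensator formula for one individual of a sample. -/
theorem lintegral_pi_compensator (h : IsRegular X P β K π Z I haz) (i : Fin n)
    (Ψ : ℝ → E → (Fin n → Ω) → ENNReal)
    (hΨ : Measurable fun q : ℝ × E × (Fin n → Ω) => Ψ q.1 q.2.1 q.2.2)
    (hi : ∀ s e ω y, Ψ s e (Function.update ω i y) = Ψ s e ω) :
    ∫⁻ ω, ENNReal.ofReal (X.event (ω i)) * Ψ (X.time (ω i)) (π (ω i)) ω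
        ∂(Measure.pi fun _ => P) =
      ∫⁻ ω, (∫⁻ s in I, ENNReal.ofReal (X.atRisk s (ω i)) * (Ψ s (π (ω i)) ω *
        ENNReal.ofReal (haz s * Real.exp (β ⬝ᵥ Z s (π (ω i)))))) ∂(Measure.pi fun _ => P) := by
  have hmi : Measurable fun ω : Fin n → Ω => ω i := measurable_pi_apply i
  have hm1 : Measurable fun ω : Fin n → Ω =>
      ENNReal.ofReal (X.event (ω i)) * Ψ (X.time (ω i)) (π (ω i)) ω :=
    ((h.measurable_event.comp hmi).ennreal_ofReal).mul
      (hΨ.comp ((h.measurable_time.comp hmi).prodMk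
        ((h.measurable_proj.comp hmi).prodMk measurable_id)))
  have hm2 : Measurable fun ω : Fin n → Ω => ∫⁻ s in I, ENNReal.ofReal (X.atRisk s (ω i)) *
      (Ψ s (π (ω i)) ω * ENNReal.ofReal (haz s * Real.exp (β ⬝ᵥ Z s (π (ω i))))) := by
    refine Measurable.lintegral_prod_right' (f := fun q : (Fin n → Ω) × ℝ =>
      ENNReal.ofReal (X.atRisk q.2 (q.1 i)) * (Ψ q.2 (π (q.1 i)) q.1 *
        ENNReal.ofReal (haz q.2 * Real.exp (β ⬝ᵥ Z q.2 (π (q.1 i)))))) ?_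
    have hπ : Measurable fun q : (Fin n → Ω) × ℝ => π (q.1 i) :=
      h.measurable_proj.comp (hmi.comp measurable_fst)
    refine Measurable.mul ?_ (Measurable.mul ?_ ?_)
    · exact (h.measurable_atRisk.comp
        (measurable_snd.prodMk (hmi.comp measurable_fst))).ennreal_ofReal
    · exact hΨ.comp (measurable_snd.prodMk (hπ.prodMk measurable_fst))
    · exact h.measurable_rate.comp (measurable_snd.prodMk hπ)
  rw [lintegral_pi_resample P i hm1, lintegral_pi_resample P i hm2]
  refine lintegral_congr fun ω => ?_
  simp only [Function.update_self, hi]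
  exact h.compensator (fun s e => Ψ s e ω)
    (hΨ.comp (measurable_fst.prodMk (measurable_snd.prodMk measurable_const)))

/-- Almost surely the observed times of a sample are distinct. -/
theorem ae_injective_time (h : IsRegular X P β K π Z I haz) :
    ∀ᵐ ω ∂(Measure.pi fun _ : Fin n => P), Function.Injective fun i => X.time (ω i) := by
  have h1 : ∀ i j : Fin n, i ≠ j →
      ∀ᵐ ω ∂(Measure.pi fun _ : Fin n => P), X.time (ω i) ≠ X.time (ω j) := by
    intro i j hij
    have hms : MeasurableSet {ω : Fin n → Ω | X.time (ω i) = X.time (ω j)} :=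
      measurableSet_eq_fun (h.measurable_time.comp (measurable_pi_apply i))
        (h.measurable_time.comp (measurable_pi_apply j))
    rw [ae_iff]
    simp only [ne_eq, not_not]
    rw [← lintegral_indicator_one hms, lintegral_pi_resample P i
      (measurable_one.indicator hms)]
    refine (lintegral_congr fun ω => ?_).trans lintegral_zero
    have e : ∀ x, {ω : Fin n → Ω | X.time (ω i) = X.time (ω j)}.indicator
        (1 : (Fin n → Ω) → ENNReal) (Function.update ω i x) =
        {x | X.time x = X.time (ω j)}.indicator 1 x := fun x => by
      simp [Set.indicator, Function.update_of_ne hij.symm]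
    simp_rw [e]
    rw [lintegral_indicator_one (measurableSet_eq_fun h.measurable_time measurable_const)]
    exact h.measure_time_eq _
  have h2 : ∀ᵐ ω ∂(Measure.pi fun _ : Fin n => P), ∀ i j : Fin n, i ≠ j →
      X.time (ω i) ≠ X.time (ω j) := by
    rw [ae_all_iff]; intro i; rw [ae_all_iff]; intro j
    by_cases hij : i = j
    · exact Eventually.of_forall fun ω hne => absurd hij hne
    · filter_upwards [h1 i j hij] with ω hω _ using hω
  filter_upwards [h2] with ω hω i j hij
  by_contra hne
  exact hω i j hne hij

/-- A nonnegative variable whose increments at the failures have nonpositive compensators. -/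
theorem lintegral_le_one_of_compensated (h : IsRegular X P β K π Z I haz)
    (W : (Fin n → Ω) → ENNReal) (Ψ₀ Ψ₁ : Fin n → ℝ → E → (Fin n → Ω) → ENNReal)
    (hm₀ : ∀ i, Measurable fun q : ℝ × E × (Fin n → Ω) => Ψ₀ i q.1 q.2.1 q.2.2)
    (hm₁ : ∀ i, Measurable fun q : ℝ × E × (Fin n → Ω) => Ψ₁ i q.1 q.2.1 q.2.2)
    (hi₀ : ∀ i s x ω y, Ψ₀ i s x (Function.update ω i y) = Ψ₀ i s x ω)
    (hi₁ : ∀ i s x ω y, Ψ₁ i s x (Function.update ω i y) = Ψ₁ i s x ω)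
    (C : NNReal) (hC : ∀ i s x ω, Ψ₀ i s x ω ≤ C)
    (hsplit : ∀ᵐ ω ∂(Measure.pi fun _ : Fin n => P),
      W ω + ∑ i, ENNReal.ofReal (X.event (ω i)) * Ψ₀ i (X.time (ω i)) (π (ω i)) ω =
      1 + ∑ i, ENNReal.ofReal (X.event (ω i)) * Ψ₁ i (X.time (ω i)) (π (ω i)) ω)
    (hle : ∀ ω s, ∑ i, ENNReal.ofReal (X.atRisk s (ω i)) * (Ψ₁ i s (π (ω i)) ω *
        ENNReal.ofReal (haz s * Real.exp (β ⬝ᵥ Z s (π (ω i))))) ≤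
      ∑ i, ENNReal.ofReal (X.atRisk s (ω i)) * (Ψ₀ i s (π (ω i)) ω *
        ENNReal.ofReal (haz s * Real.exp (β ⬝ᵥ Z s (π (ω i)))))) :
    ∫⁻ ω, W ω ∂(Measure.pi fun _ : Fin n => P) ≤ 1 := by
  have hcomp : ∀ i, Measurable fun ω : Fin n → Ω => (X.time (ω i), π (ω i), ω) := fun i =>
    (h.measurable_time.comp (measurable_pi_apply i)).prodMk
      ((h.measurable_proj.comp (measurable_pi_apply i)).prodMk measurable_id)
  have hk : ∀ Ψ : Fin n → ℝ → E → (Fin n → Ω) → ENNReal,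
      (∀ i, Measurable fun q : ℝ × E × (Fin n → Ω) => Ψ i q.1 q.2.1 q.2.2) → ∀ i,
      Measurable fun ω : Fin n → Ω =>
      ENNReal.ofReal (X.event (ω i)) * Ψ i (X.time (ω i)) (π (ω i)) ω := fun Ψ hm i =>
    ((h.measurable_event.comp (measurable_pi_apply i)).ennreal_ofReal).mul ((hm i).comp (hcomp i))
  have hinteg := lintegral_congr_ae hsplit
  rw [lintegral_add_right _ (Finset.measurable_fun_sum _ fun i _ => hk Ψ₀ hm₀ i),
    lintegral_add_right _ (Finset.measurable_fun_sum _ fun i _ => hk Ψ₁ hm₁ i),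
    lintegral_finsetSum _ fun i _ => hk Ψ₀ hm₀ i,
    lintegral_finsetSum _ fun i _ => hk Ψ₁ hm₁ i] at hinteg
  have hmeas : ∀ (Ψ : Fin n → ℝ → E → (Fin n → Ω) → ENNReal),
      (∀ i, Measurable fun q : ℝ × E × (Fin n → Ω) => Ψ i q.1 q.2.1 q.2.2) → ∀ i,
      Measurable fun q : (Fin n → Ω) × ℝ => ENNReal.ofReal (X.atRisk q.2 (q.1 i)) *
        (Ψ i q.2 (π (q.1 i)) q.1 *
          ENNReal.ofReal (haz q.2 * Real.exp (β ⬝ᵥ Z q.2 (π (q.1 i))))) := by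
    intro Ψ hΨ i
    have hωi : Measurable fun q : (Fin n → Ω) × ℝ => q.1 i :=
      (measurable_pi_apply i).comp measurable_fst
    have hπ : Measurable fun q : (Fin n → Ω) × ℝ => π (q.1 i) := h.measurable_proj.comp hωi
    exact ((h.measurable_atRisk.comp (measurable_snd.prodMk hωi)).ennreal_ofReal).mul
      (((hΨ i).comp (measurable_snd.prodMk (hπ.prodMk measurable_fst))).mul
        (h.measurable_rate.comp (measurable_snd.prodMk hπ)))
  have hsum : ∀ (Ψ : Fin n → ℝ → E → (Fin n → Ω) → ENNReal),
      (∀ i, Measurable fun q : ℝ × E × (Fin n → Ω) => Ψ i q.1 q.2.1 q.2.2) →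
      (∀ i s x ω y, Ψ i s x (Function.update ω i y) = Ψ i s x ω) →
      ∑ i, ∫⁻ ω, ENNReal.ofReal (X.event (ω i)) * Ψ i (X.time (ω i)) (π (ω i)) ω
        ∂(Measure.pi fun _ : Fin n => P) =
      ∫⁻ ω, (∫⁻ s in I, ∑ i, ENNReal.ofReal (X.atRisk s (ω i)) * (Ψ i s (π (ω i)) ω *
        ENNReal.ofReal (haz s * Real.exp (β ⬝ᵥ Z s (π (ω i))))))
        ∂(Measure.pi fun _ : Fin n => P) := by
    intro Ψ hm hi
    rw [Finset.sum_congr rfl fun i _ => h.lintegral_pi_compensator i (Ψ i) (hm i) (hi i),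
      ← lintegral_finsetSum _ fun i _ => (hmeas Ψ hm i).lintegral_prod_right']
    refine lintegral_congr fun ω => ?_
    rw [← lintegral_finsetSum]
    exact fun i _ => (hmeas Ψ hm i).comp measurable_prodMk_left
  have hle' : ∑ i, ∫⁻ ω, ENNReal.ofReal (X.event (ω i)) * Ψ₁ i (X.time (ω i)) (π (ω i)) ω
        ∂(Measure.pi fun _ : Fin n => P) ≤
      ∑ i, ∫⁻ ω, ENNReal.ofReal (X.event (ω i)) * Ψ₀ i (X.time (ω i)) (π (ω i)) ω
        ∂(Measure.pi fun _ : Fin n => P) := by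
    rw [hsum Ψ₀ hm₀ hi₀, hsum Ψ₁ hm₁ hi₁]
    exact lintegral_mono fun ω => lintegral_mono fun s => hle ω s
  -- The bound `C` serves only to make this sum finite, hence cancellable in `ENNReal`.
  have hfin : ∑ i, ∫⁻ ω, ENNReal.ofReal (X.event (ω i)) * Ψ₀ i (X.time (ω i)) (π (ω i)) ω
      ∂(Measure.pi fun _ : Fin n => P) ≠ ⊤ := by
    refine ENNReal.sum_ne_top.mpr fun i _ => ?_
    refine ne_top_of_le_ne_top (b := ∫⁻ _, C ∂(Measure.pi fun _ : Fin n => P))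
      (by simp) (lintegral_mono fun ω => ?_)
    refine (mul_le_mul' (b := 1) ?_ (hC i _ _ ω)).trans (by rw [one_mul])
    rcases event_eq_zero_or_one X (ω i) with hd | hd <;> rw [hd] <;> simp
  have hone : ∫⁻ _ : Fin n → Ω, (1 : ENNReal) ∂(Measure.pi fun _ : Fin n => P) = 1 := by simp
  rw [hone] at hinteg
  exact (ENNReal.add_le_add_iff_right hfin).mp (hinteg.le.trans (add_le_add le_rfl hle'))

/-- The exponential supermartingale inequality at the end of the study. -/
theorem lintegral_prod_exp_exponent_le_one (h : IsRegular X P β K π Z I haz) (hK : 0 < K)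
    (k : Fin p) (θ : ℝ) :
    ∫⁻ ω, ENNReal.ofReal (∏ j, Real.exp (X.event (ω j) * exponent Z β k θ (2 * K)
      (X.time (ω j)) (fun l => X.time (ω l)) (fun l => π (ω l)) j))
        ∂(Measure.pi fun _ : Fin n => P) ≤ 1 := by
  refine h.lintegral_le_one_of_compensated _
    (fun i s x ω => ENNReal.ofReal (pastProd X β π Z k θ (2 * K) i s x ω))
    (fun i s x ω => ENNReal.ofReal (pastProd X β π Z k θ (2 * K) i s x ω *
      Real.exp (exponent Z β k θ (2 * K) s (Function.update (fun l => X.time (ω l)) i s)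
        (Function.update (fun l => π (ω l)) i x) i)))
    (fun i => (h.measurable_pastProd k θ (2 * K) i).ennreal_ofReal)
    (fun i => ((h.measurable_pastProd k θ (2 * K) i).mul (Real.continuous_exp.measurable.comp
      ((measurable_exponent Z β k h.measurable_cov θ (2 * K) i).comp
        (measurable_fst.prodMk (h.measurable_override i))))).ennreal_ofReal)
    (fun i s x ω y => by simp only [pastProd_update])
    (fun i s x ω y => by simp only [pastProd_update, update_comp_update])
    (Real.toNNReal (Real.exp (|θ| * (2 * K)) ^ n))
    (fun i s x ω => ENNReal.ofReal_le_ofReal (h.pastProd_le hK k θ (2 * K) i s x ω)) ?_ ?_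
  · filter_upwards [h.ae_injective_time (n := n)] with ω hω
    have hd : ∀ i, 0 ≤ X.event (ω i) := fun i => by
      rcases event_eq_zero_or_one X (ω i) with hd | hd <;> simp [hd]
    have hp : ∀ i, 0 ≤ pastProd X β π Z k θ (2 * K) i (X.time (ω i)) (π (ω i)) ω := fun i =>
      pastProd_nonneg _ _ _ _ _ _ _ _ _ _ _
    rw [Finset.sum_congr rfl fun i _ => (ENNReal.ofReal_mul (hd i)).symm,
      Finset.sum_congr rfl fun i _ => (ENNReal.ofReal_mul (hd i)).symm,
      ← ENNReal.ofReal_sum_of_nonneg fun i _ => mul_nonneg (hd i) (hp i),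
      ← ENNReal.ofReal_sum_of_nonneg fun i _ => mul_nonneg (hd i)
        (mul_nonneg (hp i) (Real.exp_pos _).le), ← ENNReal.ofReal_one,
      ← ENNReal.ofReal_add (Finset.prod_nonneg fun j _ => (Real.exp_pos _).le)
        (Finset.sum_nonneg fun i _ => mul_nonneg (hd i) (hp i)),
      ← ENNReal.ofReal_add zero_le_one (Finset.sum_nonneg fun i _ => mul_nonneg (hd i)
        (mul_nonneg (hp i) (Real.exp_pos _).le))]
    exact congrArg ENNReal.ofReal (prod_exp_exponent_add_sum X β π Z k θ (2 * K) ω hω)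
  · intro ω s
    have hy : ∀ i, 0 ≤ X.atRisk s (ω i) := fun i => by
      rcases atRisk_eq_zero_or_one X s (ω i) with hd | hd <;> simp [hd]
    have hp : ∀ i, 0 ≤ pastProd X β π Z k θ (2 * K) i s (π (ω i)) ω := fun i =>
      pastProd_nonneg _ _ _ _ _ _ _ _ _ _ _
    have hr : ∀ i, 0 ≤ haz s * Real.exp (β ⬝ᵥ Z s (π (ω i))) := fun i =>
      mul_nonneg (h.haz_nonneg s) (Real.exp_pos _).le
    have e : ∀ i (a : ℝ), 0 ≤ a → ENNReal.ofReal (X.atRisk s (ω i)) * (ENNReal.ofReal a *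
        ENNReal.ofReal (haz s * Real.exp (β ⬝ᵥ Z s (π (ω i))))) =
        ENNReal.ofReal (X.atRisk s (ω i) * (a * (haz s * Real.exp (β ⬝ᵥ Z s (π (ω i)))))) := by
      intro i a ha
      rw [ENNReal.ofReal_mul (hy i), ENNReal.ofReal_mul ha]
    rw [Finset.sum_congr rfl fun i _ => e i _ (hp i),
      Finset.sum_congr rfl fun i _ => e i _ (mul_nonneg (hp i) (Real.exp_pos _).le),
      ← ENNReal.ofReal_sum_of_nonneg fun i _ => mul_nonneg (hy i) (mul_nonneg (hp i) (hr i)),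
      ← ENNReal.ofReal_sum_of_nonneg fun i _ => mul_nonneg (hy i)
        (mul_nonneg (mul_nonneg (hp i) (Real.exp_pos _).le) (hr i))]
    exact ENNReal.ofReal_le_ofReal
      (sum_atRisk_pastProd_le X β π Z k θ hK h.bound s (haz s) (h.haz_nonneg s) ω)

/-- The random variance term, one contribution per observed failure, is enlarged to the
deterministic one with `n` contributions. -/
theorem lintegral_exp_score_le_one (h : IsRegular X P β K π Z I haz) (hK : 0 < K)
    (k : Fin p) (θ : ℝ) :
    ∫⁻ ω, ENNReal.ofReal (Real.exp (θ * (n * score X ω β k) - n * ((θ * (2 * K)) ^ 2 / 2)))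
      ∂(Measure.pi fun _ : Fin n => P) ≤ 1 := by
  refine (lintegral_mono fun ω => ENNReal.ofReal_le_ofReal ?_).trans
    (h.lintegral_prod_exp_exponent_le_one hK k θ)
  rw [← Real.exp_sum]
  refine Real.exp_le_exp.mpr ?_
  rcases Nat.eq_zero_or_pos n with rfl | hn
  · simp
  have hn' : (n : ℝ) ≠ 0 := by positivity
  have e : (n : ℝ) * score X ω β k =
      ∑ i, X.event (ω i) * (Z (X.time (ω i)) (π (ω i)) k -
        riskMean Z β k (X.time (ω i)) (fun l => X.time (ω l)) (fun l => π (ω l))) := by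
    simp only [score, Triple.integralN, h.zbar_eq_riskMean, h.covariate_eq]
    field_simp
  rw [e, Finset.mul_sum]
  have e2 : (n : ℝ) * ((θ * (2 * K)) ^ 2 / 2) = ∑ _i : Fin n, (θ * (2 * K)) ^ 2 / 2 := by simp
  rw [e2, ← Finset.sum_sub_distrib]
  refine Finset.sum_le_sum fun i _ => ?_
  simp only [exponent]
  have := sq_nonneg (θ * (2 * K))
  rcases event_eq_zero_or_one X (ω i) with hd | hd <;> rw [hd] <;> nlinarith

end IsRegular

/-! ### A regular version of the model -/

/-- The sample space with the σ-algebra generated by the covariate process. -/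
structure CovSpace {Ω : Type*} {p : ℕ} [MeasurableSpace Ω] (X : Triple Ω p) (P : Measure Ω) where
  /-- The map from the sample space. -/
  toCov ::
  /-- The sample point. -/
  point : Ω

instance {Ω : Type*} {p : ℕ} [MeasurableSpace Ω] (X : Triple Ω p) (P : Measure Ω) :
    MeasurableSpace (CovSpace X P) :=
  MeasurableSpace.comap CovSpace.point (X.covariateSigma P)

/-- Truncation to `[-K, K]`. -/
def clip (K x : ℝ) : ℝ := max (-K) (min K x)

theorem abs_clip_le {K : ℝ} (hK : 0 ≤ K) (x : ℝ) : |clip K x| ≤ K :=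
  abs_le.mpr ⟨le_max_left _ _, max_le (by linarith) (min_le_left _ _)⟩

theorem clip_of_abs_le {K x : ℝ} (h : |x| ≤ K) : clip K x = x := by
  rw [clip, min_eq_right (abs_le.mp h).2, max_eq_right (abs_le.mp h).1]

theorem continuous_clip (K : ℝ) : Continuous (clip K) :=
  continuous_const.max (continuous_const.min continuous_id)

section Regularise

variable {Ω : Type*} [MeasurableSpace Ω] {p : ℕ} (X : Triple Ω p) (P : Measure Ω) (K : ℝ)

open Classical in
/-- The covariate process at the grid point `k / (m + 1)`, truncated. -/
def gridCov (m : ℕ) (j : Fin p) (k : ℕ) (e : CovSpace X P) : ℝ :=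
  if ((k : ℝ) / (m + 1)) ∈ X.timeSet P then
    clip K (X.covariate ((k : ℝ) / (m + 1)) e.point j) else 0

/-- A version of the covariate process that is bounded everywhere and jointly measurable for the
σ-algebra that the process generates. -/
def regCov (s : ℝ) (e : CovSpace X P) (j : Fin p) : ℝ :=
  clip K (limsup (fun m : ℕ => gridCov X P K m j ⌊s * (m + 1)⌋₊ e) atTop)

/-- A grid point outside the time index set gets the value `0`, since the σ-algebra knows the
process on that set only. -/
theorem measurable_gridCov (m : ℕ) (j : Fin p) (k : ℕ) : Measurable (gridCov X P K m j k) := by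
  unfold gridCov
  split_ifs with h
  · refine (continuous_clip K).measurable.comp ((measurable_pi_apply j).comp ?_)
    have h1 : Measurable[X.covariateSigma P] (X.covariate ((k : ℝ) / (m + 1))) :=
      Measurable.of_comap_le (le_iSup₂_of_le (f := fun t (_ : t ∈ X.timeSet P) =>
        MeasurableSpace.comap (X.covariate t) inferInstance) _ h le_rfl)
    intro s hs
    exact ⟨_, h1 hs, rfl⟩
  · exact measurable_const

/-- For each mesh only countably many grid indices occur, so joint measurability follows from that
of each grid value. The limsup is measurable whether or not the grid values converge. -/
theorem measurable_regCov : Measurable fun q : ℝ × CovSpace X P => regCov X P K q.1 q.2 := by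
  refine measurable_pi_iff.mpr fun j => ?_
  have h2 : ∀ m : ℕ, Measurable fun q : ℝ × CovSpace X P =>
      gridCov X P K m j ⌊q.1 * (m + 1)⌋₊ q.2 := by
    intro m
    have h3 : Measurable fun q : ℝ × CovSpace X P => (⌊q.1 * ((m : ℝ) + 1)⌋₊, q.2) :=
      (measurable_fst.mul_const _).nat_floor.prodMk measurable_snd
    have h1 : Measurable (Function.uncurry (gridCov X P K m j)) :=
      measurable_from_prod_countable_right fun k => measurable_gridCov X P K m j k
    exact h1.comp h3
  exact (continuous_clip K).measurable.comp (Measurable.limsup h2)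

theorem abs_regCov_le (hK : 0 ≤ K) (s : ℝ) (e : CovSpace X P) (j : Fin p) :
    |regCov X P K s e j| ≤ K := abs_clip_le hK _

theorem mem_timeSet_of_le {s t : ℝ} (ht : t ∈ X.timeSet P) (hs : 0 ≤ s) (hst : s ≤ t) :
    s ∈ X.timeSet P :=
  ⟨hs, le_trans (EReal.coe_le_coe_iff.mpr hst) ht.2⟩

/-- The grid points are countable, so the bound holds at all of them simultaneously. Rounding `t`
down stays in the time index set, and the Lipschitz property gives convergence to the value at `t`,
for all `t` at once. -/
theorem ae_regCov_eq {L : ℝ} (hB : X.BoundedCovariates P K) (hL : X.LipschitzCovariates P L) :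
    ∀ᵐ ω ∂P, ∀ t ∈ X.timeSet P, regCov X P K t ⟨ω⟩ = X.covariate t ω := by
  have h1 : ∀ᵐ ω ∂P, ∀ m k : ℕ, ((k : ℝ) / (m + 1)) ∈ X.timeSet P →
      ∀ j, |X.covariate ((k : ℝ) / (m + 1)) ω j| ≤ K := by
    rw [ae_all_iff]; intro m; rw [ae_all_iff]; intro k
    by_cases hk : ((k : ℝ) / (m + 1)) ∈ X.timeSet P
    · filter_upwards [hB _ hk] with ω hω _ using hω
    · exact Eventually.of_forall fun ω h => absurd h hk
  filter_upwards [h1, hL] with ω w1 w2 t ht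
  funext j
  have hq0 : Tendsto (fun m : ℕ => ((⌊t * ((m : ℝ) + 1)⌋₊ : ℝ) / ((m : ℝ) + 1))) atTop (𝓝 t) :=
    (tendsto_nat_floor_mul_div_atTop ht.1).comp
      (tendsto_atTop_add_const_right _ _ tendsto_natCast_atTop_atTop)
  have hmem : ∀ m : ℕ, ((⌊t * ((m : ℝ) + 1)⌋₊ : ℝ) / ((m : ℝ) + 1)) ∈ X.timeSet P := fun m => by
    refine mem_timeSet_of_le X P ht (by positivity) ?_
    rw [div_le_iff₀ (by positivity)]
    exact Nat.floor_le (mul_nonneg ht.1 (by positivity))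
  have hlim : Tendsto (fun m : ℕ => X.covariate ((⌊t * ((m : ℝ) + 1)⌋₊ : ℝ) / ((m : ℝ) + 1)) ω j)
      atTop (𝓝 (X.covariate t ω j)) := by
    rw [tendsto_iff_dist_tendsto_zero]
    refine squeeze_zero (fun _ => dist_nonneg) (fun m => ?_)
      (g := fun m : ℕ => L * |(⌊t * ((m : ℝ) + 1)⌋₊ : ℝ) / ((m : ℝ) + 1) - t|) ?_
    · rw [Real.dist_eq]; exact w2 _ (hmem m) _ ht j
    · simpa using ((hq0.sub_const t).abs).const_mul L
  have hK : |X.covariate t ω j| ≤ K := le_of_tendsto' hlim.abs fun m => w1 m _ (hmem m) j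
  have hg : ∀ m : ℕ, gridCov X P K m j ⌊t * ((m : ℝ) + 1)⌋₊ ⟨ω⟩ =
      X.covariate ((⌊t * ((m : ℝ) + 1)⌋₊ : ℝ) / ((m : ℝ) + 1)) ω j := fun m => by
    rw [gridCov, if_pos (hmem m), clip_of_abs_le (w1 m _ (hmem m) j)]
  rw [regCov]
  simp_rw [hg]
  rw [hlim.limsup_eq, clip_of_abs_le hK]

theorem measure_time_eq_zero {C : ℝ} (hm : Measurable X.time) (hD : X.BoundedDensity P C)
    (t : ℝ) : P {ω | X.time ω = t} = 0 := by
  obtain ⟨f, -, -, h⟩ := hD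
  have h1 : P {ω | X.time ω = t} = P.map X.time {t} :=
    (Measure.map_apply hm (measurableSet_singleton t)).symm
  rw [h1, h]
  exact withDensity_absolutelyContinuous _ _ (by simp)

/-- The time does not exceed `t₊`, by comparison with the rationals above it, and does not equal it,
as there are no atoms. -/
theorem ae_time_mem_ico [IsProbabilityMeasure P] (hm : Measurable X.time)
    (h0 : ∀ ω, 0 ≤ X.time ω) (hna : ∀ t, P {ω | X.time ω = t} = 0) :
    ∀ᵐ ω ∂P, X.time ω ∈ ico (X.tPlus P) := by
  have h1 : ∀ q : ℚ, X.tPlus P < ((q : ℝ) : EReal) → ∀ᵐ ω ∂P, X.time ω ≤ q := by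
    intro q hq
    obtain ⟨_, ⟨t, ⟨_, ht⟩, rfl⟩, htq⟩ := sInf_lt_iff.mp hq
    have : ∀ᵐ ω ∂P, ω ∈ {ω | X.time ω ≤ t} :=
      (mem_ae_iff_prob_eq_one (measurableSet_le hm measurable_const)).mpr ht
    filter_upwards [this] with ω hω
    exact le_trans hω (EReal.coe_le_coe_iff.mp htq.le)
  have h2 : ∀ᵐ ω ∂P, ∀ q : {q : ℚ // X.tPlus P < ((q : ℝ) : EReal)}, X.time ω ≤ (q : ℚ) := by
    rw [ae_all_iff]; exact fun q => h1 q.1 q.2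
  -- If `t₊` is infinite, `toReal` is `0`, and excluding this value as well does no harm.
  have h3 : ∀ᵐ ω ∂P, X.time ω ≠ (X.tPlus P).toReal := by
    rw [ae_iff]; simpa using hna _
  filter_upwards [h2, h3] with ω w2 w3
  refine ⟨h0 ω, lt_of_le_of_ne ?_ fun h => w3 ?_⟩
  · by_contra hlt
    obtain ⟨q, hq1, hq2⟩ := EReal.exists_rat_btwn_of_lt (not_le.mp hlt)
    have := w2 ⟨q, by exact_mod_cast hq1⟩
    have hq2' : (q : ℝ) < X.time ω := by exact_mod_cast hq2
    exact absurd this (not_le.mpr hq2')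
  · rw [← h, EReal.toReal_coe]

theorem ico_subset_timeSet : ico (X.tPlus P) ⊆ X.timeSet P := fun _ h => ⟨h.1, h.2.le⟩

/-- The model makes the baseline hazard locally integrable only, hence almost everywhere measurable,
while the compensator formula takes a measurable rate. -/
theorem exists_measurable_hazard {haz : ℝ → ℝ} {τ : EReal} (h0 : ∀ t, 0 ≤ haz t)
    (hinteg : ∀ t ∈ ico τ, IntegrableOn haz (Set.Icc 0 t)) :
    ∃ haz' : ℝ → ℝ, Measurable haz' ∧ (∀ t, 0 ≤ haz' t) ∧
      ∀ᵐ t ∂(volume.restrict (ico τ)), haz' t = haz t := by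
  have hae : AEMeasurable haz (volume.restrict (ico τ)) := by
    rw [ico_eq_iUnion, aemeasurable_iUnion_iff]
    exact fun q => (hinteg _ q.2).aemeasurable
  refine ⟨fun t => max 0 (hae.mk haz t), measurable_const.max hae.measurable_mk,
    fun t => le_max_left _ _, ?_⟩
  filter_upwards [hae.ae_eq_mk] with t ht
  rw [← ht, max_eq_right (h0 t)]

/-- The triple with the regular version of the covariate process. -/
def regTriple : Triple Ω p where
  failure := X.failure
  censor := X.censor
  covariate := fun t ω => regCov X P K t ⟨ω⟩

/-- The σ-algebra that `CovSpace.toCov` pulls back is exactly the one the covariates generate, so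
conditioning on the process becomes conditioning on a random element and conditional laws are
kernels on `CovSpace`. Changing the hazard on a null set of times and the covariates on a null set
of outcomes leaves the conditional survival function unchanged almost surely. -/
theorem isRegular_regTriple [IsProbabilityMeasure P] {β : Fin p → ℝ} {haz : ℝ → ℝ} {L C : ℝ}
    (hK : 0 ≤ K) (hX : X.IsCoxModel P β haz) (hB : X.BoundedCovariates P K)
    (hL : X.LipschitzCovariates P L) (hD : X.BoundedDensity P C) :
    ∃ haz' : ℝ → ℝ, IsRegular (regTriple X P K) P β K (CovSpace.toCov (X := X) (P := P))
      (regCov X P K) (ico (X.tPlus P)) haz' := by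
  have hmT : Measurable X.time := hX.measurable_failure.min hX.measurable_censor
  have hna := measure_time_eq_zero X P hmT hD
  have hintH : ∀ t ∈ ico (X.tPlus P), IntegrableOn haz (Set.Icc 0 t) := fun t ht =>
    hX.haz_integrable t ht.1 ht.2
  obtain ⟨haz', hm', h0', hae'⟩ := exists_measurable_hazard hX.haz_nonneg hintH
  have hle : X.covariateSigma P ≤ ‹MeasurableSpace Ω› := iSup₂_le fun t _ =>
    Measurable.comap_le (hX.measurable_covariate.comp measurable_prodMk_left)
  have hproj : Measurable (CovSpace.toCov (X := X) (P := P)) := by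
    rintro _ ⟨s, hs, rfl⟩
    exact hle s hs
  have hcomap : MeasurableSpace.comap (CovSpace.toCov (X := X) (P := P)) inferInstance =
      X.covariateSigma P := by
    rw [show (inferInstance : MeasurableSpace (CovSpace X P)) =
      MeasurableSpace.comap CovSpace.point (X.covariateSigma P) from rfl,
      MeasurableSpace.comap_comp]
    exact MeasurableSpace.comap_id
  have hdot : Measurable fun q : ℝ × CovSpace X P => β ⬝ᵥ regCov X P K q.1 q.2 :=
    Finset.measurable_fun_sum _ fun l _ =>
      ((measurable_pi_apply l).comp (measurable_regCov X P K)).const_mul _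
  have hrate : Measurable (Function.uncurry fun (s : ℝ) (e : CovSpace X P) =>
      haz' s * Real.exp (β ⬝ᵥ regCov X P K s e)) :=
    (hm'.comp measurable_fst).mul (Real.continuous_exp.measurable.comp hdot)
  have hreg := ae_regCov_eq X P K hB hL
  have hintH' : ∀ t ∈ ico (X.tPlus P), IntegrableOn haz' (Set.Icc 0 t) := fun t ht => by
    refine (hintH t ht).congr ?_
    filter_upwards [ae_restrict_of_ae_restrict_of_subset (Icc_subset_ico ht) hae'] with s hs
    exact hs.symm
  -- Boundedness everywhere, and not just almost surely, gives integrability for every value of the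
  -- conditioning element.
  have hinteg : ∀ e : CovSpace X P, ∀ t ∈ ico (X.tPlus P), IntegrableOn
      (fun s => haz' s * Real.exp (β ⬝ᵥ regCov X P K s e)) (Set.Icc 0 t) := by
    intro e t ht
    refine Integrable.mul_bdd (c := Real.exp (∑ l, |β l| * K)) (hintH' t ht) ?_ ?_
    · exact (Real.continuous_exp.measurable.comp
        (hdot.comp measurable_prodMk_right)).aestronglyMeasurable
    · refine Eventually.of_forall fun s => ?_
      rw [Real.norm_of_nonneg (Real.exp_pos _).le]
      refine Real.exp_le_exp.mpr (Finset.sum_le_sum fun l _ => (le_abs_self _).trans ?_)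
      rw [abs_mul]
      exact mul_le_mul_of_nonneg_left (abs_regCov_le X P K hK s e l) (abs_nonneg _)
  have key := fun g : ℝ → CovSpace X P → ENNReal =>
    lintegral_event_eq_lintegral_hazard P hproj hX.measurable_failure hX.measurable_censor
      hX.failure_nonneg (τ := X.tPlus P) hrate
      (fun s e => mul_nonneg (h0' s) (Real.exp_pos _).le) hinteg
      (by rw [hcomap]; exact hX.condIndep)
      (by
        rw [hcomap]
        intro t ht
        filter_upwards [hX.hazard t ht.1 ht.2, hreg] with ω w1 w2
        rw [w1]
        congr 2
        refine intervalIntegral.integral_congr_ae ?_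
        rw [Set.uIoc_of_le ht.1]
        have hsub : Set.Ioc 0 t ⊆ ico (X.tPlus P) :=
          Set.Ioc_subset_Icc_self.trans (Icc_subset_ico ht)
        filter_upwards [(ae_restrict_iff' (measurableSet_ico _)).mp hae'] with s hs hst
        rw [hs (hsub hst), w2 s (ico_subset_timeSet X P (hsub hst))]) (g := g)
  refine ⟨haz', hX.measurable_failure, hX.measurable_censor, hproj, measurable_regCov X P K,
    fun _ _ => rfl, abs_regCov_le X P K hK, hna, hm', h0', fun g hg => ?_⟩
  have htime := ae_time_mem_ico X P hmT
    (fun ω => le_min (hX.failure_nonneg ω) (hX.censor_nonneg ω)) hna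
  calc ∫⁻ ω, ENNReal.ofReal ((regTriple X P K).event ω) * g ((regTriple X P K).time ω) ⟨ω⟩ ∂P
      = ∫⁻ ω, {ω | X.failure ω ≤ X.censor ω ∧ X.failure ω ∈ ico (X.tPlus P)}.indicator
          (fun ω => g (X.failure ω) ⟨ω⟩) ω ∂P := by
        refine lintegral_congr_ae ?_
        filter_upwards [htime] with ω hω
        simp only [Triple.event, Triple.time, regTriple, Set.indicator, Set.mem_ofPred_eq] at hω ⊢
        by_cases hle : X.failure ω ≤ X.censor ω
        · rw [min_eq_left hle] at hω ⊢
          simp [hle, hω]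
        · simp [hle]
    _ = _ := by
        rw [key g hg]
        refine lintegral_congr fun ω => lintegral_congr fun s => ?_
        simp only [Set.indicator, Set.mem_ofPred_eq, Triple.atRisk, Triple.time, regTriple,
          le_min_iff]
        split_ifs <;> simp

end Regularise

/-! ### Concentration inequalities -/

theorem measure_lt_le_of_lintegral_exp_le_one {S : Type*} [MeasurableSpace S] (Q : Measure S)
    {f : S → ℝ} (hf : Measurable f) (h : ∫⁻ ω, ENNReal.ofReal (Real.exp (f ω)) ∂Q ≤ 1) (a : ℝ) :
    Q {ω | a < f ω} ≤ ENNReal.ofReal (Real.exp (-a)) := by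
  have hm : Measurable fun ω => ENNReal.ofReal (Real.exp (f ω)) :=
    (Real.continuous_exp.measurable.comp hf).ennreal_ofReal
  have h1 := mul_meas_ge_le_lintegral (μ := Q) hm (ENNReal.ofReal (Real.exp a))
  have h2 : Q {ω | a < f ω} ≤
      Q {ω | ENNReal.ofReal (Real.exp a) ≤ ENNReal.ofReal (Real.exp (f ω))} :=
    measure_mono fun ω (hω : a < f ω) =>
      ENNReal.ofReal_le_ofReal (Real.exp_le_exp.mpr hω.le)
  have h3 : ENNReal.ofReal (Real.exp a) * ENNReal.ofReal (Real.exp (-a)) = 1 := by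
    rw [← ENNReal.ofReal_mul (Real.exp_pos _).le, ← Real.exp_add]; simp
  calc Q {ω | a < f ω}
      = ENNReal.ofReal (Real.exp (-a)) * (ENNReal.ofReal (Real.exp a) * Q {ω | a < f ω}) := by
        rw [← mul_assoc, mul_comm (ENNReal.ofReal (Real.exp (-a))), h3, one_mul]
    _ ≤ ENNReal.ofReal (Real.exp (-a)) * 1 := by
        gcongr
        exact ((mul_le_mul_right h2 _).trans h1).trans h
    _ = _ := mul_one _

/-- The tail of a sub-Gaussian variable. -/
theorem measure_abs_lt_le {S : Type*} [MeasurableSpace S] (Q : Measure S)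
    {f : S → ℝ} (hf : Measurable f) {N b ℓ : ℝ} (hN : 0 < N) (hb : 0 < b) (hℓ : 0 < ℓ)
    (h : ∀ θ : ℝ, ∫⁻ ω, ENNReal.ofReal (Real.exp (θ * f ω - N * ((θ * b) ^ 2 / 2))) ∂Q ≤ 1)
    (a : ℝ) :
    Q {ω | (a + 1 / 2) * b * √(N * ℓ) < |f ω|} ≤ 2 * ENNReal.ofReal (Real.exp (-(a * ℓ))) := by
  set r := √(N * ℓ) with hr
  have hr0 : 0 < r := Real.sqrt_pos.mpr (by positivity)
  have hrr : r ^ 2 = N * ℓ := Real.sq_sqrt (by positivity)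
  -- This choice makes the quadratic term `ℓ / 2`, and the linear term at the threshold `(a + 1/2)
  -- ℓ`, which leaves `a ℓ`.
  set θ := ℓ / (r * b) with hθ
  have e1 : N * ((θ * b) ^ 2 / 2) = ℓ / 2 := by
    rw [hθ]; field_simp; rw [hrr]
  have e2 : θ * ((a + 1 / 2) * b * r) = (a + 1 / 2) * ℓ := by
    rw [hθ]; field_simp
  have hθ0 : 0 < θ := by positivity
  have t1 := measure_lt_le_of_lintegral_exp_le_one Q
    ((hf.const_mul θ).sub_const (N * ((θ * b) ^ 2 / 2))) (h θ) (a * ℓ)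
  have t2 := measure_lt_le_of_lintegral_exp_le_one Q
    ((hf.const_mul (-θ)).sub_const (N * ((-θ * b) ^ 2 / 2))) (h (-θ)) (a * ℓ)
  refine (measure_mono ?_).trans ((measure_union_le _ _).trans
    ((add_le_add t1 t2).trans (by rw [two_mul])))
  intro ω hω
  have hω : (a + 1 / 2) * b * r < |f ω| := hω
  rcases lt_abs.mp hω with h1 | h1
  · left
    show a * ℓ < θ * f ω - N * ((θ * b) ^ 2 / 2)
    have := mul_lt_mul_of_pos_left h1 hθ0
    rw [e1]; linarith
  · right
    show a * ℓ < -θ * f ω - N * ((-θ * b) ^ 2 / 2)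
    have := mul_lt_mul_of_pos_left h1 hθ0
    rw [show (-θ * b) ^ 2 = (θ * b) ^ 2 by ring, e1]; linarith

theorem lintegral_pi_exp_sum_le_one {Ω : Type*} [MeasurableSpace Ω] (P : Measure Ω)
    [IsProbabilityMeasure P] {n : ℕ} (A : Finset (Fin n)) {f : Ω → ℝ} (hf : Measurable f)
    (h : ∫⁻ ω, ENNReal.ofReal (Real.exp (f ω)) ∂P ≤ 1) :
    ∫⁻ ω, ENNReal.ofReal (Real.exp (∑ j ∈ A, f (ω j))) ∂(Measure.pi fun _ : Fin n => P) ≤ 1 := by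
  classical
  have e : ∀ ω : Fin n → Ω, ENNReal.ofReal (Real.exp (∑ j ∈ A, f (ω j))) =
      ∏ j, (fun x => if j ∈ A then ENNReal.ofReal (Real.exp (f x)) else 1) (ω j) := fun ω => by
    rw [Real.exp_sum, ENNReal.ofReal_prod_of_nonneg fun _ _ => (Real.exp_pos _).le,
      Finset.prod_ite_mem, Finset.univ_inter]
  simp_rw [e]
  rw [lintegral_pi_prod P (fun j x => if j ∈ A then ENNReal.ofReal (Real.exp (f x)) else 1)]
  · refine Finset.prod_le_one' fun j _ => ?_
    split_ifs
    · exact h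
    · simp
  · intro j
    split_ifs
    · exact (Real.continuous_exp.measurable.comp hf).ennreal_ofReal
    · exact measurable_const

theorem weight_nonneg {Ω : Type*} {p : ℕ} (X : Triple Ω p) (t : ℝ) (β : Fin p → ℝ)
    (ω : Ω) : 0 ≤ X.weight t β ω := by
  unfold Triple.weight Triple.atRisk; split_ifs <;> simp [Real.exp_nonneg]

/-! ### Tail of the score; bounds on weights and on the population mean. -/

namespace IsRegular

variable {Ω E : Type*} [MeasurableSpace Ω] [MeasurableSpace E] {p : ℕ} {X : Triple Ω p}
  {P : Measure Ω} {β : Fin p → ℝ} {K : ℝ} {π : Ω → E}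
  {Z : ℝ → E → Fin p → ℝ} {I : Set ℝ} {haz : ℝ → ℝ} {n : ℕ}

theorem measurable_covariate (h : IsRegular X P β K π Z I haz) (k : Fin p) :
    Measurable fun q : ℝ × Ω => X.covariate q.1 q.2 k := by
  simp only [h.covariate_eq]
  exact (measurable_pi_apply k).comp
    (h.measurable_cov.comp (measurable_fst.prodMk (h.measurable_proj.comp measurable_snd)))

theorem measurable_weight (h : IsRegular X P β K π Z I haz) :
    Measurable fun q : ℝ × Ω => X.weight q.1 β q.2 :=
  h.measurable_atRisk.mul (Real.continuous_exp.measurable.comp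
    (Finset.measurable_fun_sum _ fun l _ => (h.measurable_covariate l).const_mul _))

theorem abs_covariate_le (h : IsRegular X P β K π Z I haz) (t : ℝ) (ω : Ω) (k : Fin p) :
    |X.covariate t ω k| ≤ K := by
  rw [h.covariate_eq]; exact h.bound _ _ _

theorem zbar_measurable (h : IsRegular X P β K π Z I haz) (k : Fin p) (i : Fin n) :
    Measurable fun ω : Fin n → Ω => zbar X ω (X.time (ω i)) β k := by
  have hpair : ∀ j, Measurable fun ω : Fin n → Ω => (X.time (ω i), ω j) := fun j =>
    (h.measurable_time.comp (measurable_pi_apply i)).prodMk (measurable_pi_apply j)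
  refine Finset.measurable_fun_sum _ fun j _ =>
    ((h.measurable_covariate k).comp (hpair j)).mul ?_
  exact (h.measurable_weight.comp (hpair j)).div
    (Finset.measurable_fun_sum _ fun l _ => h.measurable_weight.comp (hpair l))

theorem score_measurable (h : IsRegular X P β K π Z I haz) (k : Fin p) :
    Measurable fun ω : Fin n → Ω => score X ω β k := by
  refine Measurable.const_mul (Finset.measurable_fun_sum _ fun i _ => ?_) _
  have hpair : Measurable fun ω : Fin n → Ω => (X.time (ω i), ω i) :=
    (h.measurable_time.comp (measurable_pi_apply i)).prodMk (measurable_pi_apply i)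
  exact (h.measurable_event.comp (measurable_pi_apply i)).mul
    (((h.measurable_covariate k).comp hpair).sub (h.zbar_measurable k i))

theorem weight_le (h : IsRegular X P β K π Z I haz) {D : ℝ}
    (hD : ∀ t e, |β ⬝ᵥ Z t e| ≤ D) (t : ℝ) (ω : Ω) :
    X.weight t β ω ≤ Real.exp D * X.atRisk t ω := by
  unfold Triple.weight
  rw [h.covariate_eq, mul_comm]
  refine mul_le_mul_of_nonneg_right (Real.exp_le_exp.mpr ((le_abs_self _).trans (hD _ _))) ?_
  rcases atRisk_eq_zero_or_one X t ω with hd | hd <;> simp [hd]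

theorem le_weight (h : IsRegular X P β K π Z I haz) {D : ℝ}
    (hD : ∀ t e, |β ⬝ᵥ Z t e| ≤ D) (t : ℝ) (ω : Ω) :
    Real.exp (-D) * X.atRisk t ω ≤ X.weight t β ω := by
  unfold Triple.weight
  rw [h.covariate_eq, mul_comm]
  refine mul_le_mul_of_nonneg_left (Real.exp_le_exp.mpr (abs_le.mp (hD _ _)).1) ?_
  rcases atRisk_eq_zero_or_one X t ω with hd | hd <;> simp [hd]

variable [IsProbabilityMeasure P]

/-- The tail bound with `a = 2` and range `2 * K`, whence `(2 + 1/2) * 2K = 5K`, and a union over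
the coordinates. -/
theorem score_tail (h : IsRegular X P β K π Z I haz) (hK : 0 < K) (hn : 0 < n) {ℓ : ℝ}
    (hℓ : 0 < ℓ) :
    (Measure.pi fun _ : Fin n => P) {ω | ∃ k, 5 * K * (√ℓ / √n) < |score X ω β k|} ≤
      p * (2 * ENNReal.ofReal (Real.exp (-(2 * ℓ)))) := by
  have hn' : (0 : ℝ) < n := by exact_mod_cast hn
  have h1 : ∀ k, (Measure.pi fun _ : Fin n => P) {ω | 5 * K * (√ℓ / √n) < |score X ω β k|} ≤
      2 * ENNReal.ofReal (Real.exp (-(2 * ℓ))) := by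
    intro k
    refine (measure_mono ?_).trans (measure_abs_lt_le (Measure.pi fun _ : Fin n => P)
      ((h.score_measurable k).const_mul (n : ℝ)) hn' (show 0 < 2 * K by linarith) hℓ
      (fun θ => h.lintegral_exp_score_le_one hK k θ) 2)
    intro ω hω
    have hω : 5 * K * (√ℓ / √n) < |score X ω β k| := hω
    show (2 + 1 / 2) * (2 * K) * √(n * ℓ) < |n * score X ω β k|
    rw [abs_mul, abs_of_pos hn', Real.sqrt_mul hn'.le]
    have e : (2 + 1 / 2) * (2 * K) * (√n * √ℓ) = n * (5 * K * (√ℓ / √n)) := by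
      have : √(n : ℝ) ≠ 0 := (Real.sqrt_pos.mpr hn').ne'
      field_simp
      rw [Real.sq_sqrt hn'.le]; ring
    rw [e]
    exact mul_lt_mul_of_pos_left hω hn'
  have e : {ω : Fin n → Ω | ∃ k, 5 * K * (√ℓ / √n) < |score X ω β k|} =
      ⋃ k, {ω | 5 * K * (√ℓ / √n) < |score X ω β k|} := by ext; simp
  rw [e]
  refine (measure_iUnion_fintype_le _ _).trans ((Finset.sum_le_sum fun k _ => h1 k).trans ?_)
  simp

theorem weight_integrable (h : IsRegular X P β K π Z I haz) {D : ℝ}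
    (hD : ∀ t e, |β ⬝ᵥ Z t e| ≤ D) (t : ℝ) : Integrable (X.weight t β) P := by
  refine Integrable.of_bound (h.measurable_weight.comp measurable_prodMk_left).aestronglyMeasurable
    (Real.exp D) (Eventually.of_forall fun ω => ?_)
  rw [Real.norm_of_nonneg (weight_nonneg X t β ω)]
  refine (h.weight_le hD t ω).trans ?_
  have := Real.exp_pos D
  rcases atRisk_eq_zero_or_one X t ω with hd | hd <;> rw [hd] <;> linarith

theorem covariate_mul_weight_integrable (h : IsRegular X P β K π Z I haz) {D : ℝ}
    (hD : ∀ t e, |β ⬝ᵥ Z t e| ≤ D) (t : ℝ) (k : Fin p) :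
    Integrable (fun ω => X.covariate t ω k * X.weight t β ω) P :=
  (h.weight_integrable hD t).bdd_mul (c := K)
    ((h.measurable_covariate k).comp measurable_prodMk_left).aestronglyMeasurable
    (Eventually.of_forall fun ω => h.abs_covariate_le t ω k)

theorem abs_mu_le (h : IsRegular X P β K π Z I haz) (hK : 0 ≤ K) {D : ℝ}
    (hD : ∀ t e, |β ⬝ᵥ Z t e| ≤ D) (t : ℝ) (k : Fin p) : |X.mu P t β k| ≤ K := by
  have h0 : 0 ≤ ∫ ω, X.weight t β ω ∂P := integral_nonneg fun ω => weight_nonneg X t β ω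
  rw [Triple.mu, abs_div, abs_of_nonneg h0]
  refine div_le_of_le_mul₀ h0 hK ?_
  rw [← integral_const_mul]
  refine (abs_integral_le_integral_abs).trans (integral_mono
    (h.covariate_mul_weight_integrable hD t k).abs ((h.weight_integrable hD t).const_mul K)
    fun ω => ?_)
  simp only [abs_mul, abs_of_nonneg (weight_nonneg X t β ω)]
  exact mul_le_mul_of_nonneg_right (h.abs_covariate_le t ω k) (weight_nonneg X t β ω)

theorem mu_measurable (h : IsRegular X P β K π Z I haz) (k : Fin p) :
    Measurable fun t => X.mu P t β k := by
  refine Measurable.div ?_ ?_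
  · exact (((h.measurable_covariate k).mul h.measurable_weight).stronglyMeasurable
      |>.integral_prod_right').measurable
  · exact (h.measurable_weight.stronglyMeasurable.integral_prod_right').measurable

/-- No positivity of the mean weight is needed: if it is zero, the weight vanishes almost surely. -/
theorem integral_centred_weight (h : IsRegular X P β K π Z I haz) {D : ℝ}
    (hD : ∀ t e, |β ⬝ᵥ Z t e| ≤ D) (t : ℝ) (k : Fin p) :
    ∫ ω, (X.covariate t ω k - X.mu P t β k) * X.weight t β ω ∂P = 0 := by
  have e : ∀ ω, (X.covariate t ω k - X.mu P t β k) * X.weight t β ω =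
      X.covariate t ω k * X.weight t β ω - X.mu P t β k * X.weight t β ω := fun ω => by ring
  simp_rw [e]
  rw [integral_sub (h.covariate_mul_weight_integrable hD t k)
    ((h.weight_integrable hD t).const_mul _), integral_const_mul]
  by_cases h0 : ∫ ω, X.weight t β ω ∂P = 0
  · rw [h0, mul_zero, sub_zero]
    have hz := (integral_eq_zero_iff_of_nonneg (fun ω => weight_nonneg X t β ω)
      (h.weight_integrable hD t)).mp h0
    refine integral_eq_zero_of_ae ?_
    filter_upwards [hz] with ω hω
    simp only [Pi.zero_apply] at hω ⊢
    rw [hω, mul_zero]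
  · rw [Triple.mu, div_mul_cancel₀ _ h0, sub_self]

end IsRegular

/-- Independence of one individual from the others. -/
theorem lintegral_pi_exp_sum_erase_le_one {Ω : Type*} [MeasurableSpace Ω] (P : Measure Ω)
    [IsProbabilityMeasure P] {n : ℕ} {T : Ω → ℝ} (hT : Measurable T) (i : Fin n)
    {g : ℝ → Ω → ℝ} (hg : Measurable fun q : ℝ × Ω => g q.1 q.2)
    (h : ∀ t, ∫⁻ x, ENNReal.ofReal (Real.exp (g t x)) ∂P ≤ 1) :
    ∫⁻ ω, ENNReal.ofReal (Real.exp (∑ j ∈ Finset.univ.erase i, g (T (ω i)) (ω j)))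
      ∂(Measure.pi fun _ : Fin n => P) ≤ 1 := by
  have hm1 : Measurable fun q : (Fin n → Ω) × Ω => ENNReal.ofReal (Real.exp
      (∑ j ∈ Finset.univ.erase i, g (T q.2) (q.1 j))) := by
    refine (Real.continuous_exp.measurable.comp
      (Finset.measurable_fun_sum _ fun j _ => ?_)).ennreal_ofReal
    exact hg.comp ((hT.comp measurable_snd).prodMk ((measurable_pi_apply j).comp measurable_fst))
  have hm2 : Measurable fun ω : Fin n → Ω => ENNReal.ofReal (Real.exp
      (∑ j ∈ Finset.univ.erase i, g (T (ω i)) (ω j))) :=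
    hm1.comp (measurable_id.prodMk (measurable_pi_apply i))
  rw [lintegral_pi_resample P i hm2]
  have e : ∀ (ω : Fin n → Ω) (x : Ω), ∑ j ∈ Finset.univ.erase i,
      g (T (Function.update ω i x i)) (Function.update ω i x j) =
      ∑ j ∈ Finset.univ.erase i, g (T x) (ω j) := fun ω x =>
    Finset.sum_congr rfl fun j hj => by
      rw [Function.update_self, Function.update_of_ne (Finset.ne_of_mem_erase hj)]
  simp_rw [e]
  rw [lintegral_lintegral_swap hm1.aemeasurable]
  calc _ ≤ ∫⁻ _ : Ω, (1 : ENNReal) ∂P := lintegral_mono fun x =>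
        lintegral_pi_exp_sum_le_one P (Finset.univ.erase i)
          (hg.comp measurable_prodMk_left) (h (T x))
    _ = 1 := by simp

/-- The number of individuals at risk at the time of individual `i`. -/
def riskCount {Ω : Type*} {p n : ℕ} (X : Triple Ω p) (ω : Fin n → Ω) (i : Fin n) : ℕ :=
  (Finset.univ.filter fun j => X.time (ω i) ≤ X.time (ω j)).card

theorem sum_atRisk_eq {Ω : Type*} {p n : ℕ} (X : Triple Ω p) (ω : Fin n → Ω) (i : Fin n) :
    ∑ j, X.atRisk (X.time (ω i)) (ω j) = riskCount X ω i := by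
  simp [Triple.atRisk, riskCount]

theorem riskCount_pos {Ω : Type*} {p n : ℕ} (X : Triple Ω p) (ω : Fin n → Ω) (i : Fin n) :
    0 < riskCount X ω i := Finset.card_pos.mpr ⟨i, by simp⟩

theorem riskCount_le {Ω : Type*} {p n : ℕ} (X : Triple Ω p) (ω : Fin n → Ω) (i : Fin n) :
    riskCount X ω i ≤ n := (Finset.card_le_univ _).trans (by simp)

/-- The weighted covariate centred at its population mean. -/
def centred {Ω : Type*} [MeasurableSpace Ω] {p : ℕ} (X : Triple Ω p) (P : Measure Ω)
    (β : Fin p → ℝ) (k : Fin p) (t : ℝ) (ω : Ω) : ℝ :=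
  (X.covariate t ω k - X.mu P t β k) * X.weight t β ω

/-- Given the time of individual `i`, the other terms of the numerator are independent with mean
zero, so that it concentrates. -/
theorem zbar_sub_mu {Ω : Type*} [MeasurableSpace Ω] {p n : ℕ} (X : Triple Ω p) (P : Measure Ω)
    (β : Fin p → ℝ) (k : Fin p) (ω : Fin n → Ω) (i : Fin n) :
    zbar X ω (X.time (ω i)) β k - X.mu P (X.time (ω i)) β k =
      (∑ j, centred X P β k (X.time (ω i)) (ω j)) / ∑ j, X.weight (X.time (ω i)) β (ω j) := by
  have h := (sum_weight_pos X ω β i).ne'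
  simp only [centred, sub_mul, Finset.sum_sub_distrib, ← Finset.mul_sum, sub_div,
    mul_div_cancel_right₀ _ h]
  simp only [zbar, normWeight, Finset.sum_div, mul_div_assoc]

/-! ### Deviation of the risk-set average from its population mean. -/

namespace IsRegular

variable {Ω E : Type*} [MeasurableSpace Ω] [MeasurableSpace E] {p : ℕ} {X : Triple Ω p}
  {P : Measure Ω} {β : Fin p → ℝ} {K : ℝ} {π : Ω → E}
  {Z : ℝ → E → Fin p → ℝ} {I : Set ℝ} {haz : ℝ → ℝ} {n : ℕ}

/-- The numerator is of order `√(R ℓ)` by assumption, and the denominator is at least `exp (-D) *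
R`. -/
theorem abs_zbar_sub_mu_le (h : IsRegular X P β K π Z I haz) (hK : 0 < K) {D : ℝ}
    (hD : ∀ t e, |β ⬝ᵥ Z t e| ≤ D) {ℓ : ℝ} (hℓ : 1 ≤ ℓ) (k : Fin p) (ω : Fin n → Ω) (i : Fin n)
    (hω : |∑ j, centred X P β k (X.time (ω i)) (ω j)| ≤ 9 / 2 * (2 * K * Real.exp D) *
        √(riskCount X ω i * ℓ)) :
    |zbar X ω (X.time (ω i)) β k - X.mu P (X.time (ω i)) β k| ≤
      9 * K * Real.exp D ^ 2 * √ℓ * (1 / √(riskCount X ω i)) := by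
  have hR1 : (0 : ℝ) < riskCount X ω i := by exact_mod_cast riskCount_pos X ω i
  have hW : Real.exp (-D) * riskCount X ω i ≤ ∑ j, X.weight (X.time (ω i)) β (ω j) := by
    rw [← sum_atRisk_eq, Finset.mul_sum]
    exact Finset.sum_le_sum fun j _ => h.le_weight hD _ _
  have hpos := sum_weight_pos X ω β i
  rw [zbar_sub_mu, abs_div, abs_of_pos hpos, div_le_iff₀ hpos]
  refine hω.trans ?_
  set R : ℝ := (riskCount X ω i : ℝ)
  have hr : 0 < √R := Real.sqrt_pos.mpr hR1
  have hrr : √R ^ 2 = R := Real.sq_sqrt hR1.le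
  have hE : Real.exp D * Real.exp (-D) = 1 := by rw [← Real.exp_add]; simp
  rw [Real.sqrt_mul hR1.le]
  calc 9 / 2 * (2 * K * Real.exp D) * (√R * √ℓ)
      = 9 * K * Real.exp D * (Real.exp D * Real.exp (-D)) * √ℓ * √R := by rw [hE]; ring
    _ = 9 * K * Real.exp D ^ 2 * √ℓ * (1 / √R) * (Real.exp (-D) * R) := by
        nth_rewrite 3 [← hrr]
        field_simp
    _ ≤ _ := by gcongr

variable [IsProbabilityMeasure P]

theorem centred_measurable (h : IsRegular X P β K π Z I haz) (k : Fin p) :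
    Measurable fun q : ℝ × Ω => centred X P β k q.1 q.2 :=
  ((h.measurable_covariate k).sub ((h.mu_measurable k).comp measurable_fst)).mul
    h.measurable_weight

theorem abs_centred_le (h : IsRegular X P β K π Z I haz) (hK : 0 ≤ K) {D : ℝ}
    (hD : ∀ t e, |β ⬝ᵥ Z t e| ≤ D) (k : Fin p) (t : ℝ) (ω : Ω) :
    |centred X P β k t ω| ≤ 2 * K * Real.exp D * X.atRisk t ω := by
  rw [centred, abs_mul, abs_of_nonneg (weight_nonneg X t β ω), mul_assoc (2 * K)]
  refine mul_le_mul ?_ (h.weight_le hD t ω) (weight_nonneg X t β ω) (by linarith)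
  refine (abs_sub _ _).trans ?_
  linarith [h.abs_covariate_le t ω k, h.abs_mu_le hK hD t k]

theorem lintegral_exp_centred_le_one (h : IsRegular X P β K π Z I haz) (hK : 0 < K) {D : ℝ}
    (hD : ∀ t e, |β ⬝ᵥ Z t e| ≤ D) (k : Fin p) (θ t : ℝ) :
    ∫⁻ ω, ENNReal.ofReal (Real.exp (θ * centred X P β k t ω -
      (θ * (2 * K * Real.exp D)) ^ 2 / 2 * X.atRisk t ω)) ∂P ≤ 1 :=
  lintegral_exp_compensated_le_one P θ (by positivity)
    ((h.centred_measurable k).comp measurable_prodMk_left) (atRisk_eq_zero_or_one X t)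
    (h.abs_centred_le hK.le hD k t) (h.integral_centred_weight hD t k)

/-- The leave-one-out exponential inequality. -/
theorem lintegral_exp_sum_erase_le_one (h : IsRegular X P β K π Z I haz) (hK : 0 < K) {D : ℝ}
    (hD : ∀ t e, |β ⬝ᵥ Z t e| ≤ D) (k : Fin p) (θ : ℝ) (i : Fin n) :
    ∫⁻ ω, ENNReal.ofReal (Real.exp (∑ j ∈ Finset.univ.erase i,
      (θ * centred X P β k (X.time (ω i)) (ω j) -
        (θ * (2 * K * Real.exp D)) ^ 2 / 2 * X.atRisk (X.time (ω i)) (ω j))))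
      ∂(Measure.pi fun _ : Fin n => P) ≤ 1 := by
  exact lintegral_pi_exp_sum_erase_le_one P h.measurable_time i
    (g := fun t x => θ * centred X P β k t x -
      (θ * (2 * K * Real.exp D)) ^ 2 / 2 * X.atRisk t x)
    (((h.centred_measurable k).const_mul θ).sub (h.measurable_atRisk.const_mul _))
    (h.lintegral_exp_centred_le_one hK hD k θ)

/-- Uniform control of the centred sums at the observed times. -/
theorem centred_tail (h : IsRegular X P β K π Z I haz) (hK : 0 < K) {D : ℝ}
    (hD : ∀ t e, |β ⬝ᵥ Z t e| ≤ D) {ℓ : ℝ} (hℓ : 1 ≤ ℓ) :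
    (Measure.pi fun _ : Fin n => P) {ω | ∃ i k, 9 / 2 * (2 * K * Real.exp D) *
        √(riskCount X ω i * ℓ) < |∑ j, centred X P β k (X.time (ω i)) (ω j)|} ≤
      (n * p * n : ℕ) * (2 * ENNReal.ofReal (Real.exp (-(3 * ℓ)))) := by
  set b := 2 * K * Real.exp D with hb
  have hb0 : 0 < b := by positivity
  set f : Fin n → Fin p → ℝ → (Fin n → Ω) → ℝ := fun i k θ ω => ∑ j ∈ Finset.univ.erase i,
      (θ * centred X P β k (X.time (ω i)) (ω j) -
        (θ * b) ^ 2 / 2 * X.atRisk (X.time (ω i)) (ω j)) with hf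
  have hfm : ∀ i k θ, Measurable (f i k θ) := fun i k θ => by
    refine Finset.measurable_fun_sum _ fun j _ => ?_
    have hpair : Measurable fun ω : Fin n → Ω => (X.time (ω i), ω j) :=
      (h.measurable_time.comp (measurable_pi_apply i)).prodMk (measurable_pi_apply j)
    exact (((h.centred_measurable k).comp hpair).const_mul θ).sub
      ((h.measurable_atRisk.comp hpair).const_mul _)
  have htail := fun i k θ => measure_lt_le_of_lintegral_exp_le_one _ (hfm i k θ)
    (h.lintegral_exp_sum_erase_le_one hK hD k θ i) (3 * ℓ)
  -- The best exponent depends on the random size of the risk set. It is replaced by one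
  -- deterministic exponent for each possible size `m + 1`, at the price of one more factor `n` in
  -- the union bound.
  set θ : Fin n → ℝ := fun m => ℓ / (√((m + 1 : ℕ) * ℓ) * b) with hθ
  have hsub : {ω : Fin n → Ω | ∃ i k, 9 / 2 * b * √(riskCount X ω i * ℓ) <
      |∑ j, centred X P β k (X.time (ω i)) (ω j)|} ⊆
      ⋃ q : (Fin n × Fin p) × Fin n, ({ω | 3 * ℓ < f q.1.1 q.1.2 (θ q.2) ω} ∪
        {ω | 3 * ℓ < f q.1.1 q.1.2 (-θ q.2) ω}) := by
    rintro ω ⟨i, k, hik⟩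
    have hr1 := riskCount_pos X ω i
    have hr2 := riskCount_le X ω i
    set m : Fin n := ⟨riskCount X ω i - 1, by omega⟩ with hm
    have hm1 : ((m + 1 : ℕ) : ℝ) = riskCount X ω i := by
      have : (m : ℕ) + 1 = riskCount X ω i := by simp [hm]; omega
      rw [this]
    have hR1 : (1 : ℝ) ≤ riskCount X ω i := by exact_mod_cast hr1
    set R : ℝ := (riskCount X ω i : ℝ) with hR
    set r := √(R * ℓ) with hrdef
    have hRl : 1 ≤ R * ℓ := by nlinarith
    have hrr : r ^ 2 = R * ℓ := Real.sq_sqrt (by linarith)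
    have hr0 : 1 ≤ r := Real.one_le_sqrt.mpr hRl
    have hθm : θ m = ℓ / (r * b) := by simp only [hθ]; rw [hm1]
    have hθ0 : 0 < θ m := by rw [hθm]; positivity
    have hS : ∑ j ∈ Finset.univ.erase i, X.atRisk (X.time (ω i)) (ω j) ≤ R := by
      rw [hR, ← sum_atRisk_eq]
      refine Finset.sum_le_sum_of_subset_of_nonneg (Finset.subset_univ _) fun j _ _ => ?_
      rcases atRisk_eq_zero_or_one X (X.time (ω i)) (ω j) with hd | hd <;> simp [hd]
    have hown : |centred X P β k (X.time (ω i)) (ω i)| ≤ b := by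
      refine (h.abs_centred_le hK.le hD k _ _).trans ?_
      rcases atRisk_eq_zero_or_one X (X.time (ω i)) (ω i) with hd | hd <;> rw [hd] <;> linarith
    have hdecomp : ∑ j, centred X P β k (X.time (ω i)) (ω j) =
        centred X P β k (X.time (ω i)) (ω i) +
          ∑ j ∈ Finset.univ.erase i, centred X P β k (X.time (ω i)) (ω j) :=
      (Finset.add_sum_erase _ _ (Finset.mem_univ i)).symm
    set A := ∑ j ∈ Finset.univ.erase i, centred X P β k (X.time (ω i)) (ω j) with hA
    have hfe : ∀ θ', f i k θ' ω = θ' * A - (θ' * b) ^ 2 / 2 *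
        ∑ j ∈ Finset.univ.erase i, X.atRisk (X.time (ω i)) (ω j) := fun θ' => by
      simp only [hf, Finset.sum_sub_distrib, ← Finset.mul_sum, hA]
    have hq : (θ m * b) ^ 2 / 2 * R = ℓ / 2 := by
      rw [hθm]; field_simp; rw [hrr]; ring
    -- Removing the own term of individual `i` costs at most `b ≤ b * r`, so `9/2` becomes `7/2`;
    -- the variance term then takes `ℓ / 2` and leaves `3 ℓ`.
    have hAbig : 7 / 2 * b * r < |A| := by
      have : |∑ j, centred X P β k (X.time (ω i)) (ω j)| ≤ b + |A| := by
        rw [hdecomp]; exact (abs_add_le _ _).trans (by linarith)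
      nlinarith
    have hθA : 7 / 2 * ℓ = θ m * (7 / 2 * b * r) := by rw [hθm]; field_simp
    have hvar : (θ m * b) ^ 2 / 2 *
        ∑ j ∈ Finset.univ.erase i, X.atRisk (X.time (ω i)) (ω j) ≤ ℓ / 2 := by
      rw [← hq]; exact mul_le_mul_of_nonneg_left hS (by positivity)
    refine Set.mem_iUnion.mpr ⟨((i, k), m), ?_⟩
    rcases lt_abs.mp hAbig with h1 | h1
    · left
      show 3 * ℓ < f i k (θ m) ω
      rw [hfe]
      have := mul_lt_mul_of_pos_left h1 hθ0
      linarith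
    · right
      show 3 * ℓ < f i k (-θ m) ω
      rw [hfe, show (-θ m * b) ^ 2 = (θ m * b) ^ 2 by ring]
      have := mul_lt_mul_of_pos_left h1 hθ0
      linarith
  refine (measure_mono hsub).trans ((measure_iUnion_fintype_le _ _).trans
    ((Finset.sum_le_sum fun q _ => (measure_union_le _ _).trans
      (add_le_add (htail _ _ _) (htail _ _ _))).trans ?_))
  simp [two_mul, mul_add]

end IsRegular

theorem abs_mul_sub_mul_le {x y a b c d M : ℝ} (h1 : |x - c| ≤ M) (h2 : |y - b| ≤ M) :
    |(x - a) * (y - b) - (x - c) * (y - d)| ≤ M * (|a - c| + |b - d|) := by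
  have e : (x - a) * (y - b) - (x - c) * (y - d) = -((a - c) * (y - b)) - (x - c) * (b - d) := by
    ring
  rw [e]
  refine (abs_sub _ _).trans ?_
  rw [abs_neg, abs_mul, abs_mul]
  nlinarith [abs_nonneg (a - c), abs_nonneg (b - d)]

theorem abs_event_mul_le {Ω : Type*} {p : ℕ} (X : Triple Ω p) (ω : Ω) (x : ℝ) :
    |X.event ω * x| ≤ |x| := by
  rcases event_eq_zero_or_one X ω with h | h <;> simp [h]

theorem normWeight_nonneg {Ω : Type*} {p n : ℕ} (X : Triple Ω p) (ω : Fin n → Ω) (s : ℝ)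
    (β : Fin p → ℝ) (i : Fin n) : 0 ≤ normWeight X ω s β i :=
  div_nonneg (weight_nonneg X _ _ _) (Finset.sum_nonneg fun _ _ => weight_nonneg X _ _ _)

theorem sum_normWeight_le_one {Ω : Type*} {p n : ℕ} (X : Triple Ω p) (ω : Fin n → Ω) (s : ℝ)
    (β : Fin p → ℝ) : ∑ i, normWeight X ω s β i ≤ 1 := by
  simp only [normWeight, ← Finset.sum_div]
  exact div_self_le_one _

theorem abs_zbar_le {Ω : Type*} {p n : ℕ} {X : Triple Ω p} {K : ℝ} (hK : 0 ≤ K)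
    (hX : ∀ t ω k, |X.covariate t ω k| ≤ K) (β : Fin p → ℝ) (ω : Fin n → Ω) (s : ℝ)
    (k : Fin p) : |zbar X ω s β k| ≤ K := by
  refine (Finset.abs_sum_le_sum_abs _ _).trans ?_
  calc _ ≤ ∑ i, K * normWeight X ω s β i := by
        refine Finset.sum_le_sum fun i _ => ?_
        rw [abs_mul, abs_of_nonneg (normWeight_nonneg X ω s β i)]
        exact mul_le_mul_of_nonneg_right (hX _ _ _) (normWeight_nonneg X ω s β i)
    _ ≤ K := by
        rw [← Finset.mul_sum]
        exact mul_le_of_le_one_right hK (sum_normWeight_le_one X ω s β)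

/-- The summand of the population version of `vhat`. -/
def popTerm {Ω : Type*} [MeasurableSpace Ω] {p : ℕ} (X : Triple Ω p) (P : Measure Ω)
    (β : Fin p → ℝ) (k l : Fin p) (ω : Ω) : ℝ :=
  X.integralN (fun s => (X.covariate s ω k - X.mu P s β k) *
    (X.covariate s ω l - X.mu P s β l)) ω

/-! ### Entrywise deviation of `vhat` from `sigma`. -/

namespace IsRegular

variable {Ω E : Type*} [MeasurableSpace Ω] [MeasurableSpace E] {p : ℕ} {X : Triple Ω p}
  {P : Measure Ω} [IsProbabilityMeasure P] {β : Fin p → ℝ} {K : ℝ} {π : Ω → E}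
  {Z : ℝ → E → Fin p → ℝ} {I : Set ℝ} {haz : ℝ → ℝ} {n : ℕ}

theorem abs_covariate_sub_mu_le (h : IsRegular X P β K π Z I haz) (hK : 0 ≤ K) {D : ℝ}
    (hD : ∀ t e, |β ⬝ᵥ Z t e| ≤ D) (k : Fin p) (t : ℝ) (ω : Ω) :
    |X.covariate t ω k - X.mu P t β k| ≤ 2 * K := by
  refine (abs_sub _ _).trans ?_
  linarith [h.abs_covariate_le t ω k, h.abs_mu_le hK hD t k]

theorem popTerm_measurable (h : IsRegular X P β K π Z I haz) (k l : Fin p) :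
    Measurable (popTerm X P β k l) := by
  have hpair : Measurable fun ω : Ω => (X.time ω, ω) := h.measurable_time.prodMk measurable_id
  have h1 : ∀ k, Measurable fun ω => X.covariate (X.time ω) ω k - X.mu P (X.time ω) β k :=
    fun k => ((h.measurable_covariate k).comp hpair).sub
      ((h.mu_measurable k).comp h.measurable_time)
  exact h.measurable_event.mul ((h1 k).mul (h1 l))

theorem abs_popTerm_le (h : IsRegular X P β K π Z I haz) (hK : 0 ≤ K) {D : ℝ}
    (hD : ∀ t e, |β ⬝ᵥ Z t e| ≤ D) (k l : Fin p) (ω : Ω) : |popTerm X P β k l ω| ≤ 4 * K ^ 2 := by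
  refine (abs_event_mul_le X ω _).trans ?_
  rw [abs_mul]
  refine (mul_le_mul (h.abs_covariate_sub_mu_le hK hD k _ ω)
    (h.abs_covariate_sub_mu_le hK hD l _ ω) (abs_nonneg _) (by linarith)).trans (le_of_eq ?_)
  ring

theorem abs_sigma_le (h : IsRegular X P β K π Z I haz) (hK : 0 ≤ K) {D : ℝ}
    (hD : ∀ t e, |β ⬝ᵥ Z t e| ≤ D) (k l : Fin p) : |X.sigma P β k l| ≤ 4 * K ^ 2 := by
  have h1 : X.sigma P β k l = ∫ ω, popTerm X P β k l ω ∂P := rfl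
  rw [h1, ← Real.norm_eq_abs]
  refine (norm_integral_le_of_norm_le_const (C := 4 * K ^ 2)
    (Eventually.of_forall fun ω => h.abs_popTerm_le hK hD k l ω)).trans ?_
  simp

/-- Hoeffding for bounded i.i.d. terms: the range is `8 K²` after centring, and `a = 3` gives `(3 +
1/2) * 8 = 28`. -/
theorem popTerm_tail (h : IsRegular X P β K π Z I haz) (hK : 0 < K) {D : ℝ}
    (hD : ∀ t e, |β ⬝ᵥ Z t e| ≤ D) (hn : 0 < n) {ℓ : ℝ} (hℓ : 0 < ℓ) :
    (Measure.pi fun _ : Fin n => P) {ω | ∃ k l, 28 * K ^ 2 * √(n * ℓ) <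
        |∑ i, (popTerm X P β k l (ω i) - X.sigma P β k l)|} ≤
      (p * p : ℕ) * (2 * ENNReal.ofReal (Real.exp (-(3 * ℓ)))) := by
  have hn' : (0 : ℝ) < n := by exact_mod_cast hn
  have hb : 0 < 8 * K ^ 2 := by positivity
  have h1 : ∀ q : Fin p × Fin p, (Measure.pi fun _ : Fin n => P) {ω | 28 * K ^ 2 * √(n * ℓ) <
        |∑ i, (popTerm X P β q.1 q.2 (ω i) - X.sigma P β q.1 q.2)|} ≤
      2 * ENNReal.ofReal (Real.exp (-(3 * ℓ))) := by
    intro q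
    have hm : Measurable fun x => popTerm X P β q.1 q.2 x - X.sigma P β q.1 q.2 :=
      (h.popTerm_measurable _ _).sub_const _
    have hinteg : Integrable (popTerm X P β q.1 q.2) P :=
      Integrable.of_bound (h.popTerm_measurable _ _).aestronglyMeasurable (4 * K ^ 2)
        (Eventually.of_forall fun ω => h.abs_popTerm_le hK.le hD _ _ ω)
    have key := measure_abs_lt_le (Measure.pi fun _ : Fin n => P)
      (f := fun ω => ∑ i, (popTerm X P β q.1 q.2 (ω i) - X.sigma P β q.1 q.2))
      (Finset.measurable_fun_sum _ fun i _ => hm.comp (measurable_pi_apply i)) hn' hb hℓ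
      (fun θ => ?_) 3
    · refine (measure_mono fun ω hω => ?_).trans key
      refine lt_of_eq_of_lt ?_ (show 28 * K ^ 2 * √(n * ℓ) < _ from hω)
      ring
    · have h2 := lintegral_exp_compensated_le_one P (ξ := fun x =>
        popTerm X P β q.1 q.2 x - X.sigma P β q.1 q.2) (Y := fun _ => 1) θ hb hm
        (fun _ => Or.inr rfl) (fun ω => by
          rw [mul_one]
          refine (abs_sub _ _).trans ?_
          linarith [h.abs_popTerm_le hK.le hD q.1 q.2 ω, h.abs_sigma_le hK.le hD q.1 q.2])
        (by
          rw [integral_sub hinteg (integrable_const _)]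
          simp only [integral_const, probReal_univ, one_smul]
          exact sub_self _)
      refine le_of_eq_of_le (lintegral_congr fun ω => ?_) (lintegral_pi_exp_sum_le_one P
        Finset.univ ((hm.const_mul θ).sub_const _) h2)
      congr 2
      simp only [mul_one]
      rw [Finset.mul_sum, Finset.sum_sub_distrib (f := fun i =>
        θ * (popTerm X P β q.1 q.2 (ω i) - X.sigma P β q.1 q.2))]
      simp
  have e : {ω : Fin n → Ω | ∃ k l, 28 * K ^ 2 * √(n * ℓ) <
        |∑ i, (popTerm X P β k l (ω i) - X.sigma P β k l)|} =
      ⋃ q : Fin p × Fin p, {ω | 28 * K ^ 2 * √(n * ℓ) <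
        |∑ i, (popTerm X P β q.1 q.2 (ω i) - X.sigma P β q.1 q.2)|} := by ext; simp
  rw [e]
  refine (measure_iUnion_fintype_le _ _).trans ((Finset.sum_le_sum fun q _ => h1 q).trans ?_)
  simp

/-- The entrywise deviation of `vhat` at the true parameter from its population version. -/
theorem vhat_tail (h : IsRegular X P β K π Z I haz) (hK : 0 < K) {D : ℝ}
    (hD : ∀ t e, |β ⬝ᵥ Z t e| ≤ D) (hn : 0 < n) {ℓ : ℝ} (hℓ : 1 ≤ ℓ) :
    (Measure.pi fun _ : Fin n => P) {ω | ∃ k l,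
        (72 * K ^ 2 * Real.exp D ^ 2 + 28 * K ^ 2) * (√ℓ / √n) <
          |vhat X ω β k l - X.sigma P β k l|} ≤
      (n * p * n + p * p : ℕ) * (2 * ENNReal.ofReal (Real.exp (-(3 * ℓ)))) := by
  have hn' : (0 : ℝ) < n := by exact_mod_cast hn
  have hsq : 0 < √(n : ℝ) := Real.sqrt_pos.mpr hn'
  have hsq2 : √(n : ℝ) ^ 2 = n := Real.sq_sqrt hn'.le
  rw [Nat.cast_add, add_mul ((n * p * n : ℕ) : ENNReal)]
  refine (measure_mono ?_).trans ((measure_union_le _ _).trans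
    (add_le_add (h.centred_tail (n := n) hK hD hℓ)
      (h.popTerm_tail (n := n) (ℓ := ℓ) hK hD hn (by linarith))))
  intro ω hω
  by_contra hcon
  simp only [Set.mem_union, Set.mem_ofPred_eq, not_or, not_exists, not_lt] at hcon hω
  obtain ⟨h1, h2⟩ := hcon
  obtain ⟨k, l, hkl⟩ := hω
  have hz := fun k i => h.abs_zbar_sub_mu_le hK hD hℓ k ω i (h1 i k)
  set c := 9 * K * Real.exp D ^ 2 * √ℓ with hc
  have hc0 : 0 ≤ c := by positivity
  -- The cost of replacing the risk-set average by the population mean, plus a centred i.i.d.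
  -- average.
  have e1 : vhat X ω β k l - X.sigma P β k l =
      (1 / (n : ℝ)) * ∑ i, X.event (ω i) * ((X.covariate (X.time (ω i)) (ω i) k -
          zbar X ω (X.time (ω i)) β k) * (X.covariate (X.time (ω i)) (ω i) l -
          zbar X ω (X.time (ω i)) β l) - (X.covariate (X.time (ω i)) (ω i) k -
          X.mu P (X.time (ω i)) β k) * (X.covariate (X.time (ω i)) (ω i) l -
          X.mu P (X.time (ω i)) β l)) +
      (1 / (n : ℝ)) * ∑ i, (popTerm X P β k l (ω i) - X.sigma P β k l) := by
    have : X.sigma P β k l = (1 / (n : ℝ)) * ∑ _i : Fin n, X.sigma P β k l := by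
      simp only [Finset.sum_const, Finset.card_univ, Fintype.card_fin, nsmul_eq_mul]
      field_simp
    conv_lhs => rw [this]
    simp only [vhat, Matrix.of_apply, popTerm, Triple.integralN]
    rw [← mul_sub, ← mul_add, ← Finset.sum_sub_distrib, ← Finset.sum_add_distrib]
    congr 1
    exact Finset.sum_congr rfl fun i _ => by ring
  -- Each summand is at most `2K` times two deviations bounded by `c / √R`. Summing `1 / √R` over
  -- risk sets gives at most `2 √n`, and `4 * 9 * 2 = 72`.
  have b1 : |∑ i, X.event (ω i) * ((X.covariate (X.time (ω i)) (ω i) k -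
          zbar X ω (X.time (ω i)) β k) * (X.covariate (X.time (ω i)) (ω i) l -
          zbar X ω (X.time (ω i)) β l) - (X.covariate (X.time (ω i)) (ω i) k -
          X.mu P (X.time (ω i)) β k) * (X.covariate (X.time (ω i)) (ω i) l -
          X.mu P (X.time (ω i)) β l))| ≤ 4 * K * c * (2 * √n) := by
    refine (Finset.abs_sum_le_sum_abs _ _).trans ?_
    calc _ ≤ ∑ i, 4 * K * c * (1 / √(riskCount X ω i)) := by
          refine Finset.sum_le_sum fun i _ => (abs_event_mul_le X _ _).trans ?_
          refine (abs_mul_sub_mul_le (M := 2 * K) (h.abs_covariate_sub_mu_le hK.le hD k _ _)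
            ?_).trans ?_
          · refine (abs_sub _ _).trans ?_
            linarith [h.abs_covariate_le (X.time (ω i)) (ω i) l,
              abs_zbar_le hK.le h.abs_covariate_le β ω (X.time (ω i)) l]
          · nlinarith [hz k i, hz l i]
      _ = 4 * K * c * ∑ i, 1 / √(riskCount X ω i) := by rw [Finset.mul_sum]
      _ ≤ _ := by
          refine mul_le_mul_of_nonneg_left ?_ (by positivity)
          exact sum_inv_sqrt_card_le fun i => X.time (ω i)
  have b2 := h2 k l
  have hle : |vhat X ω β k l - X.sigma P β k l| ≤
      (72 * K ^ 2 * Real.exp D ^ 2 + 28 * K ^ 2) * (√ℓ / √n) := by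
    rw [e1]
    refine (abs_add_le _ _).trans ?_
    rw [abs_mul, abs_mul, abs_of_pos (by positivity : 0 < 1 / (n : ℝ))]
    calc _ ≤ 1 / (n : ℝ) * (4 * K * c * (2 * √n)) + 1 / (n : ℝ) * (28 * K ^ 2 * √(n * ℓ)) := by
          gcongr
      _ = _ := by
          rw [Real.sqrt_mul hn'.le, hc]
          field_simp
          rw [hsq2]
          field_simp
          ring
  linarith

end IsRegular

/-! ### Transfer between versions of the covariate process -/

section Transfer

variable {Ω : Type*} {p n : ℕ} {X Y : Triple Ω p} {ω : Fin n → Ω}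

/-- Two triples agree on a sample if all that enters the estimators agrees. -/
structure Agree (X Y : Triple Ω p) (ω : Fin n → Ω) : Prop where
  time_eq : Y.time = X.time
  event_eq : Y.event = X.event
  covariate_eq : ∀ i j, Y.covariate (X.time (ω i)) (ω j) = X.covariate (X.time (ω i)) (ω j)

theorem Agree.weight_eq (h : Agree X Y ω) (β : Fin p → ℝ) (i j : Fin n) :
    Y.weight (X.time (ω i)) β (ω j) = X.weight (X.time (ω i)) β (ω j) := by
  simp only [Triple.weight, Triple.atRisk, h.time_eq, h.covariate_eq]

theorem Agree.normWeight_eq (h : Agree X Y ω) (β : Fin p → ℝ) (i j : Fin n) :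
    normWeight Y ω (X.time (ω i)) β j = normWeight X ω (X.time (ω i)) β j := by
  simp only [normWeight, h.weight_eq]

theorem Agree.zbar_eq (h : Agree X Y ω) (β : Fin p → ℝ) (i : Fin n) :
    zbar Y ω (X.time (ω i)) β = zbar X ω (X.time (ω i)) β := by
  funext k
  simp only [zbar, h.normWeight_eq, h.covariate_eq]

theorem Agree.logLik_eq (h : Agree X Y ω) : logLik Y ω = logLik X ω := by
  funext β
  simp only [logLik, Triple.integralN, h.time_eq, h.event_eq, h.covariate_eq, h.weight_eq]

theorem Agree.score_eq (h : Agree X Y ω) (β : Fin p → ℝ) : score Y ω β = score X ω β := by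
  funext k
  simp only [score, Triple.integralN, h.time_eq, h.event_eq, h.covariate_eq, h.zbar_eq]

theorem Agree.hessian_eq (h : Agree X Y ω) (β : Fin p → ℝ) : hessian Y ω β = hessian X ω β := by
  ext k l
  simp only [hessian, Matrix.of_apply, Triple.integralN, h.time_eq, h.event_eq, h.covariate_eq,
    h.zbar_eq, h.normWeight_eq]

theorem Agree.vhat_eq (h : Agree X Y ω) (β : Fin p → ℝ) : vhat Y ω β = vhat X ω β := by
  ext k l
  simp only [vhat, Matrix.of_apply, Triple.integralN, h.time_eq, h.event_eq, h.covariate_eq,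
    h.zbar_eq]

theorem Agree.kappa_eq (h : Agree X Y ω) (β : Fin p → ℝ) : kappa Y ω β = kappa X ω β := by
  simp only [kappa, h.hessian_eq]

end Transfer

section Regularise

variable {Ω : Type*} [MeasurableSpace Ω] {p : ℕ} (X : Triple Ω p) (P : Measure Ω)
  (K : ℝ)

theorem ae_agree_regTriple [IsProbabilityMeasure P] {n : ℕ} {L : ℝ} (hB : X.BoundedCovariates P K)
    (hL : X.LipschitzCovariates P L) (hT : ∀ᵐ ω ∂P, X.time ω ∈ X.timeSet P) :
    ∀ᵐ ω ∂(Measure.pi fun _ : Fin n => P), Agree X (regTriple X P K) ω := by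
  have hq := fun i : Fin n => Measure.quasiMeasurePreserving_eval (fun _ : Fin n => P) i
  have h1 : ∀ᵐ ω ∂(Measure.pi fun _ : Fin n => P), ∀ i, X.time (ω i) ∈ X.timeSet P :=
    ae_all_iff.mpr fun i => (hq i).ae hT
  have h2 : ∀ᵐ ω ∂(Measure.pi fun _ : Fin n => P), ∀ i, ∀ t ∈ X.timeSet P,
      regCov X P K t ⟨ω i⟩ = X.covariate t (ω i) :=
    ae_all_iff.mpr fun i => (hq i).ae (ae_regCov_eq X P K hB hL)
  filter_upwards [h1, h2] with ω w1 w2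
  exact ⟨rfl, rfl, fun i j => w2 j _ (w1 i)⟩

/-- The two versions of `mu` are compared on the time index set only; the observed time lies there
almost surely. -/
theorem sigma_regTriple {L : ℝ} (hB : X.BoundedCovariates P K)
    (hL : X.LipschitzCovariates P L) (hT : ∀ᵐ ω ∂P, X.time ω ∈ X.timeSet P) (β : Fin p → ℝ) :
    (regTriple X P K).sigma P β = X.sigma P β := by
  have hr := ae_regCov_eq X P K hB hL
  have hmu : ∀ t ∈ X.timeSet P, (regTriple X P K).mu P t β = X.mu P t β := by
    intro t ht
    have hw : ∀ᵐ ω ∂P, (regTriple X P K).weight t β ω = X.weight t β ω := by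
      filter_upwards [hr] with ω hω
      show X.atRisk t ω * Real.exp (β ⬝ᵥ regCov X P K t ⟨ω⟩) = _
      rw [hω t ht]; rfl
    funext k
    simp only [Triple.mu]
    congr 1
    · refine integral_congr_ae ?_
      filter_upwards [hr, hw] with ω h1 h2
      rw [h2]
      show regCov X P K t ⟨ω⟩ k * _ = _
      rw [h1 t ht]
    · exact integral_congr_ae hw
  ext k l
  simp only [Triple.sigma, Matrix.of_apply]
  refine integral_congr_ae ?_
  filter_upwards [hr, hT] with ω h1 h2
  simp only [Triple.integralN]
  show X.event ω * ((regCov X P K (X.time ω) ⟨ω⟩ k - (regTriple X P K).mu P (X.time ω) β k) *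
    (regCov X P K (X.time ω) ⟨ω⟩ l - (regTriple X P K).mu P (X.time ω) β l)) = _
  rw [h1 _ h2, hmu _ h2]

end Regularise

/-! ### Log-sum-exp inequalities -/

section LogSumExp

variable {ι : Type*} (s : Finset ι) {w a : ι → ℝ}

/-- Squaring `1 + x / 2 ≤ exp (x / 2)`; the lower bound on `x` keeps the left side nonnegative. -/
theorem sq_one_add_half_le_exp {x : ℝ} (hx : -2 ≤ x) : 1 + x + x ^ 2 / 4 ≤ Real.exp x := by
  have h1 : (1 + x / 2) ^ 2 ≤ Real.exp (x / 2) ^ 2 :=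
    pow_le_pow_left₀ (by linarith) (by linarith [Real.add_one_le_exp (x / 2)]) 2
  have h2 : Real.exp (x / 2) ^ 2 = Real.exp x := by
    rw [← Real.exp_nat_mul]; congr 1; push_cast; ring
  rw [h2] at h1
  linarith [h1, (by ring : (1 + x / 2) ^ 2 = 1 + x + x ^ 2 / 4)]

theorem sum_mul_exp_eq (m : ℝ) :
    ∑ i ∈ s, w i * Real.exp (a i) = Real.exp m * ∑ i ∈ s, w i * Real.exp (a i - m) := by
  rw [Finset.mul_sum]
  refine Finset.sum_congr rfl fun i _ => ?_
  rw [mul_left_comm, ← Real.exp_add, add_sub_cancel]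

theorem sum_mul_sub_mean (hs : ∑ i ∈ s, w i = 1) :
    ∑ i ∈ s, w i * (a i - ∑ j ∈ s, w j * a j) = 0 := by
  simp only [mul_sub, Finset.sum_sub_distrib, ← Finset.sum_mul, hs]
  ring

theorem one_le_sum_mul_exp (hw : ∀ i ∈ s, 0 ≤ w i) (hs : ∑ i ∈ s, w i = 1) :
    1 ≤ ∑ i ∈ s, w i * Real.exp (a i - ∑ j ∈ s, w j * a j) := by
  calc (1 : ℝ) = ∑ i ∈ s, w i * ((a i - ∑ j ∈ s, w j * a j) + 1) := by
        simp only [mul_add, Finset.sum_add_distrib, sum_mul_sub_mean s hs, mul_one, hs, zero_add]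
    _ ≤ _ := Finset.sum_le_sum fun i hi =>
        mul_le_mul_of_nonneg_left (Real.add_one_le_exp _) (hw i hi)

/-- Log-sum-exp exceeds the mean by at least an eighth of the variance. -/
theorem mean_add_variance_le_log (hw : ∀ i ∈ s, 0 ≤ w i) (hs : ∑ i ∈ s, w i = 1)
    (ha : ∀ i ∈ s, |a i - ∑ j ∈ s, w j * a j| ≤ 1) :
    (∑ j ∈ s, w j * a j) + 1 / 8 * ∑ i ∈ s, w i * (a i - ∑ j ∈ s, w j * a j) ^ 2 ≤
      Real.log (∑ i ∈ s, w i * Real.exp (a i)) := by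
  set m := ∑ j ∈ s, w j * a j with hm
  set V := ∑ i ∈ s, w i * (a i - m) ^ 2 with hV
  have hV0 : 0 ≤ V := Finset.sum_nonneg fun i hi => mul_nonneg (hw i hi) (sq_nonneg _)
  have hV1 : V ≤ 1 := by
    rw [← hs]
    refine Finset.sum_le_sum fun i hi => mul_le_of_le_one_right (hw i hi) ?_
    rw [← sq_abs]
    exact pow_le_one₀ (abs_nonneg _) (ha i hi)
  have h1 : 1 + V / 4 ≤ ∑ i ∈ s, w i * Real.exp (a i - m) := by
    calc 1 + V / 4 = ∑ i ∈ s, w i * (1 + (a i - m) + (a i - m) ^ 2 / 4) := by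
          have h0 := sum_mul_sub_mean (a := a) s hs
          rw [← hm] at h0
          simp only [mul_add, Finset.sum_add_distrib, mul_one, hs, h0, mul_div_assoc', add_zero,
            ← Finset.sum_div]
          rw [← hV]
      _ ≤ _ := Finset.sum_le_sum fun i hi => mul_le_mul_of_nonneg_left
          (sq_one_add_half_le_exp (by linarith [(abs_le.mp (ha i hi)).1])) (hw i hi)
  have hpos : 0 < 1 + V / 4 := by linarith
  rw [sum_mul_exp_eq s m, Real.log_mul (Real.exp_pos m).ne' (by linarith), Real.log_exp]
  have h2 := Real.log_le_log hpos h1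
  have h3 := Real.one_sub_inv_le_log_of_pos hpos
  -- The variance is at most one, so the denominator `1 + V / 4` is below two.
  have h4 : V / 8 ≤ 1 - (1 + V / 4)⁻¹ := by
    have : 1 - (1 + V / 4)⁻¹ = (V / 4) / (1 + V / 4) := by field_simp; ring
    rw [this, le_div_iff₀ hpos]
    nlinarith
  linarith

/-- Convexity of log-sum-exp along a ray. -/
theorem log_sum_mul_exp_smul_le (hw : ∀ i ∈ s, 0 ≤ w i) (hs : ∑ i ∈ s, w i = 1) {t : ℝ}
    (h0 : 0 ≤ t) (h1 : t ≤ 1) :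
    Real.log (∑ i ∈ s, w i * Real.exp (t * a i)) ≤
      t * Real.log (∑ i ∈ s, w i * Real.exp (a i)) := by
  have hpos : ∀ b : ι → ℝ, 0 < ∑ i ∈ s, w i * Real.exp (b i) := fun b => by
    rw [sum_mul_exp_eq s (∑ j ∈ s, w j * b j)]
    exact mul_pos (Real.exp_pos _) (lt_of_lt_of_le one_pos (one_le_sum_mul_exp s hw hs))
  -- Shifting by `m` normalises the exponential sum to one; convexity of `exp` between `0` and `a i
  -- - m` then suffices.
  set m := Real.log (∑ i ∈ s, w i * Real.exp (a i)) with hm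
  have hone : ∑ i ∈ s, w i * Real.exp (a i - m) = 1 := by
    have := sum_mul_exp_eq (w := w) (a := a) s m
    rw [hm, Real.exp_log (hpos a), ← hm] at this
    exact mul_left_cancel₀ (hpos a).ne' (by rw [← this, mul_one])
  rw [Real.log_le_iff_le_exp (hpos _), sum_mul_exp_eq s (t * m)]
  refine mul_le_of_le_one_right (Real.exp_pos _).le ?_
  calc _ ≤ ∑ i ∈ s, w i * ((1 - t) + t * Real.exp (a i - m)) := by
        refine Finset.sum_le_sum fun i hi => mul_le_mul_of_nonneg_left ?_ (hw i hi)
        have := convexOn_exp.2 (Set.mem_univ 0) (Set.mem_univ (a i - m))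
          (sub_nonneg.mpr h1) h0 (by ring)
        simp only [smul_eq_mul, mul_zero, zero_add, Real.exp_zero, mul_one] at this
        rw [← mul_sub]; exact this
    _ = 1 := by
        simp only [mul_add, Finset.sum_add_distrib, ← Finset.sum_mul, hs, mul_left_comm _ t,
          ← Finset.mul_sum, hone]
        ring

end LogSumExp

/-! ### The `ℓ₁` norm -/

section EllOne

variable {p : ℕ}

theorem l1_nonneg (v : Fin p → ℝ) : 0 ≤ l1 v := Finset.sum_nonneg fun _ _ => abs_nonneg _

theorem l1_smul (t : ℝ) (v : Fin p → ℝ) : l1 (t • v) = |t| * l1 v := by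
  simp only [l1, Pi.smul_apply, smul_eq_mul, abs_mul, Finset.mul_sum]

theorem l1_add_le (u v : Fin p → ℝ) : l1 (u + v) ≤ l1 u + l1 v := by
  rw [l1, l1, l1, ← Finset.sum_add_distrib]
  exact Finset.sum_le_sum fun i _ => abs_add_le _ _

theorem abs_dotProduct_le {u v : Fin p → ℝ} {K : ℝ} (hv : ∀ j, |v j| ≤ K) :
    |u ⬝ᵥ v| ≤ l1 u * K := by
  refine (Finset.abs_sum_le_sum_abs _ _).trans ?_
  rw [l1, Finset.sum_mul]
  refine Finset.sum_le_sum fun j _ => ?_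
  rw [abs_mul]
  exact mul_le_mul_of_nonneg_left (hv j) (abs_nonneg _)

end EllOne

/-! ### Expansion of the log-partial likelihood -/

section Expansion

variable {Ω : Type*} {p n : ℕ} {X : Triple Ω p} (ω : Fin n → Ω) (β u : Fin p → ℝ)

theorem weight_add (s : ℝ) (w : Ω) :
    X.weight s (β + u) w = X.weight s β w * Real.exp (u ⬝ᵥ X.covariate s w) := by
  simp only [Triple.weight, add_dotProduct, Real.exp_add, mul_assoc]

theorem sum_normWeight (m : Fin n) : ∑ i, normWeight X ω (X.time (ω m)) β i = 1 := by
  simp only [normWeight, ← Finset.sum_div]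
  exact div_self (sum_weight_pos X ω β m).ne'

theorem sum_normWeight_mul_dotProduct (s : ℝ) :
    ∑ i, normWeight X ω s β i * (u ⬝ᵥ X.covariate s (ω i)) = u ⬝ᵥ zbar X ω s β := by
  simp only [dotProduct, zbar, Finset.mul_sum]
  rw [Finset.sum_comm]
  exact Finset.sum_congr rfl fun k _ => Finset.sum_congr rfl fun i _ => by ring

/-- The increment of the logarithm of the risk set sum. -/
def logIncr (X : Triple Ω p) (s : ℝ) : ℝ :=
  Real.log (∑ i, normWeight X ω s β i * Real.exp (u ⬝ᵥ X.covariate s (ω i)))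

theorem sum_normWeight_exp (s : ℝ) :
    ∑ i, normWeight X ω s β i * Real.exp (u ⬝ᵥ X.covariate s (ω i)) =
      (∑ i, X.weight s (β + u) (ω i)) / ∑ i, X.weight s β (ω i) := by
  simp only [weight_add, normWeight, Finset.sum_div]
  exact Finset.sum_congr rfl fun i _ => by ring

theorem log_sum_weight_add (m : Fin n) :
    Real.log (∑ j, X.weight (X.time (ω m)) (β + u) (ω j)) =
      Real.log (∑ j, X.weight (X.time (ω m)) β (ω j)) + logIncr ω β u X (X.time (ω m)) := by
  rw [logIncr, sum_normWeight_exp, Real.log_div (sum_weight_pos X ω _ m).ne'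
    (sum_weight_pos X ω _ m).ne']
  ring

theorem logLik_add : logLik X ω (β + u) = logLik X ω β +
    (1 / (n : ℝ)) * ∑ i, X.event (ω i) * (u ⬝ᵥ X.covariate (X.time (ω i)) (ω i)) -
    (1 / (n : ℝ)) * ∑ i, X.event (ω i) * logIncr ω β u X (X.time (ω i)) := by
  simp only [logLik, Triple.integralN, log_sum_weight_add, add_dotProduct, mul_add,
    Finset.sum_add_distrib]
  ring

theorem score_dotProduct : score X ω β ⬝ᵥ u =
    (1 / (n : ℝ)) * ∑ i, X.event (ω i) * (u ⬝ᵥ X.covariate (X.time (ω i)) (ω i)) -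
    (1 / (n : ℝ)) * ∑ i, X.event (ω i) * (u ⬝ᵥ zbar X ω (X.time (ω i)) β) := by
  simp only [score, Triple.integralN, dotProduct, Finset.sum_mul, Finset.mul_sum]
  rw [Finset.sum_comm, ← Finset.sum_sub_distrib]
  refine Finset.sum_congr rfl fun i _ => ?_
  rw [← Finset.sum_sub_distrib]
  exact Finset.sum_congr rfl fun k _ => by ring

/-- Puts the quadratic form in terms of the variances of `mean_add_variance_le_log`. -/
theorem dotProduct_neg_hessian : u ⬝ᵥ (-hessian X ω β) *ᵥ u =
    (1 / (n : ℝ)) * ∑ m, X.event (ω m) * ∑ i, normWeight X ω (X.time (ω m)) β i *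
      (u ⬝ᵥ X.covariate (X.time (ω m)) (ω i) - u ⬝ᵥ zbar X ω (X.time (ω m)) β) ^ 2 := by
  have h : ∀ m i, (u ⬝ᵥ X.covariate (X.time (ω m)) (ω i) - u ⬝ᵥ zbar X ω (X.time (ω m)) β) ^ 2 =
      ∑ k, ∑ l, u k * (X.covariate (X.time (ω m)) (ω i) k - zbar X ω (X.time (ω m)) β k) *
        (u l * (X.covariate (X.time (ω m)) (ω i) l - zbar X ω (X.time (ω m)) β l)) := by
    intro m i
    rw [← dotProduct_sub, sq, dotProduct, Finset.sum_mul_sum]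
    rfl
  have hcomm : ∀ F : Fin n → Fin n → Fin p → Fin p → ℝ,
      ∑ m, ∑ i, ∑ k, ∑ l, F m i k l = ∑ k, ∑ l, ∑ m, ∑ i, F m i k l := fun F => by
    calc _ = ∑ m, ∑ k, ∑ l, ∑ i, F m i k l := Finset.sum_congr rfl fun m _ => by
          rw [Finset.sum_comm]; exact Finset.sum_congr rfl fun k _ => Finset.sum_comm
      _ = _ := by
          rw [Finset.sum_comm]; exact Finset.sum_congr rfl fun k _ => Finset.sum_comm
  simp only [h]
  simp only [dotProduct, mulVec, hessian, Matrix.neg_apply, Matrix.of_apply, neg_neg,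
    Triple.integralN, Finset.mul_sum, Finset.sum_mul]
  rw [hcomm]
  exact Finset.sum_congr rfl fun k _ => Finset.sum_congr rfl fun l _ =>
    Finset.sum_congr rfl fun m _ => Finset.sum_congr rfl fun i _ => by ring

variable {K : ℝ}

theorem abs_dotProduct_sub_zbar_le (hK : 0 ≤ K) (hX : ∀ t w k, |X.covariate t w k| ≤ K)
    (s : ℝ) (i : Fin n) :
    |u ⬝ᵥ X.covariate s (ω i) - u ⬝ᵥ zbar X ω s β| ≤ 2 * K * l1 u := by
  rw [← dotProduct_sub]
  refine (abs_dotProduct_le (K := 2 * K) fun j => ?_).trans (le_of_eq (mul_comm _ _))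
  refine (abs_sub _ _).trans ?_
  linarith [hX s (ω i) j, abs_zbar_le hK hX β ω s j]

/-- Local strong concavity of the log-partial likelihood. -/
theorem logLik_add_le (hK : 0 ≤ K) (hX : ∀ t w k, |X.covariate t w k| ≤ K)
    (hu : 2 * K * l1 u ≤ 1) :
    logLik X ω (β + u) ≤ logLik X ω β + score X ω β ⬝ᵥ u -
      1 / 8 * (u ⬝ᵥ (-hessian X ω β) *ᵥ u) := by
  rw [logLik_add, score_dotProduct, dotProduct_neg_hessian]
  have key : ∑ i, X.event (ω i) * (u ⬝ᵥ zbar X ω (X.time (ω i)) β) +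
      1 / 8 * ∑ m, X.event (ω m) * ∑ i, normWeight X ω (X.time (ω m)) β i *
      (u ⬝ᵥ X.covariate (X.time (ω m)) (ω i) - u ⬝ᵥ zbar X ω (X.time (ω m)) β) ^ 2 ≤
      ∑ i, X.event (ω i) * logIncr ω β u X (X.time (ω i)) := by
    rw [Finset.mul_sum, ← Finset.sum_add_distrib]
    refine Finset.sum_le_sum fun m _ => ?_
    have h := mean_add_variance_le_log Finset.univ (w := normWeight X ω (X.time (ω m)) β)
      (a := fun i => u ⬝ᵥ X.covariate (X.time (ω m)) (ω i))
      (fun i _ => normWeight_nonneg X ω _ β i) (sum_normWeight ω β m)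
      (fun i _ => by
        rw [sum_normWeight_mul_dotProduct]
        exact (abs_dotProduct_sub_zbar_le ω β u hK hX _ i).trans hu)
    rw [sum_normWeight_mul_dotProduct] at h
    rcases event_eq_zero_or_one X (ω m) with he | he
    · simp [he]
    · rw [he]; simpa [logIncr] using h
  have := mul_le_mul_of_nonneg_left key (by positivity : 0 ≤ 1 / (n : ℝ))
  linarith

/-- Concavity along a segment, with no smallness of `u`: the linear part scales with `t`, and
`log_sum_mul_exp_smul_le` covers the rest. -/
theorem le_logLik_add_smul {t : ℝ} (h0 : 0 ≤ t) (h1 : t ≤ 1) :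
    (1 - t) * logLik X ω β + t * logLik X ω (β + u) ≤ logLik X ω (β + t • u) := by
  rw [logLik_add, logLik_add]
  have key : ∑ i, X.event (ω i) * logIncr ω β (t • u) X (X.time (ω i)) ≤
      t * ∑ i, X.event (ω i) * logIncr ω β u X (X.time (ω i)) := by
    rw [Finset.mul_sum]
    refine Finset.sum_le_sum fun m _ => ?_
    rcases event_eq_zero_or_one X (ω m) with he | he
    · simp [he]
    · rw [he, one_mul, one_mul]
      simpa [logIncr, smul_dotProduct] using log_sum_mul_exp_smul_le Finset.univ
        (fun i _ => normWeight_nonneg X ω (X.time (ω m)) β i) (sum_normWeight ω β m) h0 h1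
        (a := fun i => u ⬝ᵥ X.covariate (X.time (ω m)) (ω i))
  have e : ∑ i, X.event (ω i) * (t • u ⬝ᵥ X.covariate (X.time (ω i)) (ω i)) =
      t * ∑ i, X.event (ω i) * (u ⬝ᵥ X.covariate (X.time (ω i)) (ω i)) := by
    rw [Finset.mul_sum]
    exact Finset.sum_congr rfl fun i _ => by rw [smul_dotProduct, smul_eq_mul]; ring
  rw [e]
  have := mul_le_mul_of_nonneg_left key (by positivity : 0 ≤ 1 / (n : ℝ))
  linarith

/-- Moving the parameter tilts the weights to `w i * exp (a i - μ) / S`, where `S ≥ 1` by Jensen.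
Since the covariates are centred under `w`, only `exp (a i - μ) - 1` matters; it is at most `4 K l1
u`, and meets a centred covariate of size `2K`. -/
theorem abs_zbar_add_sub_le (hK : 0 ≤ K) (hX : ∀ t w k, |X.covariate t w k| ≤ K)
    (hu : 2 * K * l1 u ≤ 1) (m : Fin n) (k : Fin p) :
    |zbar X ω (X.time (ω m)) (β + u) k - zbar X ω (X.time (ω m)) β k| ≤ 8 * K ^ 2 * l1 u := by
  set s := X.time (ω m) with hs
  set w := normWeight X ω s β with hw
  set a : Fin n → ℝ := fun i => u ⬝ᵥ X.covariate s (ω i) with ha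
  set μ := ∑ j, w j * a j with hμ
  have hμ' : μ = u ⬝ᵥ zbar X ω s β := sum_normWeight_mul_dotProduct ω β u s
  have hw0 : ∀ i, 0 ≤ w i := normWeight_nonneg X ω s β
  have hw1 : ∑ i, w i = 1 := sum_normWeight ω β m
  set S := ∑ i, w i * Real.exp (a i - μ) with hS
  have hS1 : 1 ≤ S := one_le_sum_mul_exp Finset.univ (fun i _ => hw0 i) hw1
  have hnw : ∀ i, normWeight X ω s (β + u) i = w i * Real.exp (a i - μ) / S := by
    intro i
    have h1 : ∑ i, X.weight s (β + u) (ω i) = (∑ i, X.weight s β (ω i)) * (Real.exp μ * S) := by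
      rw [hS, ← sum_mul_exp_eq, sum_normWeight_exp, mul_div_cancel₀ _ (sum_weight_pos X ω β m).ne']
    have hp := (sum_weight_pos X ω β m).ne'
    rw [← hs] at hp
    have e1 : Real.exp (a i) = Real.exp μ * Real.exp (a i - μ) := by
      rw [← Real.exp_add, add_sub_cancel]
    have hem := (Real.exp_pos μ).ne'
    have hS0 : S ≠ 0 := by positivity
    rw [normWeight, h1, weight_add, hw, normWeight]
    change X.weight s β (ω i) * Real.exp (a i) / _ = _
    rw [e1]
    field_simp
  have hdiff : zbar X ω s (β + u) k - zbar X ω s β k =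
      (∑ i, w i * (X.covariate s (ω i) k - zbar X ω s β k) * (Real.exp (a i - μ) - 1)) / S := by
    have hS0 : S ≠ 0 := by positivity
    have hc : ∑ i, w i * (X.covariate s (ω i) k - zbar X ω s β k) = 0 := by
      simp only [mul_sub, Finset.sum_sub_distrib, ← Finset.sum_mul, hw1]
      simp only [zbar, ← hw, mul_comm (w _)]
      ring
    simp only [mul_sub, Finset.sum_sub_distrib, mul_one] at hc ⊢
    rw [eq_div_iff hS0]
    have e1 : zbar X ω s (β + u) k * S =
        ∑ i, X.covariate s (ω i) k * (w i * Real.exp (a i - μ)) := by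
      simp only [zbar, hnw, Finset.sum_mul]
      refine Finset.sum_congr rfl fun i _ => ?_
      field_simp
    have e2 : zbar X ω s β k * S = ∑ i, zbar X ω s β k * (w i * Real.exp (a i - μ)) := by
      rw [hS, Finset.mul_sum]
    rw [sub_mul, e1, e2, hc, sub_zero, ← Finset.sum_sub_distrib]
    exact Finset.sum_congr rfl fun i _ => by ring
  rw [hdiff, abs_div, abs_of_pos (by linarith : 0 < S)]
  refine (div_le_self (abs_nonneg _) hS1).trans ((Finset.abs_sum_le_sum_abs _ _).trans ?_)
  calc _ ≤ ∑ i, w i * (8 * K ^ 2 * l1 u) := by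
        refine Finset.sum_le_sum fun i _ => ?_
        rw [abs_mul, abs_mul, abs_of_nonneg (hw0 i), mul_assoc]
        refine mul_le_mul_of_nonneg_left ?_ (hw0 i)
        have b1 : |X.covariate s (ω i) k - zbar X ω s β k| ≤ 2 * K :=
          (abs_sub _ _).trans (by linarith [hX s (ω i) k, abs_zbar_le hK hX β ω s k])
        have b2 : |a i - μ| ≤ 2 * K * l1 u := by
          rw [hμ']; exact abs_dotProduct_sub_zbar_le ω β u hK hX s i
        have b3 := Real.abs_exp_sub_one_le (b2.trans hu)
        refine (mul_le_mul b1 (b3.trans (mul_le_mul_of_nonneg_left b2 zero_le_two))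
          (abs_nonneg _) (by linarith)).trans (le_of_eq (by ring))
    _ = _ := by rw [← Finset.sum_mul, hw1, one_mul]

theorem abs_vhat_add_sub_le (hK : 0 ≤ K) (hX : ∀ t w k, |X.covariate t w k| ≤ K)
    (hu : 2 * K * l1 u ≤ 1) (k l : Fin p) :
    |vhat X ω (β + u) k l - vhat X ω β k l| ≤ 32 * K ^ 3 * l1 u := by
  simp only [vhat, Matrix.of_apply, Triple.integralN]
  rw [← mul_sub, ← Finset.sum_sub_distrib, abs_mul, abs_of_nonneg (by positivity : 0 ≤ 1 / (n : ℝ))]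
  have hl := l1_nonneg u
  calc _ ≤ 1 / (n : ℝ) * ∑ _i : Fin n, 32 * K ^ 3 * l1 u := by
        refine mul_le_mul_of_nonneg_left ((Finset.abs_sum_le_sum_abs _ _).trans
          (Finset.sum_le_sum fun i _ => ?_)) (by positivity)
        rw [← mul_sub]
        refine (abs_event_mul_le X _ _).trans ?_
        have b : ∀ β' j, |X.covariate (X.time (ω i)) (ω i) j - zbar X ω (X.time (ω i)) β' j| ≤
            2 * K := fun β' j => (abs_sub _ _).trans
          (by linarith [hX (X.time (ω i)) (ω i) j, abs_zbar_le hK hX β' ω (X.time (ω i)) j])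
        refine (abs_mul_sub_mul_le (b β k) (b (β + u) l)).trans ?_
        have := mul_le_mul_of_nonneg_left (add_le_add (abs_zbar_add_sub_le ω β u hK hX hu i k)
          (abs_zbar_add_sub_le ω β u hK hX hu i l)) (by linarith : 0 ≤ 2 * K)
        linarith
    _ ≤ _ := by
        rw [Finset.sum_const, Finset.card_univ, Fintype.card_fin, nsmul_eq_mul, ← mul_assoc]
        refine mul_le_of_le_one_left (by positivity) ?_
        rcases eq_or_ne (n : ℝ) 0 with h | h
        · simp [h]
        · field_simp; exact le_rfl

end Expansion

/-! ### The Lasso -/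

section Lasso

variable {Ω : Type*} {p n : ℕ} {X : Triple Ω p} (ω : Fin n → Ω) {β : Fin p → ℝ} {K lam : ℝ}

theorem neg_hessian_nonneg (u : Fin p → ℝ) : 0 ≤ u ⬝ᵥ (-hessian X ω β) *ᵥ u := by
  rw [dotProduct_neg_hessian]
  refine mul_nonneg (by positivity) (Finset.sum_nonneg fun m _ => mul_nonneg ?_
    (Finset.sum_nonneg fun i _ => mul_nonneg (normWeight_nonneg X ω _ β i) (sq_nonneg _)))
  rcases event_eq_zero_or_one X (ω m) with h | h <;> simp [h]

theorem l1_eq_add (β v : Fin p → ℝ) :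
    l1 v = ∑ j with β j ≠ 0, |v j| + ∑ j with β j = 0, |v j| := by
  rw [l1, ← Finset.sum_filter_add_sum_filter_not Finset.univ (fun j => β j ≠ 0)]
  simp only [not_not]

/-- On the support the triangle inequality loses `|u j|`; off it all of `|u j|` is gained. This
serves the Lasso and the CLIME rows alike. -/
theorem l1_sub_le_l1_add (β u : Fin p → ℝ) :
    l1 β + ∑ j with β j = 0, |u j| - ∑ j with β j ≠ 0, |u j| ≤ l1 (β + u) := by
  rw [l1_eq_add β β, l1_eq_add β (β + u)]
  have h1 : ∑ j with β j = 0, |β j| = 0 :=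
    Finset.sum_eq_zero fun j hj => by simp [(Finset.mem_filter.mp hj).2]
  have h2 : ∑ j with β j = 0, |(β + u) j| = ∑ j with β j = 0, |u j| :=
    Finset.sum_congr rfl fun j hj => by simp [(Finset.mem_filter.mp hj).2]
  have h3 : ∑ j with β j ≠ 0, |β j| ≤
      ∑ j with β j ≠ 0, |(β + u) j| + ∑ j with β j ≠ 0, |u j| := by
    rw [← Finset.sum_add_distrib]
    refine Finset.sum_le_sum fun j _ => ?_
    have := abs_sub (β j + u j) (u j)
    rwa [add_sub_cancel_right] at this
  rw [h1, h2]
  linarith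

/-- The compatibility inequality. -/
theorem sum_support_le_of_kappa {M : NNReal} (hκ : (kappa X ω β)⁻¹ ≤ M) {u : Fin p → ℝ}
    (hcone : ∑ j with β j = 0, |u j| ≤ 2 * ∑ j with β j ≠ 0, |u j|) :
    ∑ j with β j ≠ 0, |u j| ≤ M * (√(sparsity β) * √(u ⬝ᵥ (-hessian X ω β) *ᵥ u)) := by
  have hs0 : 0 ≤ ∑ j with β j ≠ 0, |u j| := Finset.sum_nonneg fun _ _ => abs_nonneg _
  rcases eq_or_ne u 0 with rfl | hu
  · simp
  rcases hs0.eq_or_lt with hz | hpos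
  · rw [← hz]; positivity
  have h1 : kappa X ω β ≤ ENNReal.ofReal (√(sparsity β) * √(u ⬝ᵥ (-hessian X ω β) *ᵥ u)) /
      ENNReal.ofReal (∑ j with β j ≠ 0, |u j|) :=
    iInf_le (fun v : {v : Fin p → ℝ // v ≠ 0 ∧
      ∑ j with β j = 0, |v j| ≤ 2 * ∑ j with β j ≠ 0, |v j|} =>
      ENNReal.ofReal (√(sparsity β) * √(v.1 ⬝ᵥ (-hessian X ω β) *ᵥ v.1)) /
      ENNReal.ofReal (∑ j with β j ≠ 0, |v.1 j|)) ⟨u, hu, hcone⟩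
  have h2 := (ENNReal.inv_le_inv.mpr h1).trans hκ
  rw [ENNReal.inv_div (Or.inl ENNReal.ofReal_ne_top) (Or.inl (by simpa using hpos))] at h2
  have h3 := (ENNReal.div_le_iff_le_mul (Or.inr ENNReal.coe_ne_top) (Or.inl
    ENNReal.ofReal_ne_top)).mp h2
  rw [← ENNReal.ofReal_coe_nnreal, ← ENNReal.ofReal_mul M.coe_nonneg] at h3
  exact (ENNReal.ofReal_le_ofReal_iff (by positivity)).mp h3

/-- The basic inequality, for the points between the true parameter and the Lasso estimator. -/
theorem l1_le_of_penalised_le (hK : 0 ≤ K) (hX : ∀ t w k, |X.covariate t w k| ≤ K)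
    (hlam : 0 < lam) (hscore : ∀ k, |score X ω β k| ≤ lam / 3) {M : NNReal}
    (hκ : (kappa X ω β)⁻¹ ≤ M) {u : Fin p → ℝ} (hu : 2 * K * l1 u ≤ 1)
    (hle : -logLik X ω (β + u) + lam * l1 (β + u) ≤ -logLik X ω β + lam * l1 β) :
    l1 u ≤ 32 * M ^ 2 * sparsity β * lam := by
  set a := ∑ j with β j ≠ 0, |u j| with ha
  set b := ∑ j with β j = 0, |u j| with hb
  set Q := u ⬝ᵥ (-hessian X ω β) *ᵥ u with hQ
  have hQ0 : 0 ≤ Q := neg_hessian_nonneg ω u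
  have ha0 : 0 ≤ a := Finset.sum_nonneg fun _ _ => abs_nonneg _
  have hsum : l1 u = a + b := l1_eq_add β u
  have h1 := logLik_add_le ω β u hK hX hu
  have h2 := l1_sub_le_l1_add β u
  have h3 : score X ω β ⬝ᵥ u ≤ l1 u * (lam / 3) := by
    rw [dotProduct_comm]; exact (le_abs_self _).trans (abs_dotProduct_le hscore)
  have h4 := mul_le_mul_of_nonneg_left h2 hlam.le
  rw [← ha, ← hb] at h4
  rw [hsum] at h3
  -- A score below `lam / 3` takes a third of the penalty, which yields the cone with constant `2 =
  -- (4/3) / (2/3)`. Then `Q ≤ (32/3) lam a` and `a² ≤ M² d Q` give `a ≤ (32/3) M² d lam`, and `a +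
  -- b ≤ 3 a`.
  have h5 : lam * (2 / 3 * b) + 1 / 8 * Q ≤ lam * (4 / 3 * a) := by linarith
  have hcone : b ≤ 2 * a := by
    have : lam * (2 / 3 * b) ≤ lam * (4 / 3 * a) := by linarith
    have := le_of_mul_le_mul_left this hlam
    linarith
  have hk := sum_support_le_of_kappa ω hκ hcone
  rw [← ha, ← hQ] at hk
  have hb0 : 0 ≤ b := Finset.sum_nonneg fun _ _ => abs_nonneg _
  have hQle : Q ≤ 32 / 3 * lam * a := by nlinarith
  have hM := M.2
  have hsq : a ^ 2 ≤ M ^ 2 * (sparsity β * Q) := by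
    have := pow_le_pow_left₀ ha0 hk 2
    rwa [mul_pow, mul_pow, Real.sq_sqrt (Nat.cast_nonneg _), Real.sq_sqrt hQ0] at this
  have ha1 : a ≤ 32 / 3 * M ^ 2 * sparsity β * lam := by
    rcases ha0.eq_or_lt with h | h
    · rw [← h]; positivity
    · refine le_of_mul_le_mul_right ?_ h
      have : (M : ℝ) ^ 2 * (sparsity β * Q) ≤ M ^ 2 * (sparsity β * (32 / 3 * lam * a)) := by
        gcongr
      nlinarith
  rw [hsum]
  linarith

/-- Localisation: strong concavity is available only for `2 * K * l1 u ≤ 1`. By concavity every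
point of the segment from the truth to the estimator satisfies the basic inequality; a far estimator
would put such a point exactly on the boundary, where the bound, strictly inside by `hsmall`, is
violated. -/
theorem IsLasso.l1_sub_le (hK : 0 < K) (hX : ∀ t w k, |X.covariate t w k| ≤ K)
    (hlam : 0 < lam) (hscore : ∀ k, |score X ω β k| ≤ lam / 3) {M : NNReal}
    (hκ : (kappa X ω β)⁻¹ ≤ M) (hsmall : 2 * K * (32 * M ^ 2 * sparsity β * lam) < 1)
    {b : Fin p → ℝ} (hb : IsLasso X ω lam b) :
    l1 (b - β) ≤ 32 * M ^ 2 * sparsity β * lam := by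
  set v := b - β with hv
  have hbv : b = β + v := by rw [hv]; abel
  have hl := l1_nonneg v
  have key : ∀ t : ℝ, 0 ≤ t → t ≤ 1 → 2 * K * (t * l1 v) ≤ 1 →
      t * l1 v ≤ 32 * M ^ 2 * sparsity β * lam := by
    intro t h0 h1 h2
    have e : l1 (t • v) = t * l1 v := by rw [l1_smul, abs_of_nonneg h0]
    rw [← e]
    refine l1_le_of_penalised_le ω hK.le hX hlam hscore hκ (by rwa [e]) ?_
    have c1 := le_logLik_add_smul (X := X) ω β v h0 h1
    have c2 : l1 (β + t • v) ≤ (1 - t) * l1 β + t * l1 (β + v) := by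
      have : β + t • v = (1 - t) • β + t • (β + v) := by
        rw [sub_smul, smul_add, one_smul]; abel
      rw [this]
      refine (l1_add_le _ _).trans ?_
      rw [l1_smul, l1_smul, abs_of_nonneg h0, abs_of_nonneg (sub_nonneg.mpr h1)]
    have c3 := hb β
    rw [hbv] at c3
    have c4 := mul_le_mul_of_nonneg_left c3 h0
    have c5 := mul_le_mul_of_nonneg_left c2 hlam.le
    nlinarith
  rcases le_or_gt (2 * K * l1 v) 1 with h | h
  · simpa using key 1 zero_le_one le_rfl (by simpa using h)
  · exfalso
    have hp : 0 < 2 * K * l1 v := by linarith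
    have hlp : 0 < l1 v := by
      rcases hl.eq_or_lt with h' | h'
      · rw [← h'] at hp; simp at hp
      · exact h'
    have e : 2 * K * ((2 * K * l1 v)⁻¹ * l1 v) = 1 := by field_simp
    have := key (2 * K * l1 v)⁻¹ (by positivity) (inv_le_one_of_one_le₀ h.le) e.le
    have := mul_le_mul_of_nonneg_left this (by linarith : 0 ≤ 2 * K)
    linarith

end Lasso

/-! ### The CLIME estimator -/

section Clime

variable {p : ℕ}

theorem l1_single (j : Fin p) : l1 (Pi.single j (1 : ℝ)) = 1 := by
  rw [l1, Finset.sum_eq_single j]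
  · simp
  · intro i _ hi; simp [Pi.single_eq_of_ne hi]
  · simp

theorem abs_le_l1 (v : Fin p → ℝ) (j : Fin p) : |v j| ≤ l1 v :=
  Finset.single_le_sum (f := fun j => |v j|) (fun _ _ => abs_nonneg _) (Finset.mem_univ j)

theorem l1_pos {v : Fin p → ℝ} (hv : v ≠ 0) : 0 < l1 v := by
  obtain ⟨j, hj⟩ := Function.ne_iff.mp hv
  exact (abs_pos.mpr hj).trans_le (abs_le_l1 v j)

theorem bddAbove_opOne (A : Matrix (Fin p) (Fin p) ℝ) :
    BddAbove (Set.range fun v : {v : Fin p → ℝ // v ≠ 0} => l1 (A *ᵥ v.1) / l1 v.1) := by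
  refine ⟨∑ i, ∑ j, |A i j|, ?_⟩
  rintro _ ⟨⟨v, hv⟩, rfl⟩
  rw [div_le_iff₀ (l1_pos hv), l1, Finset.sum_mul]
  refine Finset.sum_le_sum fun i _ => ?_
  rw [mulVec, dotProduct]
  refine (Finset.abs_sum_le_sum_abs _ _).trans ?_
  rw [Finset.sum_mul]
  refine Finset.sum_le_sum fun j _ => ?_
  rw [abs_mul]
  exact mul_le_mul_of_nonneg_left (abs_le_l1 v j) (abs_nonneg _)

theorem l1_col_le_opOne (A : Matrix (Fin p) (Fin p) ℝ) (j : Fin p) :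
    l1 (fun i => A i j) ≤ opOne A := by
  have hne : (Pi.single j 1 : Fin p → ℝ) ≠ 0 := by simp
  have h := le_ciSup (bddAbove_opOne A) ⟨Pi.single j 1, hne⟩
  simp only [l1_single, div_one] at h
  refine le_trans (le_of_eq ?_) h
  congr 1
  funext i
  simp

theorem opOne_nonneg (A : Matrix (Fin p) (Fin p) ℝ) : 0 ≤ opOne A :=
  Real.iSup_nonneg fun _ => div_nonneg (l1_nonneg _) (l1_nonneg _)

theorem card_support_le_maxColSupport (A : Matrix (Fin p) (Fin p) ℝ) (j : Fin p) :
    (Finset.univ.filter fun i => A i j ≠ 0).card ≤ maxColSupport A := by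
  have h := Finset.le_sup (f := fun j => {i : Fin p | A i j ≠ 0}.ncard) (Finset.mem_univ j)
  refine le_trans (le_of_eq ?_) h
  rw [← Set.ncard_coe_finset]
  congr 1
  ext i; simp

/-- A vector whose `ℓ₁` norm does not exceed that of a sparse one, and which is uniformly close to
it, is close to it in `ℓ₁` norm. -/
theorem l1_sub_le_of_l1_le {x y : Fin p → ℝ} {η : ℝ} (hxy : l1 x ≤ l1 y)
    (hη : ∀ i, |x i - y i| ≤ η) :
    l1 (x - y) ≤ 2 * (Finset.univ.filter fun i => y i ≠ 0).card * η := by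
  have h1 := l1_sub_le_l1_add y (x - y)
  rw [add_sub_cancel] at h1
  have h2 : ∑ j with y j ≠ 0, |(x - y) j| ≤ (Finset.univ.filter fun i => y i ≠ 0).card * η := by
    rw [← nsmul_eq_mul]
    exact Finset.sum_le_card_nsmul _ _ _ fun i _ => hη i
  rw [l1_eq_add y]
  linarith

theorem abs_mulVec_le {A : Matrix (Fin p) (Fin p) ℝ} {η : ℝ} (hA : ∀ i j, |A i j| ≤ η)
    (v : Fin p → ℝ) (i : Fin p) : |(A *ᵥ v) i| ≤ η * l1 v := by
  rw [mulVec, dotProduct_comm, mul_comm]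
  exact abs_dotProduct_le (hA i)

/-- `ℓ₁` error bound for the rows of the CLIME estimator. -/
theorem IsClime.l1_row_sub_le {V S T : Matrix (Fin p) (Fin p) ℝ} {lam η : ℝ}
    (hdet : IsUnit S.det) (hsymm : S.IsSymm) (hη : ∀ i j, |V i j - S i j| ≤ η)
    (hlam : η * opOne S⁻¹ ≤ lam) (hη0 : 0 ≤ η) (hT : IsClime V lam T) (j : Fin p) :
    l1 (T j - S⁻¹ j) ≤ 4 * (maxColSupport S⁻¹ : ℝ) * opOne S⁻¹ * lam := by
  have hM := opOne_nonneg S⁻¹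
  have hl0 : 0 ≤ lam := le_trans (by positivity) hlam
  -- The CLIME problems concern rows, whereas `opOne` and `maxColSupport` control columns; symmetry
  -- reconciles them.
  have hsi : (S⁻¹).IsSymm := by rw [Matrix.IsSymm, Matrix.transpose_nonsing_inv, hsymm]
  have hrow : ∀ j, S⁻¹ j = fun i => S⁻¹ i j := fun j => by funext i; exact hsi.apply i j
  have hcol : ∀ j, l1 (S⁻¹ j) ≤ opOne S⁻¹ := fun j => by rw [hrow]; exact l1_col_le_opOne _ j
  have hSinv : S *ᵥ S⁻¹ j = Pi.single j 1 := by
    have : S⁻¹ j = S⁻¹ *ᵥ Pi.single j 1 := by rw [hrow]; funext i; simp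
    rw [this, Matrix.mulVec_mulVec, Matrix.mul_nonsing_inv _ hdet, Matrix.one_mulVec]
  -- Used twice: for the feasibility of the true row, and to pass from `V` to `S` at the minimiser,
  -- whose `ℓ₁` norm is no larger.
  have hinf : ∀ b : Fin p → ℝ, l1 b ≤ opOne S⁻¹ → ∀ i, |(V *ᵥ b - S *ᵥ b) i| ≤ lam := by
    intro b hb i
    rw [← Matrix.sub_mulVec]
    refine (abs_mulVec_le (A := V - S) (fun i j => hη i j) b i).trans ?_
    exact (mul_le_mul_of_nonneg_left hb hη0).trans hlam
  have hfeas : S⁻¹ j ∈ climeFeasible V lam j := by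
    rw [climeFeasible, Set.mem_ofPred_eq, pi_norm_le_iff_of_nonneg hl0]
    intro i
    rw [← hSinv]
    exact hinf _ (hcol j) i
  obtain ⟨h1, h2⟩ := hT j ⟨_, hfeas⟩
  have h3 := h2 _ hfeas
  have hS : ∀ i, |(S *ᵥ (T j - S⁻¹ j)) i| ≤ 2 * lam := by
    intro i
    rw [climeFeasible, Set.mem_ofPred_eq, pi_norm_le_iff_of_nonneg hl0] at h1
    have a1 := h1 i
    have a2 := hinf (T j) (h3.trans (hcol j)) i
    rw [Matrix.mulVec_sub, hSinv]
    simp only [Pi.sub_apply, Real.norm_eq_abs] at a1 a2 ⊢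
    rw [abs_le] at *
    constructor <;> linarith
  -- Applying `S⁻¹` turns the residual bound into a sup-norm bound; minimality of the `ℓ₁` norm and
  -- sparsity of the true row upgrade it to `ℓ₁`.
  have hsup : ∀ i, |T j i - S⁻¹ j i| ≤ 2 * opOne S⁻¹ * lam := by
    intro i
    have : T j i - S⁻¹ j i = S⁻¹ i ⬝ᵥ (S *ᵥ (T j - S⁻¹ j)) := by
      have e : S⁻¹ *ᵥ (S *ᵥ (T j - S⁻¹ j)) = T j - S⁻¹ j := by
        rw [Matrix.mulVec_mulVec, Matrix.nonsing_inv_mul _ hdet, Matrix.one_mulVec]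
      exact (congrFun e i).symm
    rw [this]
    refine (abs_dotProduct_le hS).trans ?_
    have := mul_le_mul_of_nonneg_right (hcol i) (by linarith : 0 ≤ 2 * lam)
    linarith
  refine (l1_sub_le_of_l1_le h3 hsup).trans ?_
  have hc : ((Finset.univ.filter fun i => S⁻¹ j i ≠ 0).card : ℝ) ≤ maxColSupport S⁻¹ := by
    have := card_support_le_maxColSupport S⁻¹ j
    simp only [hrow j]
    exact_mod_cast this
  calc _ ≤ 2 * (maxColSupport S⁻¹ : ℝ) * (2 * opOne S⁻¹ * lam) := by gcongr
    _ = _ := by ring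

theorem abs_dotProduct_mulVec_le {A : Matrix (Fin p) (Fin p) ℝ} {c x : Fin p → ℝ} {a b : ℝ}
    (hA : ∀ j, l1 (A j) ≤ a) (hx : ∀ j, |x j| ≤ b) (hb : 0 ≤ b) :
    |c ⬝ᵥ A *ᵥ x| ≤ l1 c * (a * b) := by
  refine abs_dotProduct_le fun j => ?_
  exact (abs_dotProduct_le hx).trans (mul_le_mul_of_nonneg_right (hA j) hb)

theorem isSymm_sigma {Ω : Type*} [MeasurableSpace Ω] (X : Triple Ω p) (P : Measure Ω)
    (β : Fin p → ℝ) : (X.sigma P β).IsSymm := by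
  refine Matrix.IsSymm.ext fun i j => ?_
  simp only [Triple.sigma, Matrix.of_apply]
  congr 1
  funext ω
  congr 1
  funext s
  exact mul_comm _ _

end Clime

/-! ### The error of the one-step correction -/

section Error

variable {Ω : Type*} {p n : ℕ}

/-- The deterministic error bound on the event where the score, the matrix `vhat` and the
compatibility factor behave. -/
theorem abs_dotProduct_clime_sub_le {X : Triple Ω p} {ω : Fin n → Ω} {β b c : Fin p → ℝ}
    {K lam lamC s η : ℝ} {M : NNReal} {S T : Matrix (Fin p) (Fin p) ℝ} (hK : 0 < K)
    (hX : ∀ t w k, |X.covariate t w k| ≤ K) (hs : 0 ≤ s) (hη : 0 ≤ η) (hlam : 0 < lam)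
    (hlam' : 15 * K * s ≤ lam) (hdet : IsUnit S.det) (hsymm : S.IsSymm)
    (hscore : ∀ k, |score X ω β k| ≤ 5 * K * s)
    (hV : ∀ k l, |vhat X ω β k l - S k l| ≤ η) (hκ : (kappa X ω β)⁻¹ ≤ M)
    (hsmall : 2 * K * (32 * M ^ 2 * sparsity β * lam) < 1)
    (hlamC : (32 * K ^ 3 * (32 * M ^ 2 * sparsity β * lam) + η) * opOne S⁻¹ ≤ lamC)
    (hb : IsLasso X ω lam b) (hT : IsClime (vhat X ω b) lamC T) (hc : l1 c = 1) :
    |c ⬝ᵥ (T - S⁻¹) *ᵥ score X ω β| ≤ 4 * (maxColSupport S⁻¹ : ℝ) * opOne S⁻¹ * lamC *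
      (5 * K * s) := by
  have hl := hb.l1_sub_le ω hK hX hlam (fun k => (hscore k).trans (by linarith)) hκ hsmall
  have hbd : ∀ k l, |vhat X ω b k l - S k l| ≤
      32 * K ^ 3 * (32 * M ^ 2 * sparsity β * lam) + η := by
    intro k l
    have h1 := abs_vhat_add_sub_le ω β (b - β) hK.le hX
      ((mul_le_mul_of_nonneg_left hl (by linarith)).trans hsmall.le) k l
    rw [add_sub_cancel] at h1
    have h2 := mul_le_mul_of_nonneg_left hl (by positivity : 0 ≤ 32 * K ^ 3)
    have h3 := abs_add_le (vhat X ω b k l - vhat X ω β k l) (vhat X ω β k l - S k l)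
    rw [sub_add_sub_cancel] at h3
    linarith [hV k l]
  have hrow := fun j => hT.l1_row_sub_le hdet hsymm hbd hlamC (by positivity) j
  have := abs_dotProduct_mulVec_le (A := T - S⁻¹) (c := c) hrow hscore (by positivity)
  rwa [hc, one_mul] at this

end Error

/-! ### Probability of the exceptional events. -/

section Probability

variable {Ω : Type*} [MeasurableSpace Ω] {p : ℕ}

/-- With `x = n p`, the exponential is the power `x ^ (-k)`, which absorbs the number `a` of events
in a union bound and leaves order `1 / n`. -/
theorem natCast_mul_exp_neg_le {a k : ℕ} {x y : ℝ} (hx : 0 < x) (h : a * y ≤ x ^ k) (hy : 0 < y) :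
    (a : ENNReal) * (2 * ENNReal.ofReal (Real.exp (-(k * Real.log x)))) ≤
      ENNReal.ofReal (2 / y) := by
  have e : Real.exp (-(k * Real.log x)) = (x ^ k)⁻¹ := by
    rw [Real.exp_neg, Real.exp_nat_mul, Real.exp_log hx]
  rw [e, ← ENNReal.ofReal_natCast a, ← ENNReal.ofReal_ofNat 2,
    ← ENNReal.ofReal_mul zero_le_two, ← ENNReal.ofReal_mul (Nat.cast_nonneg a)]
  refine ENNReal.ofReal_le_ofReal ?_
  rw [le_div_iff₀ hy]
  have hk : 0 < x ^ k := by positivity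
  have : a * (2 * (x ^ k)⁻¹) * y = 2 * (a * y) / x ^ k := by field_simp
  rw [this, div_le_iff₀ hk]
  linarith

/-- The probability that the score, `vhat` or the compatibility factor misbehaves. -/
theorem measure_error_le {X : Triple Ω p} {P : Measure Ω} [IsProbabilityMeasure P]
    {β c : Fin p → ℝ} {haz : ℝ → ℝ} {K L C B lam lamC a : ℝ} {M : NNReal} {n : ℕ} (hK : 0 < K)
    (hX : X.IsCoxModel P β haz) (hdet : IsUnit (X.sigma P β).det) (hβ : l1 β ≤ B)
    (hB : X.BoundedCovariates P K) (hL : X.LipschitzCovariates P L) (hD : X.BoundedDensity P C)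
    (hn : 0 < n) (hp : 0 < p) (hℓ : 1 ≤ Real.log (n * p)) (hlam : 0 < lam)
    (hlam' : 15 * K * (√(Real.log (n * p)) / √(n : ℝ)) ≤ lam)
    (hsmall : 2 * K * (32 * M ^ 2 * sparsity β * lam) < 1)
    (hlamC : (32 * K ^ 3 * (32 * M ^ 2 * sparsity β * lam) +
      (72 * K ^ 2 * Real.exp (B * K) ^ 2 + 28 * K ^ 2) * (√(Real.log (n * p)) / √(n : ℝ))) *
        opOne (X.sigma P β)⁻¹ ≤ lamC)
    (ha : 4 * (maxColSupport (X.sigma P β)⁻¹ : ℝ) * opOne (X.sigma P β)⁻¹ * lamC *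
      (5 * K * (√(Real.log (n * p)) / √(n : ℝ))) ≤ a)
    {b : (Fin n → Ω) → Fin p → ℝ} (hb : ∀ ω, IsLasso X ω lam (b ω))
    {T : (Fin n → Ω) → Matrix (Fin p) (Fin p) ℝ}
    (hT : ∀ ω, IsClime (vhat X ω (b ω)) lamC (T ω)) (hc : l1 c = 1) :
    (Measure.pi fun _ : Fin n => P)
        {ω | a < |c ⬝ᵥ (T ω - (X.sigma P β)⁻¹) *ᵥ score X ω β|} ≤
      (Measure.pi fun _ : Fin n => P) {ω | (M : ENNReal) < (kappa X ω β)⁻¹} +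
        ENNReal.ofReal (6 / n) := by
  obtain ⟨haz', hreg⟩ := isRegular_regTriple X P K hK.le hX hB hL hD
  have hmT : Measurable X.time := hX.measurable_failure.min hX.measurable_censor
  have hT0 : ∀ᵐ ω ∂P, X.time ω ∈ X.timeSet P :=
    (ae_time_mem_ico X P hmT (fun ω => le_min (hX.failure_nonneg ω) (hX.censor_nonneg ω))
      (measure_time_eq_zero X P hmT hD)).mono fun ω h => ico_subset_timeSet X P h
  have hag := ae_agree_regTriple X P K (n := n) hB hL hT0
  have hsig := sigma_regTriple X P K hB hL hT0 β
  have hβZ : ∀ t e, |β ⬝ᵥ regCov X P K t e| ≤ B * K := fun t e =>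
    (abs_dotProduct_le (hreg.bound t e)).trans (mul_le_mul_of_nonneg_right hβ hK.le)
  set s := √(Real.log (n * p)) / √(n : ℝ) with hs
  set η := (72 * K ^ 2 * Real.exp (B * K) ^ 2 + 28 * K ^ 2) * s with hη
  have t1 := hreg.score_tail (n := n) (ℓ := Real.log (n * p)) hK hn (by linarith)
  have t2 := hreg.vhat_tail (n := n) (ℓ := Real.log (n * p)) hK hβZ hn hℓ
  rw [← hs] at t1 t2
  rw [← hη, hsig] at t2
  have hn1 : (1 : ℝ) ≤ n := by exact_mod_cast hn
  have hp1 : (1 : ℝ) ≤ p := by exact_mod_cast hp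
  have hx : (0 : ℝ) < n * p := by positivity
  have hxp : (p : ℝ) ≤ n * p := le_mul_of_one_le_left (by linarith) hn1
  have hxn : (n : ℝ) ≤ n * p := le_mul_of_one_le_right (by linarith) hp1
  have t1' := t1.trans (natCast_mul_exp_neg_le (a := p) (k := 2) (y := n) hx
    (by rw [mul_comm (p : ℝ), sq]; exact le_mul_of_one_le_left hx.le (by linarith)) (by linarith))
  -- With `y = n / 2` this contributes `4 / n`, which joins the `2 / n` of the score to make `6 /
  -- n`.
  have t2' := t2.trans (natCast_mul_exp_neg_le (a := n * p * n + p * p) (k := 3) (y := n / 2) hx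
    (by
      push_cast
      have h1 : (n : ℝ) * p * n * n ≤ (n * p) ^ 3 := by
        rw [pow_succ, sq]
        nlinarith [mul_le_mul hxn hxn (by linarith) hx.le]
      have h2 : (p : ℝ) * p * n ≤ (n * p) ^ 3 := by
        have := mul_le_mul hxp hxp (by linarith) hx.le
        nlinarith
      linarith) (by linarith))
  -- The tails are known for the regular version, the estimators are those of the original triple;
  -- `Agree` identifies them. Only monotonicity of the measure is used, so the estimators need not
  -- be measurable.
  have hsub : {ω : Fin n → Ω | a < |c ⬝ᵥ (T ω - (X.sigma P β)⁻¹) *ᵥ score X ω β|} ⊆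
      ({ω | (M : ENNReal) < (kappa X ω β)⁻¹} ∪
        ({ω | ∃ k, 5 * K * s < |score (regTriple X P K) ω β k|} ∪
          {ω | ∃ k l, η < |vhat (regTriple X P K) ω β k l - X.sigma P β k l|})) ∪
        {ω | ¬ Agree X (regTriple X P K) ω} := by
    intro ω hω
    by_contra hcon
    simp only [Set.mem_union, Set.mem_ofPred_eq, not_or, not_exists, not_lt, not_not] at hcon hω
    obtain ⟨⟨h1, h2, h3⟩, hA⟩ := hcon
    rw [← hA.kappa_eq] at h1
    have hb' : IsLasso (regTriple X P K) ω lam (b ω) := by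
      intro β'
      rw [hA.logLik_eq]
      exact hb ω β'
    have hT' := hT ω
    rw [← hA.vhat_eq] at hT'
    have := abs_dotProduct_clime_sub_le (c := c) hK hreg.abs_covariate_le (by positivity)
      (by positivity) hlam hlam' hdet (isSymm_sigma X P β) h2 h3 h1 hsmall hlamC hb' hT' hc
    rw [hA.score_eq] at this
    linarith
  refine (measure_mono hsub).trans ((measure_union_le _ _).trans ?_)
  rw [ae_iff.mp hag, add_zero]
  refine (measure_union_le _ _).trans (add_le_add le_rfl ((measure_union_le _ _).trans
    ((add_le_add t1' t2').trans ?_)))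
  rw [← ENNReal.ofReal_add (by positivity) (by positivity)]
  refine ENNReal.ofReal_le_ofReal (le_of_eq ?_)
  field_simp
  norm_num

end Probability

/-! ### Rates -/

section Rates

theorem sparsity_eq_zero_iff {p : ℕ} {β : Fin p → ℝ} : sparsity β = 0 ↔ β = 0 := by
  rw [sparsity, Set.ncard_eq_zero]
  constructor
  · intro h
    funext j
    by_contra hj
    exact (Set.eq_empty_iff_forall_notMem.mp h j) hj
  · rintro rfl; simp

variable {p : ℕ → ℕ}

theorem tendsto_log_mul_atTop (hp : ∀ n, 0 < p n) :
    Tendsto (fun n : ℕ => Real.log (n * p n)) atTop atTop := by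
  refine tendsto_atTop_mono' _ ?_ (Real.tendsto_log_atTop.comp tendsto_natCast_atTop_atTop)
  filter_upwards [eventually_gt_atTop 0] with n hn
  have hn' : (0 : ℝ) < n := by exact_mod_cast hn
  have hp1 : (1 : ℝ) ≤ p n := by exact_mod_cast hp n
  exact Real.log_le_log hn' (le_mul_of_one_le_right hn'.le hp1)

/-- Under the growth condition on the dimension along the `n` with `β n = 0`, the error rate of
`vhat` is of smaller order than the CLIME rate. -/
theorem eventually_rate_le (hp : ∀ n, 0 < p n) {β : ∀ n, Fin (p n) → ℝ}
    (hg : ∀ a : ℝ, 0 < a → (fun n => (p n : ℝ))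
        =o[atTop ⊓ 𝓟 {n | β n = 0}] fun n => Real.exp ((n : ℝ) ^ a))
    {δ₀ : ℝ} (hδ : 0 < δ₀) {c : ℝ} (hc : 0 < c) :
    ∀ᶠ n : ℕ in atTop, (1 + (sparsity (β n) : ℝ)) * (√(Real.log (n * p n)) / √(n : ℝ)) ≤
      c * max (sparsity (β n) * Real.log (n * p n) / √(n : ℝ))
        ((n : ℝ) ^ (-((1 : ℝ) / 3 - δ₀))) := by
  have hlog := tendsto_log_mul_atTop hp
  have e1 : ∀ᶠ n : ℕ in atTop, (2 / c) ^ 2 ≤ Real.log (n * p n) :=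
    hlog.eventually (eventually_ge_atTop _)
  -- The exponent `1/12` is one choice below `1/3`: the goal is `log (np) ≤ c² n^{1/3}`.
  have e2 : ∀ᶠ n : ℕ in atTop, β n = 0 → (p n : ℝ) ≤ Real.exp ((n : ℝ) ^ ((1 : ℝ) / 12)) := by
    have := ((hg (1 / 12) (by norm_num)).bound one_pos)
    rw [eventually_inf_principal] at this
    filter_upwards [this] with n h hn
    simpa using h hn
  have hc2 : 0 < c ^ 2 / 2 := by positivity
  have e3 : ∀ᶠ n : ℕ in atTop, Real.log n ≤ c ^ 2 / 2 * (n : ℝ) ^ ((1 : ℝ) / 3) := by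
    have := ((isLittleO_log_rpow_atTop (by norm_num : (0 : ℝ) < 1 / 3)).comp_tendsto
      tendsto_natCast_atTop_atTop).bound hc2
    filter_upwards [this] with n h
    simp only [Function.comp_apply] at h
    rw [Real.norm_of_nonneg (by positivity : (0 : ℝ) ≤ (n : ℝ) ^ ((1 : ℝ) / 3))] at h
    exact (le_abs_self _).trans h
  have e4 : ∀ᶠ n : ℕ in atTop, (n : ℝ) ^ ((1 : ℝ) / 12) ≤ c ^ 2 / 2 * (n : ℝ) ^ ((1 : ℝ) / 3) := by
    have h := ((tendsto_rpow_atTop (by norm_num : (0 : ℝ) < 1 / 4)).comp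
      tendsto_natCast_atTop_atTop).eventually (eventually_ge_atTop (c ^ 2 / 2)⁻¹)
    filter_upwards [h, eventually_gt_atTop 0] with n h hn
    have hn' : (0 : ℝ) < n := by exact_mod_cast hn
    have e : (n : ℝ) ^ ((1 : ℝ) / 3) = (n : ℝ) ^ ((1 : ℝ) / 12) * (n : ℝ) ^ ((1 : ℝ) / 4) := by
      rw [← Real.rpow_add hn']; norm_num
    rw [e, mul_left_comm]
    refine le_mul_of_one_le_right (by positivity) ?_
    have := mul_le_mul_of_nonneg_left h hc2.le
    rwa [mul_inv_cancel₀ hc2.ne'] at this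
  filter_upwards [e1, e2, e3, e4, eventually_gt_atTop 0] with n h1 h2 h3 h4 hn
  have hn' : (0 : ℝ) < n := by exact_mod_cast hn
  have hn1 : (1 : ℝ) ≤ n := by exact_mod_cast hn
  have hsn : 0 < √(n : ℝ) := Real.sqrt_pos.mpr hn'
  have hℓ : 0 < Real.log (n * p n) := lt_of_lt_of_le (by positivity) h1
  set ℓ := Real.log (n * p n) with hℓdef
  have hsq : √ℓ ^ 2 = ℓ := Real.sq_sqrt hℓ.le
  -- Without active coordinates only the power of `n` is left in the maximum, and the growth
  -- condition must make it dominate. Otherwise `1 + d ≤ 2 d`, and the diverging factor `√ℓ` is to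
  -- spare.
  rcases Nat.eq_zero_or_pos (sparsity (β n)) with hd | hd
  · have hb := h2 (sparsity_eq_zero_iff.mp hd)
    have hpn : (0 : ℝ) < p n := by exact_mod_cast hp n
    have hℓle : ℓ ≤ c ^ 2 * (n : ℝ) ^ ((1 : ℝ) / 3) := by
      have : Real.log (p n) ≤ (n : ℝ) ^ ((1 : ℝ) / 12) := (Real.log_le_iff_le_exp hpn).mpr hb
      rw [hℓdef, Real.log_mul hn'.ne' hpn.ne']
      linarith
    rw [hd, Nat.cast_zero, add_zero, one_mul]
    refine le_trans ?_ (mul_le_mul_of_nonneg_left (le_max_right _ _) hc.le)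
    have b1 : (n : ℝ) ^ (-((1 : ℝ) / 3)) ≤ (n : ℝ) ^ (-((1 : ℝ) / 3 - δ₀)) :=
      Real.rpow_le_rpow_of_exponent_le hn1 (by linarith)
    refine le_trans ?_ (mul_le_mul_of_nonneg_left b1 hc.le)
    rw [div_le_iff₀ hsn, Real.sqrt_le_left (by positivity), mul_pow, mul_pow,
      Real.sq_sqrt hn'.le, ← Real.rpow_natCast ((n : ℝ) ^ (-((1 : ℝ) / 3))) 2,
      ← Real.rpow_mul hn'.le]
    refine hℓle.trans (le_of_eq ?_)
    rw [mul_assoc]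
    congr 1
    nth_rewrite 3 [← Real.rpow_one (n : ℝ)]
    rw [← Real.rpow_add hn']
    norm_num
  · have hd1 : (1 : ℝ) ≤ sparsity (β n) := by exact_mod_cast hd
    refine le_trans ?_ (mul_le_mul_of_nonneg_left (le_max_left _ _) hc.le)
    have h5 : 2 ≤ c * √ℓ := by
      have := Real.sqrt_le_sqrt h1
      rw [Real.sqrt_sq (by positivity), div_le_iff₀ hc] at this
      linarith
    have hs0 := Real.sqrt_nonneg ℓ
    rw [mul_div_assoc', mul_div_assoc']
    refine div_le_div_of_nonneg_right ?_ hsn.le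
    calc (1 + (sparsity (β n) : ℝ)) * √ℓ ≤ (2 * sparsity (β n)) * √ℓ :=
          mul_le_mul_of_nonneg_right (by linarith) hs0
      _ ≤ (c * √ℓ * sparsity (β n)) * √ℓ :=
          mul_le_mul_of_nonneg_right (mul_le_mul_of_nonneg_right h5 (by linarith)) hs0
      _ = c * (sparsity (β n) * √ℓ ^ 2) := by ring
      _ = _ := by rw [hsq]

end Rates

end Cox

end

/-! ### The main result: choice of constants and comparison of rates. -/

theorem proposition2 (K : ℝ) (hK : 0 < K) :
    -- the threshold for the Lasso tuning parameter depends on the covariate bound only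
    ∃ A₀ : ℝ, 0 < A₀ ∧
    ∀ (L C B δ₀ : ℝ) (_ : 0 < L) (_ : 0 < δ₀)
      -- for each `n`: dimension, law of the generic triple, true parameters
      (p : ℕ → ℕ)
      (Ω : ℕ → Type*) [∀ n, MeasurableSpace (Ω n)]
      (P : ∀ n, Measure (Ω n)) [∀ n, IsProbabilityMeasure (P n)]
      (X : ∀ n, Cox.Triple (Ω n) (p n))
      (β : ∀ n, Fin (p n) → ℝ) (haz : ℕ → ℝ → ℝ)
      (_ : ∀ n, (X n).IsCoxModel (P n) (β n) (haz n))
      (_ : ∀ n, IsUnit ((X n).sigma (P n) (β n)).det)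
      (_ : ∀ n, Cox.l1 (β n) ≤ B)
      -- bounded and Lipschitz covariates, bounded density of the observed time
      (_ : ∀ n, (X n).BoundedCovariates (P n) K)
      (_ : ∀ n, (X n).LipschitzCovariates (P n) L)
      (_ : ∀ n, (X n).BoundedDensity (P n) C)
      -- sparsity of the regression vector
      (_ : (fun n => (Cox.sparsity (β n) : ℝ)) =o[atTop]
        fun n => √(n : ℝ) / √(Real.log (n * p n)))
      -- dimension growth, required only along those `n` for which `β n = 0`
      (_ : ∀ a : ℝ, 0 < a → (fun n => (p n : ℝ))
        =o[atTop ⊓ 𝓟 {n | β n = 0}] fun n => Real.exp ((n : ℝ) ^ a))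
      -- compatibility factor bounded away from zero in probability
      (_ : Cox.IsBigOpOne (fun n => Measure.pi fun _ : Fin n => P n)
        fun n ω => (Cox.kappa (X n) ω (β n))⁻¹)
      -- sparsity and size of the population precision matrix
      (_ : (fun n => Cox.opOne ((X n).sigma (P n) (β n))⁻¹ ^ 2 *
          max (Cox.sparsity (β n) * Real.log (n * p n) / √(n : ℝ))
            ((n : ℝ) ^ (-((1 : ℝ) / 3 - δ₀))) *
          (Cox.maxColSupport ((X n).sigma (P n) (β n))⁻¹ : ℝ)) =o[atTop]
        fun n => 1 / √(Real.log (n * p n)))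
      -- the Lasso tuning parameter and estimator
      (lam : ℕ → ℝ) (_ : ∀ n, 0 < lam n)
      (_ : lam =Θ[atTop] fun n => √(Real.log (n * p n)) / √(n : ℝ))
      (_ : ∀ᶠ n in atTop, A₀ * (√(Real.log (n * p n)) / √(n : ℝ)) ≤ lam n)
      (βhat : ∀ n, (Fin n → Ω n) → Fin (p n) → ℝ)
      (_ : ∀ n ω, Cox.IsLasso (X n) ω (lam n) (βhat n ω))
      -- the CLIME tuning parameter and estimator
      (lamC : ℕ → ℝ) (_ : ∀ n, 0 < lamC n)
      (_ : lamC =Θ[atTop] fun n =>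
        max (Cox.opOne ((X n).sigma (P n) (β n))⁻¹ *
            (Cox.sparsity (β n) * Real.log (n * p n) / √(n : ℝ)))
          (Cox.opOne ((X n).sigma (P n) (β n))⁻¹ * (n : ℝ) ^ (-((1 : ℝ) / 3 - δ₀))))
      (Θhat : ∀ n, (Fin n → Ω n) → Matrix (Fin (p n)) (Fin (p n)) ℝ)
      (_ : ∀ n ω, Cox.IsClime (Cox.vhat (X n) ω (βhat n ω)) (lamC n) (Θhat n ω))
      (c : ∀ n, Fin (p n) → ℝ) (_ : ∀ n, Cox.l1 (c n) = 1),
      Cox.IsLittleOp (fun n => Measure.pi fun _ : Fin n => P n)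
        (fun n ω => c n ⬝ᵥ
          (Θhat n ω - ((X n).sigma (P n) (β n))⁻¹) *ᵥ Cox.score (X n) ω (β n))
        (fun n => (n : ℝ) ^ (-(1 : ℝ) / 2)) := by
  -- The score is bounded by `5 * K * s`, and the Lasso analysis asks for three times that.
  refine ⟨15 * K, by positivity, ?_⟩
  intro L C B δ₀ _ hδ p Ω _ P _ X β haz hX hdet hβ hB hL hD hsp hg hκ hA4 lam hlam0 hlamΘ hlamA
    βhat hlasso lamC hlamC0 hlamCΘ Θhat hclime c hc
  -- In dimension zero the `ℓ₁` norm of `c n` would be an empty sum.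
  have hp : ∀ n, 0 < p n := by
    intro n
    rcases Nat.eq_zero_or_pos (p n) with h | h
    · have := hc n
      have : IsEmpty (Fin (p n)) := by rw [h]; infer_instance
      simp [Cox.l1] at *
    · exact h
  intro ε hε
  rw [ENNReal.tendsto_nhds_zero]
  intro ε' hε'
  obtain ⟨M, hM⟩ := hκ (ε' / 2) (ENNReal.half_pos hε'.ne')
  obtain ⟨C₁, hC₁, hup⟩ := hlamΘ.1.exists_pos
  obtain ⟨C₂, hC₂, hupC⟩ := hlamCΘ.1.exists_pos
  obtain ⟨C₃, hC₃, hlowC⟩ := hlamCΘ.2.exists_pos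
  have hM0 : (0 : ℝ) ≤ M := M.coe_nonneg
  -- The summand `1` keeps `κ₁` positive when `M = 0`.
  set κ₁ : ℝ := 2 * K * (32 * M ^ 2 * C₁) + 1 with hκ₁
  have hκ₁0 : 0 < κ₁ := by positivity
  set κ₂ : ℝ := 32 * K ^ 3 * (32 * M ^ 2 * C₁) +
    (72 * K ^ 2 * Real.exp (B * K) ^ 2 + 28 * K ^ 2) with hκ₂
  have hκ₂0 : 0 < κ₂ := by positivity
  -- The error of `vhat` at the Lasso estimator is at most `κ₂ (1 + d) s`, and `‖Σ⁻¹‖ R ≤ C₃ lamC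
  -- n`; with this constant the error times `‖Σ⁻¹‖` is at most `lamC n`.
  have hrate := Cox.eventually_rate_le hp hg hδ (c := (C₃ * κ₂)⁻¹) (by positivity)
  have hsp' := hsp.bound (c := (2 * κ₁)⁻¹) (by positivity)
  have hA4' := hA4.bound (c := ε / (20 * K * C₂)) (by positivity)
  have hlog := (Cox.tendsto_log_mul_atTop hp).eventually (eventually_ge_atTop 1)
  have h6 : ∀ᶠ n : ℕ in atTop, ENNReal.ofReal (6 / n) ≤ ε' / 2 := by
    have h : Tendsto (fun n : ℕ => ENNReal.ofReal (6 / n)) atTop (𝓝 0) := by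
      rw [← ENNReal.ofReal_zero]
      exact ENNReal.tendsto_ofReal (tendsto_const_div_atTop_nhds_zero_nat 6)
    exact ENNReal.tendsto_nhds_zero.mp h _ (ENNReal.half_pos hε'.ne')
  filter_upwards [hM, hup.bound, hupC.bound, hlowC.bound, hrate, hsp', hA4', hlog, h6, hlamA,
    eventually_gt_atTop 0] with n h1 h2 h3 h4 h5 h7 h8 h9 h10 h11 hn
  have hn' : (0 : ℝ) < n := by exact_mod_cast hn
  have hsn : 0 < √(n : ℝ) := Real.sqrt_pos.mpr hn'
  have hopn : 0 ≤ Cox.opOne ((X n).sigma (P n) (β n))⁻¹ := Cox.opOne_nonneg _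
  have hlam0' := hlam0 n
  rw [← mul_max_of_nonneg _ _ hopn] at h3 h4
  rw [Real.norm_of_nonneg (hlam0 n).le, Real.norm_of_nonneg (by positivity)] at h2
  set ℓ := Real.log (n * p n) with hℓ
  have hℓ0 : 0 < ℓ := by linarith
  have hsℓ : 0 < √ℓ := Real.sqrt_pos.mpr hℓ0
  set R := max (Cox.sparsity (β n) * ℓ / √(n : ℝ)) ((n : ℝ) ^ (-((1 : ℝ) / 3 - δ₀))) with hR
  set o := Cox.opOne ((X n).sigma (P n) (β n))⁻¹ with ho
  set r : ℝ := (Cox.maxColSupport ((X n).sigma (P n) (β n))⁻¹ : ℝ) with hr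
  set d : ℝ := (Cox.sparsity (β n) : ℝ) with hd
  have hd0 : 0 ≤ d := Nat.cast_nonneg _
  have hr0 : 0 ≤ r := Nat.cast_nonneg _
  have hR0 : 0 ≤ R := le_max_of_le_right (by positivity)
  set s := √ℓ / √(n : ℝ) with hs
  have hs0 : 0 < s := by positivity
  have hds : κ₁ * (d * s) ≤ 1 / 2 := by
    rw [Real.norm_of_nonneg hd0, Real.norm_of_nonneg (by positivity)] at h7
    calc κ₁ * (d * s) ≤ κ₁ * ((2 * κ₁)⁻¹ * (√n / √ℓ) * s) := by gcongr
      _ = 1 / 2 := by rw [hs]; field_simp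
  have hlamle : 32 * (M : ℝ) ^ 2 * d * lam n ≤ 32 * M ^ 2 * C₁ * (d * s) := by
    calc _ ≤ 32 * (M : ℝ) ^ 2 * d * (C₁ * s) := by gcongr
      _ = _ := by ring
  have hsmall : 2 * K * (32 * M ^ 2 * d * lam n) < 1 := by
    have h := mul_le_mul_of_nonneg_left hlamle (by positivity : 0 ≤ 2 * K)
    have hp0 : 0 ≤ d * s := by positivity
    rw [hκ₁, add_mul, one_mul] at hds
    linarith
  have hoR : o * R ≤ C₃ * lamC n := by
    rwa [Real.norm_of_nonneg (by positivity), Real.norm_of_nonneg (hlamC0 n).le] at h4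
  have hCo : lamC n ≤ C₂ * (o * R) := by
    rwa [Real.norm_of_nonneg (hlamC0 n).le, Real.norm_of_nonneg (by positivity)] at h3
  have hlC : (32 * K ^ 3 * (32 * M ^ 2 * d * lam n) +
      (72 * K ^ 2 * Real.exp (B * K) ^ 2 + 28 * K ^ 2) * s) * o ≤ lamC n := by
    have a1 : 32 * K ^ 3 * (32 * M ^ 2 * d * lam n) +
        (72 * K ^ 2 * Real.exp (B * K) ^ 2 + 28 * K ^ 2) * s ≤ κ₂ * ((1 + d) * s) := by
      have b1 := mul_le_mul_of_nonneg_left hlamle (by positivity : 0 ≤ 32 * K ^ 3)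
      have b2 : 0 ≤ 32 * K ^ 3 * (32 * M ^ 2 * C₁) * s := by positivity
      have b3 : 0 ≤ (72 * K ^ 2 * Real.exp (B * K) ^ 2 + 28 * K ^ 2) * (d * s) := by positivity
      rw [hκ₂]
      linarith
    calc _ ≤ κ₂ * ((C₃ * κ₂)⁻¹ * R) * o := by
          refine mul_le_mul_of_nonneg_right (a1.trans ?_) hopn
          exact mul_le_mul_of_nonneg_left h5 hκ₂0.le
      _ = o * R / C₃ := by field_simp
      _ ≤ lamC n := by rw [div_le_iff₀ hC₃]; linarith
  -- The assumed rate of `o² R r` is `1 / √ℓ`, which cancels the logarithm in `s` and leaves `1 /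
  -- √n`; the constant `20 = 4 * 5` explains the choice in `hA4'`.
  have ha : 4 * r * o * lamC n * (5 * K * s) ≤ ε * (n : ℝ) ^ (-(1 : ℝ) / 2) := by
    rw [Real.norm_of_nonneg (by positivity), Real.norm_of_nonneg (by positivity)] at h8
    have e : (n : ℝ) ^ (-(1 : ℝ) / 2) = 1 / √(n : ℝ) := by
      rw [neg_div, Real.rpow_neg hn'.le, ← Real.sqrt_eq_rpow, one_div]
    calc _ ≤ 4 * r * o * (C₂ * (o * R)) * (5 * K * s) := by gcongr
      _ = 20 * K * C₂ * s * (o ^ 2 * R * r) := by ring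
      _ ≤ 20 * K * C₂ * s * (ε / (20 * K * C₂) * (1 / √ℓ)) := by gcongr
      _ = _ := by rw [e, hs]; field_simp
  refine (Cox.measure_error_le hK (hX n) (hdet n) (hβ n) (hB n) (hL n) (hD n) hn (hp n) h9
    (hlam0 n) h11 hsmall hlC ha (hlasso n) (hclime n) (hc n)).trans ?_
  exact (add_le_add h1 h10).trans (ENNReal.add_halves ε').le
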